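/- Let $X$ be a topological space with a sheaf $\mathcal O$ of commutative $\mathbb C$-algebras whose sheaf $\mathcal T$ of $\mathbb C$-linear derivations is locally free of finite rank (e.g. a smooth complex algebraic variety, a complex manifold, or a $C^\infty$ manifold with complex-valued functions). Put $\Omega^1=\mathcal T^\vee$, let $\Omega^2$ and $\Omega^{3,cl}$ be the sheaves of alternating $\mathcal O$-bilinear, respectively closed alternating $\mathcal O$-trilinear, forms on $\mathcal T$, with the usual exterior derivative $d$, and for an $\mathcal O$-module $\mathcal F$ write $\Omega^1\otimes\mathcal F=\mathcal Hom_{\mathcal O}(\mathcal T,\mathcal F)$. Let $\mathcal A$ be a Lie algebroid on $X$, locally free of finite rank over $\mathcal O$, with surjective anchor $\pi:\mathcal A\to\mathcal T$; let $\mathfrak g=\ker\pi$, and let $\langle\ ,\ \rangle$ be a symmetric $\mathcal O$-bilinear pairing $\mathfrak g\times\mathfrak g\to\mathcal O$ with $\pi(a)\langle b,c\rangle=\langle[a,b],c\rangle+\langle b,[a,c]\rangle$ for $a\in\mathcal A$, $b,c\in\mathfrak g$. Let $\widehat{\mathfrak g}=\mathcal A^\vee\times_{\mathfrak g^\vee}\mathfrak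 g$, where $\mathfrak g\to\mathfrak g^\vee$ is given by the pairing; the transpose of $\pi$ and the projection give an exact sequence $0\to\Omega^1\to\widehat{\mathfrak g}\to\mathfrak g\to0$. Let $\alpha(\mathcal A)\in H^1(X;\Omega^1\otimes\mathfrak g)$ be the image of the class of $0\to\mathfrak g\to\mathcal A\to\mathcal T\to0$ under the canonical isomorphism $\operatorname{Ext}^1_{\mathcal O}(\mathcal T,\mathfrak g)\cong H^1(X;\Omega^1\otimes\mathfrak g)$, and let $\beta\in H^2(X;\Omega^1\otimes\Omega^1)$ be the image, under $\operatorname{Ext}^2_{\mathcal O}(\mathcal T,\Omega^1)\cong H^2(X;\Omega^1\otimes\Omega^1)$, of the class of the 2-extension $0\to\Omega^1\to\widehat{\mathfrak g}\to\mathcal A\to\mathcal T\to0$ obtained by splicing, i.e. of the Yoneda product of the classes of the two short exact sequences. Conventions. Let $\check C(\mathcal U)\to\mathbb Z$ be the Čech resolution $\cdots\to\bigoplus\mathbb Z_{U_{ij}}\to\bigoplus\mathbb Z_{U_i}$ of an open cover $\mathcal U=\{U_i\}$ (differential: alternating sum of the face maps). A Čech $n$-cocycle with values in a complex $K$ of sheaves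 is a morphism of complexes $\check C(\mathcal U)\to K[n]$; its class is the induced element of $H^n(X;K)=\operatorname{Hom}_{D(X)}(\mathbb Z,K[n])$. Cup products are computed with the Koszul sign, $(a\smile b)_{i_0\dots i_{p+q}}=(-1)^{pq}\,a_{i_0\dots i_p}\otimes b_{i_p\dots i_{p+q}}$. Let $\langle\alpha(\mathcal A)\smile\alpha(\mathcal A)\rangle\in H^2(X;\Omega^1\otimes\Omega^1)$ be the cup square of $\alpha(\mathcal A)$ with respect to the pairing $(a,b)\mapsto(\xi\mapsto(\eta\mapsto\langle a\xi,b\eta\rangle))$. 1. One has $$\beta=\langle\alpha(\mathcal A)\smile\alpha(\mathcal A)\rangle\quad\text{in }H^2(X;\Omega^1\otimes\Omega^1);$$ that is, $\alpha(\mathcal A)$ is represented by Čech 1-cocycles, and whenever $a$ and $b$ are Čech 1-cocycles of the same open cover that both represent $\alpha(\mathcal A)$, the cocycle $\langle a\smile b\rangle$ represents $\beta$. 2. Suppose that there are an open cover $\{U_i\}$ of $X$ and flat connections $\nabla_i$ on $\mathcal A|_{U_i}$ ($\mathcal O$-linear sections of $\pi$ which commute with brackets). Put $A_{ij}=\nabla_j-\nabla_i$,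 with values in $\mathfrak g$, and $$B_{ijk}=-\langle A_{ij}\wedge A_{jk}\rangle-\langle A_{jk}\wedge A_{ki}\rangle+\langle A_{ki}\wedge A_{ij}\rangle\in\Omega^2(U_i\cap U_j\cap U_k),\qquad H_{ij}=\langle A_{ij},[A_{ij},A_{ij}]\rangle\in\Omega^{3,cl}(U_i\cap U_j),$$ where $\langle a\wedge b\rangle(\xi,\eta)=\langle a\xi,b\eta\rangle-\langle a\eta,b\xi\rangle$ and $\langle a,[a,a]\rangle(\xi,\eta,\zeta)=\langle a\xi,[a\eta,a\zeta]\rangle$. Then $B$ and $H$ are the components of a unique Čech 2-cocycle class $\Pi(\mathcal A,\langle\ ,\ \rangle)\in H^2(X;\Omega^2\to\Omega^{3,cl})$ (with $\Omega^2$ in degree $0$), and for every choice of the cover and of the flat connections the image of this class in $H^2(X;\Omega^1\otimes\Omega^1)$ equals $\beta=\langle\alpha(\mathcal A)\smile\alpha(\mathcal A)\rangle$. Here the map on cohomology is induced by the projection of $\Omega^2\to\Omega^{3,cl}$ onto $\Omega^2$ and the inclusion of antisymmetric tensors $\Omega^2\to\Omega^1\otimes\Omega^1$, $\omega\mapsto(\xi\mapsto(\eta\mapsto\tfrac12\omega(\xi,\eta)))$.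 -/

import Mathlib

open CategoryTheory Limits Opposite TopologicalSpace Abelian

universe w w1 u

noncomputable section

namespace AtiyahPontryagin

/-- A sheaf of commutative `ℂ`-algebras on a topological space (the structure sheaf). -/
structure CAlgSheaf (X : TopCat.{u}) where
  ring : Sheaf (Opens.grothendieckTopology X) RingCat.{u}
  comm : ∀ (U : Opens X) (f g : ring.obj.obj (op U)), f * g = g * f
  scalar : ∀ U : Opens X, ℂ →+* ring.obj.obj (op U)
  scalar_res : ∀ (U V : Opens X) (h : V ≤ U) (c : ℂ),
    (ring.obj.map (homOfLE h).op).hom (scalar U c) = scalar V c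

variable {X : TopCat.{u}}

namespace CAlgSheaf

variable (O : CAlgSheaf X)

/-- The ring of sections over `U`. -/
abbrev Sec (U : Opens X) : Type u := O.ring.obj.obj (op U)

instance (U : Opens X) : CommRing (O.Sec U) :=
  { (inferInstance : Ring (O.Sec U)) with mul_comm := O.comm U }

/-- Restriction of functions. -/
def res {U V : Opens X} (h : V ≤ U) : O.Sec U →+* O.Sec V := (O.ring.obj.map (homOfLE h).op).hom

/-- The category of sheaves of `O`-modules. -/
abbrev Mod := SheafOfModules.{u} O.ring

/-- The structure sheaf as a module over itself. -/
abbrev unit : O.Mod := SheafOfModules.unit O.ring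

end CAlgSheaf

variable {O : CAlgSheaf X}

/-- Sections over `U` of a sheaf of modules. -/
abbrev MSec (M : O.Mod) (U : Opens X) : Type u := M.val.obj (op U)

/-- Restriction of sections of a sheaf of modules. -/
def mres (M : O.Mod) {U V : Opens X} (h : V ≤ U) : MSec M U →+ MSec M V :=
  (M.val.presheaf.map (homOfLE h).op).hom

lemma mres_smul (M : O.Mod) {U V : Opens X} (h : V ≤ U) (f : O.Sec U) (m : MSec M U) :
    mres M h (f • m) = O.res h f • mres M h m :=
  M.val.map_smul (homOfLE h).op f m

lemma mres_mres (M : O.Mod) {U V W : Opens X} (h : V ≤ U) (k : W ≤ V) (m : MSec M U) :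
    mres M k (mres M h m) = mres M (k.trans h) m :=
  (M.val.map_comp_apply (homOfLE h).op (homOfLE k).op m).symm

lemma mres_self (M : O.Mod) {U : Opens X} (h : U ≤ U) (m : MSec M U) : mres M h m = m := by
  have : M.val.presheaf.map (homOfLE h).op = 𝟙 _ := M.val.presheaf.map_id (op U)
  unfold mres
  rw [this]
  rfl

lemma mres_unit {U V : Opens X} (h : V ≤ U) (f : O.Sec U) : mres O.unit h f = O.res h f := rfl

/-- Sections of a sheaf are determined locally. -/
lemma msec_ext (M : O.Mod) {U : Opens X} (s t : MSec M U)
    (h : ∀ x ∈ U, ∃ V : Opens X, ∃ hV : V ≤ U, x ∈ V ∧ mres M hV s = mres M hV t) : s = t := by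
  choose V hV hx he using h
  refine TopCat.Sheaf.eq_of_locally_eq' (⟨M.val.presheaf, M.isSheaf⟩ : TopCat.Sheaf _ X)
    (fun x : U => V x.1 x.2) U (fun x => homOfLE (hV x.1 x.2)) ?_ s t ?_
  · intro x hxU
    exact Opens.mem_iSup.2 ⟨⟨x, hxU⟩, hx x hxU⟩
  · intro i
    exact he i.1 i.2

/-- Sections of a sheaf can be glued. -/
lemma msec_glue (M : O.Mod) {ι : Type u} (U : Opens X) (V : ι → Opens X) (hV : ∀ i, V i ≤ U)
    (hU : U ≤ iSup V) (s : ∀ i, MSec M (V i))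
    (hs : ∀ i j, mres M (inf_le_left : V i ⊓ V j ≤ V i) (s i) =
      mres M (inf_le_right : V i ⊓ V j ≤ V j) (s j)) :
    ∃ t : MSec M U, ∀ i, mres M (hV i) t = s i := by
  obtain rfl : U = iSup V := le_antisymm hU (iSup_le hV)
  obtain ⟨t, ht, -⟩ := TopCat.Sheaf.existsUnique_gluing
    (⟨M.val.presheaf, M.isSheaf⟩ : TopCat.Sheaf AddCommGrpCat.{u} X) V s (fun i j => hs i j)
  exact ⟨t, ht⟩

/-- The component over `U` of a morphism of sheaves of modules. -/
def happ {M N : O.Mod} (φ : M ⟶ N) (U : Opens X) : MSec M U →ₗ[O.Sec U] MSec N U :=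
  (φ.val.app (op U)).hom

lemma happ_mres {M N : O.Mod} (φ : M ⟶ N) {U V : Opens X} (h : V ≤ U) (m : MSec M U) :
    happ φ V (mres M h m) = mres N h (happ φ U m) :=
  PresheafOfModules.naturality_apply φ.val (homOfLE h).op m

lemma hom_ext' {M N : O.Mod} (φ ψ : M ⟶ N) (h : ∀ U m, happ φ U m = happ ψ U m) : φ = ψ := by
  apply SheafOfModules.hom_ext
  ext U m
  exact h U.unop m

/-- Constructor for morphisms of sheaves of modules from linear maps on sections. -/
def mkHom {M N : O.Mod} (φ : ∀ U, MSec M U →ₗ[O.Sec U] MSec N U)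
    (h : ∀ (U V : Opens X) (h : V ≤ U) (m : MSec M U), φ V (mres M h m) = mres N h (φ U m)) :
    M ⟶ N where
  val :=
    { app := fun U => ModuleCat.ofHom (φ U.unop)
      naturality := fun {U V} f => by
        ext m
        exact h U.unop V.unop f.unop.le m }

lemma happ_mkHom {M N : O.Mod} (φ : ∀ U, MSec M U →ₗ[O.Sec U] MSec N U) (h) (U : Opens X)
    (m : MSec M U) : happ (mkHom (M := M) (N := N) φ h) U m = φ U m := rfl

/-! ### Sheaves of local families -/

/-- A presheaf of sets on the open subsets of `X`. -/
structure PSet (X : TopCat.{u}) where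
  obj : Opens X → Type u
  res : ∀ {U V : Opens X}, V ≤ U → obj U → obj V
  res_res : ∀ {U V W : Opens X} (h : V ≤ U) (k : W ≤ V) (x : obj U),
    res k (res h x) = res (k.trans h) x

/-- The underlying presheaf of sets of a sheaf of modules. -/
abbrev sets (M : O.Mod) : PSet X := ⟨MSec M, fun h => mres M h, fun h k => mres_mres M h k⟩

/-- A condition on maps `D(V) → G(V)`, for all open `V`. -/
abbrev Cond (D : PSet X) (G : O.Mod) := ∀ V : Opens X, AddSubgroup (D.obj V → MSec G V)

/-- The group of families of maps `D(V) → G(V)`, for all open `V ⊆ U`, that commute with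
restrictions and satisfy the condition `P` over every `V`. -/
def famSec {D : PSet X} {G : O.Mod} (P : Cond D G) (U : Opens X) :
    AddSubgroup (∀ V : {V : Opens X // V ≤ U}, D.obj V.1 → MSec G V.1) where
  carrier := {f | (∀ (V W : Opens X) (hV : V ≤ U) (hW : W ≤ V) (x : D.obj V),
      mres G hW (f ⟨V, hV⟩ x) = f ⟨W, hW.trans hV⟩ (D.res hW x)) ∧ ∀ V, f V ∈ P V.1}
  zero_mem' := ⟨fun _ _ _ _ _ => map_zero _, fun V => (P V.1).zero_mem⟩
  add_mem' := fun {f g} hf hg => ⟨fun V W hV hW x => by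
    simp only [Pi.add_apply, map_add, hf.1, hg.1], fun V => (P V.1).add_mem (hf.2 V) (hg.2 V)⟩
  neg_mem' := fun {f} hf => ⟨fun V W hV hW x => by
    simp only [Pi.neg_apply, map_neg, hf.1], fun V => (P V.1).neg_mem (hf.2 V)⟩

section Fam

variable {D : PSet X} {G : O.Mod} {P : Cond D G}

/-- The value of a family over `V` at an element of `D(V)`. -/
def fval {U : Opens X} (f : famSec P U) {V : Opens X} (hV : V ≤ U) (x : D.obj V) : MSec G V :=
  f.1 ⟨V, hV⟩ x

lemma fval_mem {U : Opens X} (f : famSec P U) {V : Opens X} (hV : V ≤ U) : fval f hV ∈ P V :=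
  f.2.2 ⟨V, hV⟩

lemma fval_nat {U : Opens X} (f : famSec P U) {V W : Opens X} (hV : V ≤ U) (hW : W ≤ V)
    (x : D.obj V) : mres G hW (fval f hV x) = fval f (hW.trans hV) (D.res hW x) :=
  f.2.1 V W hV hW x

lemma fam_ext {U : Opens X} {f g : famSec P U}
    (h : ∀ (V : Opens X) (hV : V ≤ U) (x : D.obj V), fval f hV x = fval g hV x) : f = g :=
  Subtype.ext (funext fun V => funext fun x => h V.1 V.2 x)

/-- Constructor for families. -/
def mkFam {U : Opens X} (f : ∀ V : Opens X, V ≤ U → D.obj V → MSec G V)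
    (h : ∀ (V W : Opens X) (hV : V ≤ U) (hW : W ≤ V) (x : D.obj V),
      mres G hW (f V hV x) = f W (hW.trans hV) (D.res hW x))
    (hP : ∀ V hV, f V hV ∈ P V) : famSec P U :=
  ⟨fun V => f V.1 V.2, h, fun V => hP V.1 V.2⟩

/-- Restriction of families. -/
def famRes {U V : Opens X} (h : V ≤ U) : famSec P U →+ famSec P V where
  toFun f := mkFam (fun _ hW => fval f (hW.trans h)) (fun _ _ hA hB x => fval_nat f (hA.trans h) hB x)
    (fun _ hA => fval_mem f (hA.trans h))
  map_zero' := rfl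
  map_add' _ _ := rfl

variable (P) in
/-- The presheaf of families. -/
def famPresheaf : (Opens X)ᵒᵖ ⥤ AddCommGrpCat.{u} where
  obj U := AddCommGrpCat.of (famSec P U.unop)
  map i := AddCommGrpCat.ofHom (famRes i.unop.le)
  map_id _ := rfl
  map_comp _ _ := rfl

/-- The condition `P` is local. -/
def Cond.IsLocal (P : Cond D G) : Prop := ∀ (V : Opens X) (f : D.obj V → MSec G V),
  (∀ x ∈ V, ∃ W : Opens X, ∃ hW : W ≤ V, x ∈ W ∧ ∃ g ∈ P W, ∀ d, mres G hW (f d) = g (D.res hW d)) →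
    f ∈ P V

lemma famPresheaf_isSheaf (hP : P.IsLocal) :
    Presheaf.IsSheaf (Opens.grothendieckTopology X) (famPresheaf P) := by
  refine (TopCat.Presheaf.isSheaf_iff_isSheaf_comp (forget AddCommGrpCat.{u})
    (F := famPresheaf P)).2 (TopCat.Presheaf.isSheaf_of_isSheafUniqueGluing_types _ ?_)
  intro ι U sf hsf
  let s : ∀ i, famSec P (U i) := sf
  have hs : ∀ (i j : ι) (V : Opens X) (hi : V ≤ U i) (hj : V ≤ U j) (x : D.obj V),
      fval (s i) hi x = fval (s j) hj x := fun i j V hi hj x =>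
    congrArg (fun f : famSec P (U i ⊓ U j) => fval f (le_inf hi hj) x) (hsf i j)
  -- gluing of the values
  have key : ∀ (V : Opens X) (_ : V ≤ iSup U) (x : D.obj V), ∃ t : MSec G V,
      ∀ (i : ι) (W : Opens X) (hW : W ≤ V) (hi : W ≤ U i),
        mres G hW t = fval (s i) hi (D.res hW x) := by
    intro V hV x
    obtain ⟨t, ht⟩ := msec_glue G (ι := ι) V (fun i => V ⊓ U i) (fun i => inf_le_left)
      (by rw [← inf_iSup_eq]; exact le_inf le_rfl hV)
      (fun i => fval (s i) inf_le_right (D.res inf_le_left x)) (fun i j => by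
        rw [fval_nat, fval_nat, D.res_res, D.res_res]
        exact hs i j _ _ _ _)
    refine ⟨t, fun i W hW hi => ?_⟩
    have := congrArg (mres G (le_inf hW hi : W ≤ V ⊓ U i)) (ht i)
    rwa [mres_mres, fval_nat, D.res_res] at this
  have huniq : ∀ (V : Opens X) (_ : V ≤ iSup U) (a b : MSec G V),
      (∀ (i : ι) (W : Opens X) (hW : W ≤ V) (_ : W ≤ U i), mres G hW a = mres G hW b) → a = b := by
    intro V hV a b h
    refine msec_ext G a b fun x hx => ?_
    obtain ⟨i, hi⟩ := Opens.mem_iSup.1 (hV hx)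
    exact ⟨V ⊓ U i, inf_le_left, ⟨hx, hi⟩, h i _ inf_le_left inf_le_right⟩
  choose t ht using key
  refine ⟨mkFam t (fun V W hV hW x => ?_) (fun V hV => hP V _ fun x hx => ?_), ?_, ?_⟩
  · refine huniq W (hW.trans hV) _ _ fun i A hA hi => ?_
    rw [mres_mres, ht V hV x i A _ hi, ht W _ _ i A _ hi, D.res_res]
  · obtain ⟨i, hi⟩ := Opens.mem_iSup.1 (hV hx)
    exact ⟨V ⊓ U i, inf_le_left, ⟨hx, hi⟩, fval (s i) inf_le_right, fval_mem _ _,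
      fun d => ht V hV d i _ _ _⟩
  · intro i
    refine fam_ext (P := P) (f := _) (g := s i) fun V hV x => ?_
    refine huniq V (hV.trans (le_iSup U i)) _ _ fun j W hW hj => ?_
    refine (ht V _ x j W hW hj).trans ?_
    rw [fval_nat]
    exact hs j i W hj (hW.trans hV) _
  · intro f hf
    let f' : famSec P (iSup U) := f
    refine fam_ext (P := P) (f := f') fun V hV x => ?_
    refine huniq V hV _ _ fun i W hW hi => ?_
    refine Eq.trans ?_ (ht V hV x i W hW hi).symm
    rw [fval_nat]
    exact congrArg (fun f : famSec P (U i) => fval f hi (D.res hW x)) (hf i)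

/-- The abelian sheaf of families. -/
def famSheaf (P : Cond D G) (hP : P.IsLocal) :
    Sheaf (Opens.grothendieckTopology X) AddCommGrpCat.{u} :=
  ⟨famPresheaf P, famPresheaf_isSheaf hP⟩

/-- The condition `P` is stable under multiplication by functions. -/
class Cond.IsLin (P : Cond D G) : Prop where
  smul : ∀ (V : Opens X) (r : O.Sec V) (f : D.obj V → MSec G V), f ∈ P V → (fun x => r • f x) ∈ P V

instance famModule [P.IsLin] (U : Opens X) : Module (O.Sec U) (famSec P U) where
  smul r f := mkFam (fun _ hV x => O.res hV r • fval f hV x) (fun V W hV hW x => by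
    rw [mres_smul, fval_nat]; congr 1; exact mres_mres O.unit hV hW r)
    (fun V hV => Cond.IsLin.smul V _ _ (fval_mem f hV))
  one_smul f := fam_ext fun V hV x => by
    change O.res hV 1 • fval f hV x = _; rw [map_one, one_smul]
  mul_smul r s f := fam_ext fun V hV x => by
    change O.res hV (r * s) • fval f hV x = O.res hV r • (O.res hV s • fval f hV x)
    rw [map_mul, mul_smul]
  smul_zero r := fam_ext fun V hV x => smul_zero (O.res hV r)
  smul_add r f g := fam_ext fun V hV x => smul_add (O.res hV r) (fval f hV x) (fval g hV x)
  add_smul r s f := fam_ext fun V hV x => by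
    change O.res hV (r + s) • fval f hV x = O.res hV r • fval f hV x + O.res hV s • fval f hV x
    rw [map_add, add_smul]
  zero_smul f := fam_ext fun V hV x => by
    change O.res hV 0 • fval f hV x = 0
    rw [map_zero, zero_smul]

instance [P.IsLin] (U : (Opens X)ᵒᵖ) : Module (O.ring.obj.obj U) ((famPresheaf P).obj U) :=
  famModule (P := P) U.unop

/-- The sheaf of modules of families. -/
def famMod (P : Cond D G) [P.IsLin] (hP : P.IsLocal) : O.Mod where
  val := PresheafOfModules.ofPresheaf (famPresheaf P) (fun U V i r m => by
    refine fam_ext (P := P) (f := famRes i.unop.le (r • (m : famSec P U.unop))) fun W hW x => ?_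
    change O.res (hW.trans i.unop.le) r • fval (P := P) m _ x =
      O.res hW (O.res i.unop.le r) • fval (P := P) m _ x
    congr 1
    exact (mres_mres O.unit i.unop.le hW r).symm)
  isSheaf := famPresheaf_isSheaf hP

end Fam

/-! ### The sheaf `Hom(E, F)` and duals -/

/-- The condition of being `O(V)`-linear. -/
def linCond (E F : O.Mod) : Cond (sets E) F := fun V =>
  { carrier := {f | (∀ a b : MSec E V, f (a + b) = f a + f b) ∧
      ∀ (r : O.Sec V) (a : MSec E V), f (r • a) = r • f a}
    zero_mem' := ⟨fun _ _ => (add_zero 0).symm, fun r _ => (smul_zero r).symm⟩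
    add_mem' := fun {f g} hf hg =>
      ⟨fun a b => by simp only [Pi.add_apply, hf.1, hg.1]; abel,
        fun r a => by simp only [Pi.add_apply, hf.2, hg.2, smul_add]⟩
    neg_mem' := fun {f} hf =>
      ⟨fun a b => by simp only [Pi.neg_apply, hf.1]; abel,
        fun r a => by simp only [Pi.neg_apply, hf.2, smul_neg]⟩ }

instance (E F : O.Mod) : (linCond E F).IsLin where
  smul V r f hf := ⟨fun a b => by simp only [hf.1, smul_add], fun s a => by
    simp only [hf.2]; rw [smul_smul, smul_smul, mul_comm]⟩

lemma linCond_isLocal (E F : O.Mod) : (linCond E F).IsLocal := by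
  intro V f h
  refine ⟨fun a b => ?_, fun r a => ?_⟩
  · refine msec_ext F _ _ fun x hx => ?_
    obtain ⟨W, hW, hxW, g, hg, hf⟩ := h x hx
    refine ⟨W, hW, hxW, ?_⟩
    rw [map_add, hf, hf, hf]
    exact (congrArg g (map_add (mres E hW) a b)).trans (hg.1 _ _)
  · refine msec_ext F _ _ fun x hx => ?_
    obtain ⟨W, hW, hxW, g, hg, hf⟩ := h x hx
    refine ⟨W, hW, hxW, ?_⟩
    rw [mres_smul, hf, hf]
    exact (congrArg g (mres_smul E hW r a)).trans (hg.2 _ _)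

/-- The sheaf `Hom(E, F)` of `O`-linear maps: a section over `U` is a morphism `E|U → F|U`. -/
abbrev homMod (E F : O.Mod) : O.Mod := famMod (linCond E F) (linCond_isLocal E F)

/-- The linear map on sections over `V ⊆ U` given by a section of `Hom(E, F)` over `U`. -/
def hval {E F : O.Mod} {U : Opens X} (f : MSec (homMod E F) U) {V : Opens X} (hV : V ≤ U) :
    MSec E V →ₗ[O.Sec V] MSec F V where
  toFun := fval (P := linCond E F) f hV
  map_add' := (fval_mem (P := linCond E F) f hV).1
  map_smul' := (fval_mem (P := linCond E F) f hV).2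

lemma hval_nat {E F : O.Mod} {U : Opens X} (f : MSec (homMod E F) U) {V W : Opens X} (hV : V ≤ U)
    (hW : W ≤ V) (x : MSec E V) :
    mres F hW (hval f hV x) = hval f (hW.trans hV) (mres E hW x) :=
  fval_nat (P := linCond E F) f hV hW x

lemma hom_sec_ext {E F : O.Mod} {U : Opens X} {f g : MSec (homMod E F) U}
    (h : ∀ (V : Opens X) (hV : V ≤ U) (x : MSec E V), hval f hV x = hval g hV x) : f = g :=
  fam_ext (P := linCond E F) h

/-- Constructor for sections of `Hom(E, F)`. -/
def mkHomSec {E F : O.Mod} {U : Opens X} (f : ∀ V : Opens X, V ≤ U → MSec E V →ₗ[O.Sec V] MSec F V)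
    (h : ∀ (V W : Opens X) (hV : V ≤ U) (hW : W ≤ V) (x : MSec E V),
      mres F hW (f V hV x) = f W (hW.trans hV) (mres E hW x)) : MSec (homMod E F) U :=
  mkFam (P := linCond E F) (fun V hV => f V hV) h
    (fun V hV => ⟨map_add (f V hV), map_smul (f V hV)⟩)

lemma hval_mkHomSec {E F : O.Mod} {U : Opens X} (f) (h) {V : Opens X} (hV : V ≤ U) :
    hval (mkHomSec (E := E) (F := F) (U := U) f h) hV = f V hV := rfl

lemma hval_res {E F : O.Mod} {U V W : Opens X} (hV : V ≤ U) (hW : W ≤ V)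
    (f : MSec (homMod E F) U) : hval (mres (homMod E F) hV f) hW = hval f (hW.trans hV) := rfl

lemma hval_add {E F : O.Mod} {U V : Opens X} (hV : V ≤ U) (f g : MSec (homMod E F) U) :
    hval (f + g) hV = hval f hV + hval g hV := rfl

lemma hval_sub {E F : O.Mod} {U V : Opens X} (hV : V ≤ U) (f g : MSec (homMod E F) U) :
    hval (f - g) hV = hval f hV - hval g hV := rfl

lemma hval_zero {E F : O.Mod} {U V : Opens X} (hV : V ≤ U) :
    hval (0 : MSec (homMod E F) U) hV = 0 := rfl

lemma hval_smul {E F : O.Mod} {U V : Opens X} (hV : V ≤ U) (r : O.Sec U)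
    (f : MSec (homMod E F) U) : hval (r • f) hV = O.res hV r • hval f hV := rfl

/-- Composition with a morphism `F ⟶ F'`. -/
def homPost (E : O.Mod) {F F' : O.Mod} (φ : F ⟶ F') : homMod E F ⟶ homMod E F' :=
  mkHom (fun U =>
    { toFun := fun f => mkHomSec (fun V hV => happ φ V ∘ₗ hval f hV) (fun V W hV hW x => by
        simp only [LinearMap.comp_apply]; rw [← happ_mres, hval_nat])
      map_add' := fun f g => hom_sec_ext fun V hV x => map_add (happ φ V) (hval f hV x) (hval g hV x)
      map_smul' := fun r f => hom_sec_ext fun V hV x =>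
        map_smul (happ φ V) (O.res hV r) (hval f hV x) })
    (fun _ _ _ _ => rfl)

lemma hval_homPost {E F F' : O.Mod} (φ : F ⟶ F') {U V : Opens X} (hV : V ≤ U)
    (f : MSec (homMod E F) U) (x : MSec E V) :
    hval (happ (homPost E φ) U f) hV x = happ φ V (hval f hV x) := rfl

/-- Composition with a morphism `E ⟶ E'`. -/
def homPre {E E' : O.Mod} (F : O.Mod) (φ : E ⟶ E') : homMod E' F ⟶ homMod E F :=
  mkHom (fun U =>
    { toFun := fun f => mkHomSec (fun V hV => hval f hV ∘ₗ happ φ V) (fun V W hV hW x => by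
        simp only [LinearMap.comp_apply]; rw [hval_nat, happ_mres])
      map_add' := fun f g => hom_sec_ext fun V hV x => rfl
      map_smul' := fun r f => hom_sec_ext fun V hV x => rfl })
    (fun _ _ _ _ => rfl)

lemma hval_homPre {E E' F : O.Mod} (φ : E ⟶ E') {U V : Opens X} (hV : V ≤ U)
    (f : MSec (homMod E' F) U) (x : MSec E V) :
    hval (happ (homPre F φ) U f) hV x = hval f hV (happ φ V x) := rfl

/-- The dual sheaf. -/
abbrev dual (E : O.Mod) : O.Mod := homMod E O.unit

/-- The functor `Hom(E, -)` from `O`-modules to abelian sheaves. -/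
def homFunctor (E : O.Mod) : O.Mod ⥤ Sheaf (Opens.grothendieckTopology X) AddCommGrpCat.{u} where
  obj F := (SheafOfModules.toSheaf O.ring).obj (homMod E F)
  map φ := (SheafOfModules.toSheaf O.ring).map (homPost E φ)
  map_id F := by
    have : homPost E (𝟙 F) = 𝟙 _ := rfl
    rw [this, CategoryTheory.Functor.map_id]
  map_comp φ ψ := by
    have : homPost E (φ ≫ ψ) = homPost E φ ≫ homPost E ψ := rfl
    rw [this, CategoryTheory.Functor.map_comp]

instance (E : O.Mod) : (homFunctor E).Additive where
  map_add {F F' φ ψ} := by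
    have : homPost E (φ + ψ) = homPost E φ + homPost E ψ := rfl
    change (SheafOfModules.toSheaf O.ring).map _ = _
    rw [this, Functor.map_add]
    rfl

/-! ### Locally free modules, vector fields and differential forms -/

/-- `M` is locally free of finite rank: every point has a neighbourhood over which `M` has a
finite frame, i.e. finitely many sections which restrict to a basis over all smaller open sets. -/
def IsLocallyFree (M : O.Mod) : Prop :=
  ∀ x : X, ∃ U : Opens X, x ∈ U ∧ ∃ (n : ℕ) (e : Fin n → MSec M U),
    ∀ (V : Opens X) (hV : V ≤ U), ∃ b : Module.Basis (Fin n) (O.Sec V) (MSec M V),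
      ∀ i, b i = mres M hV (e i)

/-- The condition of being a `ℂ`-linear derivation of `O(V)`. -/
structure IsDer {V : Opens X} (δ : O.Sec V → O.Sec V) : Prop where
  add : ∀ f g, δ (f + g) = δ f + δ g
  mul : ∀ f g, δ (f * g) = f * δ g + g * δ f
  scalar : ∀ c : ℂ, δ (O.scalar V c) = 0

lemma IsDer.zero' (V : Opens X) : IsDer (fun _ : O.Sec V => (0 : O.Sec V)) :=
  ⟨fun _ _ => (add_zero 0).symm, fun f g => by ring, fun _ => rfl⟩

lemma IsDer.add' {V : Opens X} {δ ε : O.Sec V → O.Sec V} (hδ : IsDer δ) (hε : IsDer ε) :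
    IsDer (fun f => δ f + ε f) :=
  ⟨fun f g => by rw [hδ.add, hε.add]; ring, fun f g => by rw [hδ.mul, hε.mul]; ring,
    fun c => by rw [hδ.scalar, hε.scalar, add_zero]⟩

lemma IsDer.smul' {V : Opens X} {δ : O.Sec V → O.Sec V} (hδ : IsDer δ) (r : O.Sec V) :
    IsDer (fun f => r * δ f) :=
  ⟨fun f g => by rw [hδ.add]; ring, fun f g => by rw [hδ.mul]; ring,
    fun c => by rw [hδ.scalar, mul_zero]⟩

lemma IsDer.neg' {V : Opens X} {δ : O.Sec V → O.Sec V} (hδ : IsDer δ) :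
    IsDer (fun f => - δ f) :=
  ⟨fun f g => by rw [hδ.add]; ring, fun f g => by rw [hδ.mul]; ring,
    fun c => by rw [hδ.scalar, neg_zero]⟩

lemma IsDer.comm' {V : Opens X} {δ ε : O.Sec V → O.Sec V} (hδ : IsDer δ) (hε : IsDer ε) :
    IsDer (fun f => δ (ε f) - ε (δ f)) :=
  ⟨fun f g => by rw [hδ.add, hε.add, hδ.add, hε.add]; ring,
    fun f g => by rw [hδ.mul, hε.mul, hδ.add, hε.add, hδ.mul, hε.mul, hδ.mul, hε.mul]; ring,
    fun c => by
      have h0 : δ 0 = 0 := by simpa using hδ.scalar 0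
      have h1 : ε 0 = 0 := by simpa using hε.scalar 0
      rw [hδ.scalar, hε.scalar, h0, h1, sub_zero]⟩

variable (O) in
/-- The condition of being a `ℂ`-linear derivation. -/
def derCond : Cond (sets O.unit) O.unit := fun V =>
  { carrier := {δ | IsDer (O := O) (V := V) δ}
    zero_mem' := IsDer.zero' V
    add_mem' := fun hδ hε => IsDer.add' hδ hε
    neg_mem' := fun hδ => IsDer.neg' hδ }

instance : (derCond O).IsLin where
  smul _ r _ hδ := IsDer.smul' hδ r

lemma osec_ext {U : Opens X} (s t : O.Sec U)
    (h : ∀ x ∈ U, ∃ V : Opens X, ∃ hV : V ≤ U, x ∈ V ∧ O.res hV s = O.res hV t) : s = t :=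
  msec_ext O.unit s t h

variable (O) in
lemma derCond_isLocal : (derCond O).IsLocal := by
  intro V (δ : O.Sec V → O.Sec V) h
  refine ⟨fun f g => osec_ext _ _ fun x hx => ?_, fun f g => osec_ext _ _ fun x hx => ?_,
    fun c => osec_ext _ _ fun x hx => ?_⟩ <;> obtain ⟨W, hW, hxW, ε, hε, hf⟩ := h x hx <;>
    refine ⟨W, hW, hxW, ?_⟩ <;> replace hf : ∀ d, O.res hW (δ d) = ε (O.res hW d) := hf
  · rw [map_add, hf, hf, hf, map_add, IsDer.add hε]
  · rw [map_add, map_mul, map_mul, hf, hf, hf, map_mul, IsDer.mul hε]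
  · rw [hf, map_zero]
    exact (congrArg ε (O.scalar_res V W hW c)).trans (IsDer.scalar hε c)

variable (O) in
/-- The tangent sheaf: the sheaf of `ℂ`-linear derivations of `O`. -/
abbrev tangent : O.Mod := famMod (derCond O) (derCond_isLocal O)

/-- The action of a vector field on functions. -/
def act {U : Opens X} (ξ : MSec (tangent O) U) (f : O.Sec U) : O.Sec U :=
  fval (P := derCond O) ξ le_rfl f

section Tangent

variable {U V : Opens X}

lemma act_add (ξ : MSec (tangent O) U) (f g : O.Sec U) : act ξ (f + g) = act ξ f + act ξ g :=
  (fval_mem (P := derCond O) ξ le_rfl).add f g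

lemma act_mul (ξ : MSec (tangent O) U) (f g : O.Sec U) :
    act ξ (f * g) = f * act ξ g + g * act ξ f :=
  (fval_mem (P := derCond O) ξ le_rfl).mul f g

lemma act_neg (ξ : MSec (tangent O) U) (f : O.Sec U) : act ξ (-f) = - act ξ f :=
  map_neg (AddMonoidHom.mk' (act ξ) (act_add ξ)) f

lemma act_sub (ξ : MSec (tangent O) U) (f g : O.Sec U) : act ξ (f - g) = act ξ f - act ξ g :=
  map_sub (AddMonoidHom.mk' (act ξ) (act_add ξ)) f g

lemma act_zero (ξ : MSec (tangent O) U) : act ξ 0 = 0 :=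
  map_zero (AddMonoidHom.mk' (act ξ) (act_add ξ))

lemma add_act (ξ η : MSec (tangent O) U) (f : O.Sec U) : act (ξ + η) f = act ξ f + act η f := rfl

lemma smul_act (r : O.Sec U) (ξ : MSec (tangent O) U) (f : O.Sec U) :
    act (r • ξ) f = r * act ξ f :=
  congrArg (· * act ξ f) (mres_self O.unit le_rfl r)

lemma act_res (h : V ≤ U) (ξ : MSec (tangent O) U) (f : O.Sec U) :
    O.res h (act ξ f) = act (mres _ h ξ) (O.res h f) :=
  fval_nat (P := derCond O) ξ le_rfl h f

lemma vec_ext {ξ η : MSec (tangent O) U}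
    (h : ∀ (V : Opens X) (hV : V ≤ U) (f : O.Sec V), act (mres _ hV ξ) f = act (mres _ hV η) f) :
    ξ = η :=
  fam_ext (P := derCond O) h

lemma commutator_res (hV : V ≤ U) (ξ η : MSec (tangent O) U) (f : O.Sec U) :
    O.res hV (act ξ (act η f) - act η (act ξ f)) =
      act (mres _ hV ξ) (act (mres _ hV η) (O.res hV f)) -
        act (mres _ hV η) (act (mres _ hV ξ) (O.res hV f)) := by
  rw [map_sub, act_res, act_res, act_res, act_res]

/-- The commutator of vector fields. -/
def lie (ξ η : MSec (tangent O) U) : MSec (tangent O) U :=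
  mkFam (P := derCond O)
    (fun _ hV f => act (mres _ hV ξ) (act (mres _ hV η) f) - act (mres _ hV η) (act (mres _ hV ξ) f))
    (fun _ _ hV hW f => commutator_res hW (mres _ hV ξ) (mres _ hV η) f)
    (fun _ hV => IsDer.comm' (fval_mem (P := derCond O) (mres _ hV ξ) le_rfl)
      (fval_mem (P := derCond O) (mres _ hV η) le_rfl))

lemma lie_res (h : V ≤ U) (ξ η : MSec (tangent O) U) :
    mres _ h (lie ξ η) = lie (mres _ h ξ) (mres _ h η) := rfl

lemma lie_act (ξ η : MSec (tangent O) U) (f : O.Sec U) :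
    act (lie ξ η) f = act ξ (act η f) - act η (act ξ f) := rfl

end Tangent

/-- The sheaf of 1-forms, the dual of the tangent sheaf. -/
abbrev Omega1 (O : CAlgSheaf X) : O.Mod := dual (tangent O)

/-! ### Lie algebroids -/

variable (O) in
/-- A Lie algebroid over `(X, O)`. -/
structure LieAlgebroid where
  mod : O.Mod
  anchor : mod ⟶ tangent O
  bracket : ∀ U : Opens X, MSec mod U → MSec mod U → MSec mod U
  bracket_res : ∀ (U V : Opens X) (h : V ≤ U) (a b : MSec mod U),
    mres mod h (bracket U a b) = bracket V (mres mod h a) (mres mod h b)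
  add_bracket : ∀ (U : Opens X) (a b c : MSec mod U),
    bracket U (a + b) c = bracket U a c + bracket U b c
  bracket_add : ∀ (U : Opens X) (a b c : MSec mod U),
    bracket U a (b + c) = bracket U a b + bracket U a c
  bracket_self : ∀ (U : Opens X) (a : MSec mod U), bracket U a a = 0
  jacobi : ∀ (U : Opens X) (a b c : MSec mod U),
    bracket U a (bracket U b c) = bracket U (bracket U a b) c + bracket U b (bracket U a c)
  leibniz : ∀ (U : Opens X) (a b : MSec mod U) (f : O.Sec U),
    bracket U a (f • b) = f • bracket U a b + act (happ anchor U a) f • b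
  anchor_bracket : ∀ (U : Opens X) (a b : MSec mod U),
    happ anchor U (bracket U a b) = lie (happ anchor U a) (happ anchor U b)

namespace LieAlgebroid

variable (A : LieAlgebroid O)

/-- The anchor is a surjective morphism of sheaves. -/
def IsTransitive : Prop :=
  ∀ (U : Opens X) (ξ : MSec (tangent O) U), ∀ x ∈ U, ∃ V : Opens X, ∃ hV : V ≤ U, x ∈ V ∧
    ∃ a : MSec A.mod V, happ A.anchor V a = mres _ hV ξ

/-- The sections over `U` of the kernel of the anchor. -/
abbrev ker (U : Opens X) : Submodule (O.Sec U) (MSec A.mod U) := LinearMap.ker (happ A.anchor U)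

/-- The kernel of the anchor, as a sheaf of modules. -/
abbrev g : O.Mod := kernel A.anchor

/-- The inclusion of the kernel of the anchor. -/
abbrev gι : A.g ⟶ A.mod := kernel.ι A.anchor

variable {A}

lemma lie_zero {U : Opens X} (ξ : MSec (tangent O) U) : lie ξ 0 = 0 :=
  vec_ext fun V hV f => by
    rw [lie_res, lie_act]
    have h0 : ∀ k : O.Sec V, act (mres _ hV (0 : MSec (tangent O) U)) k = 0 := fun _ => rfl
    rw [h0, h0, act_zero, sub_zero]

/-- The action of a section of `A` on the kernel of the anchor. -/
def ad {U : Opens X} (a : MSec A.mod U) (b : A.ker U) : A.ker U :=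
  ⟨A.bracket U a b, by
    rw [LinearMap.mem_ker, A.anchor_bracket, LinearMap.mem_ker.1 b.2, lie_zero]⟩

/-- Restriction of sections of the kernel of the anchor. -/
def kres {U V : Opens X} (h : V ≤ U) (b : A.ker U) : A.ker V :=
  ⟨mres A.mod h b, by rw [LinearMap.mem_ker, happ_mres, LinearMap.mem_ker.1 b.2, map_zero]⟩

/-- The section of the kernel of the anchor given by a section of the sheaf `A.g`. -/
def toKer {U : Opens X} : MSec A.g U →ₗ[O.Sec U] A.ker U :=
  LinearMap.codRestrict (A.ker U) (happ A.gι U) (fun b => by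
    have : A.gι ≫ A.anchor = 0 := kernel.condition A.anchor
    exact congrArg (fun φ : A.g ⟶ tangent O => happ φ U b) this)

lemma toKer_mres {U V : Opens X} (h : V ≤ U) (b : MSec A.g U) :
    toKer (mres A.g h b) = kres h (toKer b) :=
  Subtype.ext (happ_mres A.gι h b)

variable (A)

/-- A symmetric `O`-bilinear pairing on the kernel of the anchor which is invariant under the
adjoint action of `A`. -/
structure InvariantPairing where
  pair : ∀ U : Opens X, A.ker U → A.ker U → O.Sec U
  pair_res : ∀ (U V : Opens X) (h : V ≤ U) (a b : A.ker U),
    O.res h (pair U a b) = pair V (kres h a) (kres h b)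
  add_pair : ∀ (U : Opens X) (a b c : A.ker U), pair U (a + b) c = pair U a c + pair U b c
  smul_pair : ∀ (U : Opens X) (f : O.Sec U) (a b : A.ker U), pair U (f • a) b = f * pair U a b
  symm : ∀ (U : Opens X) (a b : A.ker U), pair U a b = pair U b a
  invariant : ∀ (U : Opens X) (a : MSec A.mod U) (b c : A.ker U),
    act (happ A.anchor U a) (pair U b c) = pair U (ad a b) c + pair U b (ad a c)

variable {A}

namespace InvariantPairing

variable (p : A.InvariantPairing)

lemma pair_add (U : Opens X) (a b c : A.ker U) : p.pair U a (b + c) = p.pair U a b + p.pair U a c := by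
  rw [p.symm, p.add_pair, p.symm U b, p.symm U c]

lemma pair_smul (U : Opens X) (f : O.Sec U) (a b : A.ker U) :
    p.pair U a (f • b) = f * p.pair U a b := by
  rw [p.symm, p.smul_pair, p.symm]

/-- The morphism `g ⟶ g^∨` given by the pairing. -/
def toDual : A.g ⟶ dual A.g :=
  mkHom (fun U =>
    { toFun := fun b => mkHomSec (fun V hV =>
        { toFun := fun c => (p.pair V (toKer (mres A.g hV b)) (toKer c) : O.Sec V)
          map_add' := fun c d => by rw [map_add]; exact p.pair_add V _ _ _
          map_smul' := fun f c => by rw [map_smul]; exact p.pair_smul V _ _ _ })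
        (fun V W hV hW c => (p.pair_res V W hW _ _).trans (by
          rw [← toKer_mres, ← toKer_mres, mres_mres]; rfl))
      map_add' := fun b c => hom_sec_ext fun V hV d => by
        change p.pair V (toKer (mres A.g hV (b + c))) _ = p.pair V _ _ + p.pair V _ _
        rw [map_add, map_add]; exact p.add_pair V _ _ _
      map_smul' := fun f b => hom_sec_ext fun V hV d => by
        change p.pair V (toKer (mres A.g hV (f • b))) _ = O.res hV f * p.pair V _ _
        rw [mres_smul, map_smul]; exact p.smul_pair V _ _ _ })
    (fun U V h b => hom_sec_ext fun W hW d => by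
      change p.pair W (toKer (mres A.g hW (mres A.g h b))) _ = p.pair W _ _
      rw [mres_mres])

/-- The sheaf `ĝ = A^∨ ×_{g^∨} g`. -/
abbrev gHat : O.Mod := pullback (homPre O.unit A.gι) p.toDual

/-- The inclusion `Ω^1 ⟶ ĝ`, induced by the transpose of the anchor. -/
def fromOmega : Omega1 O ⟶ p.gHat :=
  pullback.lift (homPre O.unit A.anchor) 0 (by
    have h1 : homPre O.unit A.anchor ≫ homPre O.unit A.gι = homPre O.unit (A.gι ≫ A.anchor) := rfl
    have h2 : A.gι ≫ A.anchor = 0 := kernel.condition _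
    rw [h1, h2, zero_comp]
    exact hom_ext' _ _ fun U m => hom_sec_ext fun V hV x => map_zero (hval m hV))

end InvariantPairing

end LieAlgebroid

/-! ### Exactness of sequences of sheaves -/

/-- The category of abelian sheaves on `X`. -/
abbrev ShAb (X : TopCat.{u}) := Sheaf (Opens.grothendieckTopology X) AddCommGrpCat.{u}

variable (O) in
/-- The underlying abelian sheaf of a sheaf of modules. -/
abbrev toShAb : O.Mod ⥤ ShAb X := SheafOfModules.toSheaf O.ring

lemma map_epi_of_adj {C D E : Type*} [Category* C] [Category* D] [Category* E] [Abelian C]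
    [Abelian D] {a : D ⥤ C} {r : C ⥤ D} (adj : a ⊣ r) [IsIso adj.counit] [PreservesFiniteLimits a]
    (T : C ⥤ E) [(a ⋙ T).PreservesEpimorphisms] {M N : C} (p : M ⟶ N) [Epi p] :
    Epi (T.map p) := by
  have hp : a.map (r.map p) ≫ adj.counit.app N = adj.counit.app M ≫ p := adj.counit.naturality p
  have hq : a.map (Abelian.factorThruImage (r.map p)) ≫ a.map (Abelian.image.ι (r.map p)) =
      a.map (r.map p) := by
    rw [← Functor.map_comp, Abelian.image.fac]
  have h0 : a.map (r.map p) = adj.counit.app M ≫ p ≫ inv (adj.counit.app N) := by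
    rw [← Category.assoc, ← hp, Category.assoc, IsIso.hom_inv_id, Category.comp_id]
  have h1 : Epi (a.map (Abelian.image.ι (r.map p))) := by
    have : Epi (a.map (Abelian.factorThruImage (r.map p)) ≫ a.map (Abelian.image.ι (r.map p))) := by
      rw [hq, h0]
      infer_instance
    exact epi_of_epi (a.map (Abelian.factorThruImage (r.map p))) _
  have h2 : IsIso (a.map (Abelian.image.ι (r.map p))) := isIso_of_mono_of_epi _
  have h4 : Epi (T.map (a.map (Abelian.factorThruImage (r.map p)))) :=
    inferInstanceAs (Epi ((a ⋙ T).map (Abelian.factorThruImage (r.map p))))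
  have h6 : T.map p = inv (T.map (adj.counit.app M)) ≫
      (T.map (a.map (Abelian.factorThruImage (r.map p))) ≫
        T.map (a.map (Abelian.image.ι (r.map p)))) ≫ T.map (adj.counit.app N) := by
    rw [← T.map_comp, hq, ← T.map_comp, hp, T.map_comp, IsIso.inv_hom_id_assoc]
  rw [h6]
  infer_instance

instance sheafify_preservesEpi :
    (PresheafOfModules.sheafification.{u} (𝟙 O.ring.obj) ⋙ toShAb O).PreservesEpimorphisms :=
  inferInstanceAs (PresheafOfModules.toPresheaf.{u} O.ring.obj ⋙
    presheafToSheaf (Opens.grothendieckTopology X) AddCommGrpCat.{u}).PreservesEpimorphisms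

instance toSheaf_epi {M N : O.Mod} (p : M ⟶ N) [Epi p] : Epi ((toShAb O).map p) :=
  map_epi_of_adj (PresheafOfModules.sheafificationAdjunction.{u} (𝟙 O.ring.obj)) (toShAb O) p

/-- The component over `U` of a morphism of abelian sheaves. -/
abbrev sapp {F G : ShAb X} (φ : F ⟶ G) (U : Opens X) (s : F.obj.obj (op U)) : G.obj.obj (op U) :=
  (φ.hom.app (op U)).hom s

lemma epi_iff_locally {F G : ShAb X} (φ : F ⟶ G) :
    Epi φ ↔ ∀ (U : Opens X) (t : G.obj.obj (op U)), ∀ x ∈ U, ∃ V : Opens X, ∃ hV : V ≤ U, x ∈ V ∧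
      ∃ s : F.obj.obj (op V), sapp φ V s = (G.obj.map (homOfLE hV).op).hom t := by
  have h := (TopCat.Sheaf.isLocallySurjective_iff_epi (F := F) (G := G) φ).symm.trans
    (TopCat.Presheaf.isLocallySurjective_iff φ.hom)
  refine h.trans (forall_congr' fun U => forall_congr' fun t => forall_congr' fun x =>
    forall_congr' fun hx => exists_congr fun V => exists_congr fun hV => ?_)
  exact and_comm

lemma mono_of_sections {F G : ShAb X} (φ : F ⟶ G)
    (h : ∀ (U : Opens X), Function.Injective (sapp φ U)) : Mono φ := by
  refine (sheafToPresheaf (Opens.grothendieckTopology X) AddCommGrpCat.{u}).mono_of_mono_map ?_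
  have (U : (Opens X)ᵒᵖ) : Mono (φ.hom.app U) := (AddCommGrpCat.mono_iff_injective _).2 (h U.unop)
  exact NatTrans.mono_of_mono_app φ.hom

lemma shortExact_of_sections (S : ShortComplex (ShAb X))
    (hinj : ∀ U, Function.Injective (sapp S.f U))
    (hex : ∀ (U : Opens X) (x : S.X₂.obj.obj (op U)), sapp S.g U x = 0 → ∃ y, sapp S.f U y = x)
    (hepi : Epi S.g) : S.ShortExact := by
  have hmono := mono_of_sections S.f hinj
  refine { exact := ?_, mono_f := hmono, epi_g := hepi }
  refine S.exact_of_f_is_kernel (KernelFork.IsLimit.ofι' S.f S.zero fun {W} k hk => ?_)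
  have hk' : ∀ (U : Opens X) (w : W.obj.obj (op U)), sapp S.g U (sapp k U w) = 0 := fun U w =>
    congrArg (fun φ : W ⟶ S.X₃ => sapp φ U w) hk
  have hl : ∀ (U : Opens X) (w : W.obj.obj (op U)), ∃ y, sapp S.f U y = sapp k U w :=
    fun U w => hex U _ (hk' U w)
  choose l hl using hl
  have ladd : ∀ (U : Opens X) (a b : W.obj.obj (op U)), l U (a + b) = l U a + l U b := fun U a b =>
    hinj U ((hl U (a + b)).trans (((k.hom.app (op U)).hom.map_add a b).trans
      ((congrArg₂ (· + ·) (hl U a) (hl U b)).symm.trans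
        ((S.f.hom.app (op U)).hom.map_add (l U a) (l U b)).symm)))
  let φ : W.obj ⟶ S.X₁.obj :=
    { app := fun U => AddCommGrpCat.ofHom (AddMonoidHom.mk' (l U.unop) (ladd U.unop))
      naturality := fun U V i => by
        ext w
        refine hinj V.unop ?_
        have e1 := hl V.unop ((W.obj.map i).hom w)
        have e2 : sapp S.f V.unop ((S.X₁.obj.map i).hom (l U.unop w)) =
            (S.X₂.obj.map i).hom (sapp S.f U.unop (l U.unop w)) :=
          ConcreteCategory.congr_hom (S.f.hom.naturality i) (l U.unop w)
        have e3 : sapp k V.unop ((W.obj.map i).hom w) = (S.X₂.obj.map i).hom (sapp k U.unop w) :=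
          ConcreteCategory.congr_hom (k.hom.naturality i) w
        exact e1.trans (e3.trans ((congrArg _ (hl U.unop w).symm).trans e2.symm)) }
  refine ⟨⟨φ⟩, ?_⟩
  ext U w
  exact hl U.unop w

lemma epi_toSheaf_of_locally {M N : O.Mod} (φ : M ⟶ N)
    (h : ∀ (U : Opens X) (t : MSec N U), ∀ x ∈ U, ∃ V : Opens X, ∃ hV : V ≤ U, x ∈ V ∧
      ∃ s : MSec M V, happ φ V s = mres N hV t) : Epi ((toShAb O).map φ) :=
  (epi_iff_locally _).2 h

lemma locally_of_epi {M N : O.Mod} (φ : M ⟶ N) [Epi φ] (U : Opens X) (t : MSec N U)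
    (x : X) (hx : x ∈ U) : ∃ V : Opens X, ∃ hV : V ≤ U, x ∈ V ∧
      ∃ s : MSec M V, happ φ V s = mres N hV t :=
  (epi_iff_locally ((toShAb O).map φ)).1 inferInstance U t x hx

lemma shortExact_toSheaf (S : ShortComplex O.Mod)
    (hinj : ∀ U, Function.Injective (happ S.f U))
    (hex : ∀ (U : Opens X) (x : MSec S.X₂ U), happ S.g U x = 0 → ∃ y, happ S.f U y = x)
    (hepi : ∀ (U : Opens X) (t : MSec S.X₃ U), ∀ x ∈ U, ∃ V : Opens X, ∃ hV : V ≤ U, x ∈ V ∧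
      ∃ s : MSec S.X₂ V, happ S.g V s = mres S.X₃ hV t) : (S.map (toShAb O)).ShortExact :=
  shortExact_of_sections _ hinj hex (epi_toSheaf_of_locally S.g hepi)

lemma shortExact_of_toSheaf (S : ShortComplex O.Mod) (h : (S.map (toShAb O)).ShortExact) :
    S.ShortExact where
  exact := (toShAb O).reflects_exact_of_faithful S h.exact
  mono_f := (toShAb O).mono_of_mono_map h.mono_f
  epi_g := (toShAb O).epi_of_epi_map h.epi_g

lemma sections_of_shortExact {S : ShortComplex O.Mod} (hS : S.ShortExact) (U : Opens X) :
    Function.Injective (happ S.f U) ∧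
      ∀ x : MSec S.X₂ U, happ S.g U x = 0 → ∃ y, happ S.f U y = x := by
  have := hS.mono_f
  let F := SheafOfModules.evaluation.{u} O.ring (op U)
  have hadd : F.PreservesZeroMorphisms := ⟨fun _ _ => rfl⟩
  have h := hS.exact.map_of_mono_of_preservesKernel F inferInstance inferInstance
  have hm : Mono (F.map S.f) := inferInstance
  exact ⟨(ModuleCat.mono_iff_injective _).1 hm, fun x hx =>
    (ShortComplex.moduleCat_exact_iff _).1 h x hx⟩

lemma mono_happ {M N : O.Mod} (φ : M ⟶ N) [Mono φ] (U : Opens X) :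
    Function.Injective (happ φ U) := by
  let F := SheafOfModules.evaluation.{u} O.ring (op U)
  have hm : Mono (F.map φ) := inferInstance
  exact (ModuleCat.mono_iff_injective _).1 hm

/-- For `T` locally free, maps from `T` lift locally along surjections. -/
lemma hom_lift_of_frame {T M N : O.Mod} (p : M ⟶ N) [Epi p] (hT : IsLocallyFree T) (U : Opens X)
    (t : MSec (homMod T N) U) (x : X) (hx : x ∈ U) : ∃ V : Opens X, ∃ hV : V ≤ U, x ∈ V ∧
      ∃ s : MSec (homMod T M) V, happ (homPost T p) V s = mres (homMod T N) hV t := by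
  obtain ⟨W, hxW, n, e, hb⟩ := hT x
  have h : ∀ i : Fin n, ∃ V : Opens X, ∃ hV : V ≤ U ⊓ W, x ∈ V ∧ ∃ s : MSec M V,
      happ p V s = mres N hV (hval t inf_le_left (mres T inf_le_right (e i))) := fun i =>
    locally_of_epi p _ _ x ⟨hx, hxW⟩
  choose V hV hxV s hs using h
  let V' : Opens X := (U ⊓ W) ⊓ Finset.univ.inf V
  have hxV' : x ∈ V' := by
    refine ⟨⟨hx, hxW⟩, ?_⟩
    have : ∀ F : Finset (Fin n), x ∈ F.inf V := by
      intro F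
      induction F using Finset.induction with
      | empty => exact trivial
      | insert a F ha ih => rw [Finset.inf_insert]; exact ⟨hxV a, ih⟩
    exact this _
  have hVi : ∀ i, V' ≤ V i := fun i => inf_le_right.trans (Finset.inf_le (Finset.mem_univ i))
  have hU : V' ≤ U := inf_le_left.trans inf_le_left
  have hW : V' ≤ W := inf_le_left.trans inf_le_right
  choose b hb using hb
  let f : ∀ A : Opens X, A ≤ V' → MSec T A →ₗ[O.Sec A] MSec M A := fun A hA =>
    (b A (hA.trans hW)).constr (O.Sec A) fun i => mres M (hA.trans (hVi i)) (s i)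
  have hf : ∀ (A : Opens X) (hA : A ≤ V') (i : Fin n),
      f A hA (mres T (hA.trans hW) (e i)) = mres M (hA.trans (hVi i)) (s i) := fun A hA i => by
    rw [← hb A (hA.trans hW) i]
    exact (b A (hA.trans hW)).constr_basis _ _ i
  refine ⟨V', hU, hxV', mkHomSec f ?_, ?_⟩
  · intro A B hA hB y
    have : y = ∑ i, (b A (hA.trans hW)).repr y i • mres T (hA.trans hW) (e i) := by
      conv_lhs => rw [← (b A (hA.trans hW)).sum_repr y]
      simp only [hb]
    rw [this]
    simp only [map_sum, map_smul, mres_smul, hf, mres_mres]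
  · refine hom_sec_ext fun A hA y => ?_
    rw [hval_homPost, hval_mkHomSec, hval_res]
    have : happ p A ∘ₗ f A hA = hval t (hA.trans hU) := by
      refine (b A (hA.trans hW)).ext fun i => ?_
      rw [hb, LinearMap.comp_apply, hf, happ_mres, hs, mres_mres, hval_nat, mres_mres]
      exact hA
    exact LinearMap.congr_fun this y

/-- For `T` locally free, the functor `Hom(T, -)` is exact. -/
lemma homFunctor_shortExact {T : O.Mod} (hT : IsLocallyFree T) {S : ShortComplex O.Mod}
    (hS : S.ShortExact) : (S.map (homFunctor T)).ShortExact := by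
  have := hS.epi_g
  refine shortExact_toSheaf (ShortComplex.mk (homPost T S.f) (homPost T S.g) ?_) ?_ ?_ ?_
  · have h1 : homPost T S.f ≫ homPost T S.g = homPost T (S.f ≫ S.g) := rfl
    rw [h1, S.zero]
    rfl
  · intro U a b hab
    refine hom_sec_ext fun V hV x => (sections_of_shortExact hS V).1 ?_
    exact congrArg (fun f : MSec (homMod T S.X₂) U => hval f hV x) hab
  · intro U f hf
    have h : ∀ (V : Opens X) (hV : V ≤ U) (x : MSec T V), ∃ y, happ S.f V y = hval f hV x :=
      fun V hV x => (sections_of_shortExact hS V).2 _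
        (congrArg (fun f : MSec (homMod T S.X₃) U => hval f hV x) hf)
    choose l hl using h
    refine ⟨mkHomSec (fun V hV =>
      { toFun := l V hV
        map_add' := fun x y => (sections_of_shortExact hS V).1 (by
          rw [map_add, hl, hl, hl, map_add])
        map_smul' := fun r x => (sections_of_shortExact hS V).1 (by
          rw [RingHom.id_apply, map_smul, hl, hl, map_smul]) }) ?_, ?_⟩
    · intro V W hV hW x
      refine (sections_of_shortExact hS W).1 ?_
      rw [happ_mres]
      change mres _ hW (happ S.f V (l V hV x)) = happ S.f W (l W _ _)
      rw [hl, hl, hval_nat]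
    · exact hom_sec_ext fun V hV x => hl V hV x
  · exact fun U t x hx => hom_lift_of_frame S.g hT U t x hx

lemma homFunctor_exact {T : O.Mod} (hT : IsLocallyFree T) :
    PreservesFiniteLimits (homFunctor T) ∧ PreservesFiniteColimits (homFunctor T) :=
  ((homFunctor T).exact_tfae.out 0 3).1 fun _ hS => homFunctor_shortExact hT hS

lemma shortExact_pullback {C : Type*} [Category* C] [Abelian C] {S : ShortComplex C}
    (hS : S.ShortExact) {D : C} (p : D ⟶ S.X₃) (w : S.f ≫ S.g = 0 ≫ p) :
    (ShortComplex.mk (pullback.lift (f := S.g) (g := p) S.f (0 : S.X₁ ⟶ D) w) (pullback.snd S.g p)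
      (pullback.lift_snd _ _ _)).ShortExact := by
  have := hS.mono_f
  have := hS.epi_g
  have hm : Mono (pullback.lift (f := S.g) (g := p) S.f (0 : S.X₁ ⟶ D) w) := by
    have : Mono (pullback.lift (f := S.g) (g := p) S.f (0 : S.X₁ ⟶ D) w ≫ pullback.fst S.g p) := by
      rw [pullback.lift_fst]; infer_instance
    exact mono_of_mono _ (pullback.fst S.g p)
  refine { exact := ?_, mono_f := hm, epi_g := inferInstanceAs (Epi (pullback.snd S.g p)) }
  refine ShortComplex.exact_of_f_is_kernel _ (KernelFork.IsLimit.ofι' _ _ fun {W} k hk => ?_)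
  have hk' : (k ≫ pullback.fst S.g p) ≫ S.g = 0 := by
    rw [Category.assoc, pullback.condition, reassoc_of% hk, zero_comp]
  refine ⟨hS.exact.lift _ hk', ?_⟩
  apply pullback.hom_ext
  · rw [Category.assoc, pullback.lift_fst]; exact hS.exact.lift_f _ hk'
  · rw [Category.assoc, pullback.lift_snd, comp_zero, hk]

/-- For `T` locally free, the dual of a short exact sequence `0 → K → A → T → 0` is exact. -/
lemma dual_shortExact {S : ShortComplex O.Mod} (hS : S.ShortExact) (hT : IsLocallyFree S.X₃) :
    (ShortComplex.mk (homPre O.unit S.g) (homPre O.unit S.f) (by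
      have h1 : homPre O.unit S.g ≫ homPre O.unit S.f = homPre O.unit (S.f ≫ S.g) := rfl
      rw [h1, S.zero]
      exact hom_ext' _ _ fun U m => hom_sec_ext fun V hV _ => map_zero (hval m hV))).ShortExact := by
  have := hS.epi_g
  refine shortExact_of_toSheaf _ (shortExact_toSheaf _ ?_ ?_ ?_)
  · intro U a b hab
    refine hom_sec_ext fun V hV t => osec_ext _ _ fun x hx => ?_
    obtain ⟨W, hW, hxW, s, hs⟩ := locally_of_epi S.g V t x hx
    refine ⟨W, hW, hxW, ?_⟩
    refine (hval_nat a hV hW t).trans (Eq.trans ?_ (hval_nat b hV hW t).symm)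
    rw [← hs]
    exact congrArg (fun f : MSec (dual S.X₂) U => hval f (hW.trans hV) s) hab
  · intro U f hf
    have hf' : ∀ (V : Opens X) (hV : V ≤ U) (y : MSec S.X₁ V), hval f hV (happ S.f V y) = 0 :=
      fun V hV y => congrArg (fun f : MSec (dual S.X₁) U => hval f hV y) hf
    have hwd : ∀ (V : Opens X) (hV : V ≤ U) (a b : MSec S.X₂ V), happ S.g V a = happ S.g V b →
        hval f hV a = hval f hV b := fun V hV a b hab => by
      obtain ⟨y, hy⟩ := (sections_of_shortExact hS V).2 (a - b) (by rw [map_sub, hab, sub_self])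
      rw [← sub_eq_zero, ← map_sub, ← hy, hf']
    have hl : ∀ (V : Opens X) (hV : V ≤ U) (ξ : MSec S.X₃ V), ∃ t : MSec O.unit V,
        ∀ (W : Opens X) (hW : W ≤ V) (a : MSec S.X₂ W), happ S.g W a = mres S.X₃ hW ξ →
          hval f (hW.trans hV) a = mres O.unit hW t := by
      intro V hV ξ
      choose A hA hxA s hs using fun x : V => locally_of_epi S.g V ξ x.1 x.2
      obtain ⟨t, ht⟩ := msec_glue O.unit V A hA (fun x hx => Opens.mem_iSup.2 ⟨⟨x, hx⟩, hxA _⟩)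
        (fun i => hval f ((hA i).trans hV) (s i)) (fun i j => by
          rw [hval_nat, hval_nat]
          refine hwd _ _ _ _ ?_
          rw [happ_mres, happ_mres, hs, hs, mres_mres, mres_mres])
      refine ⟨t, fun W hW a ha => msec_ext O.unit _ _ fun x hx => ?_⟩
      refine ⟨W ⊓ A ⟨x, hW hx⟩, inf_le_left, ⟨hx, hxA _⟩, ?_⟩
      rw [mres_mres, ← mres_mres O.unit (hA ⟨x, hW hx⟩) inf_le_right, ht, hval_nat, hval_nat]
      refine hwd _ _ _ _ ?_
      rw [happ_mres, happ_mres, hs, ha, mres_mres, mres_mres]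
    have huniq : ∀ (V : Opens X) (_ : V ≤ U) (ξ : MSec S.X₃ V) (t t' : MSec O.unit V),
        (∀ (W : Opens X) (hW : W ≤ V) (a : MSec S.X₂ W), happ S.g W a = mres S.X₃ hW ξ →
          mres O.unit hW t = mres O.unit hW t') → t = t' := fun V hV ξ t t' h =>
      msec_ext O.unit _ _ fun x hx => by
        obtain ⟨W, hW, hxW, s, hs⟩ := locally_of_epi S.g V ξ x hx
        exact ⟨W, hW, hxW, h W hW s hs⟩
    choose l hl using hl
    have lval : ∀ (V : Opens X) (hV : V ≤ U) (a : MSec S.X₂ V),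
        l V hV (happ S.g V a) = hval f hV a := fun V hV a => by
      have := hl V hV (happ S.g V a) V le_rfl a (mres_self _ _ _).symm
      rw [this, mres_self]
    have lres : ∀ (V W : Opens X) (hV : V ≤ U) (hW : W ≤ V) (ξ : MSec S.X₃ V),
        mres O.unit hW (l V hV ξ) = l W (hW.trans hV) (mres S.X₃ hW ξ) := fun V W hV hW ξ => by
      refine huniq W (hW.trans hV) (mres S.X₃ hW ξ) _ _ fun A hA a ha => ?_
      rw [← hl W (hW.trans hV) (mres S.X₃ hW ξ) A hA a ha, mres_mres]
      exact (hl V hV ξ A (hA.trans hW) a (ha.trans (mres_mres _ _ _ _))).symm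
    refine ⟨mkHomSec (fun V hV =>
      { toFun := l V hV
        map_add' := fun ξ η => msec_ext O.unit _ _ fun x hx => ?_
        map_smul' := fun r ξ => msec_ext O.unit _ _ fun x hx => ?_ }) lres, ?_⟩
    · obtain ⟨W, hW, hxW, s, hs⟩ := locally_of_epi S.g V ξ x hx
      obtain ⟨W', hW', hxW', s', hs'⟩ := locally_of_epi S.g W (mres _ hW η) x hxW
      refine ⟨W', hW'.trans hW, hxW', ?_⟩
      have h1 : mres S.X₃ (hW'.trans hW) ξ = happ S.g W' (mres _ hW' s) := by
        rw [happ_mres, hs, mres_mres]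
      have h2 : mres S.X₃ (hW'.trans hW) η = happ S.g W' s' := by rw [hs', mres_mres]
      rw [map_add, lres, lres, lres, map_add, h1, h2, ← map_add, lval, lval, lval, map_add]
    · obtain ⟨W, hW, hxW, s, hs⟩ := locally_of_epi S.g V ξ x hx
      refine ⟨W, hW, hxW, ?_⟩
      rw [RingHom.id_apply, mres_smul, lres, lres, mres_smul, ← hs, ← map_smul, lval, lval, map_smul]
    · exact hom_sec_ext fun V hV a => lval V hV a
  · intro U t x hx
    obtain ⟨V, hV, hxV, s, hs⟩ := hom_lift_of_frame S.g hT U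
      (mkHomSec (fun _ _ => LinearMap.id) fun _ _ _ _ _ => rfl) x hx
    have hs' : ∀ (W : Opens X) (hW : W ≤ V) (ξ : MSec S.X₃ W), happ S.g W (hval s hW ξ) = ξ :=
      fun W hW ξ => congrArg (fun f : MSec (homMod S.X₃ S.X₃) V => hval f hW ξ) hs
    have hp : ∀ (W : Opens X) (_ : W ≤ V) (a : MSec S.X₂ W), ∃ y : MSec S.X₁ W,
        happ S.f W y = a - hval s (by assumption) (happ S.g W a) := fun W hW a =>
      (sections_of_shortExact hS W).2 _ (by rw [map_sub, hs', sub_self])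
    choose k hk using hp
    have inj := fun W => (sections_of_shortExact hS W).1
    have hz : ∀ (W : Opens X) (y : MSec S.X₁ W), happ S.g W (happ S.f W y) = 0 := fun W y =>
      congrArg (fun φ : S.X₁ ⟶ S.X₃ => happ φ W y) S.zero
    refine ⟨V, hV, hxV, mkHomSec (fun W hW => hval t (hW.trans hV) ∘ₗ
      { toFun := k W hW
        map_add' := fun a b => inj W (by rw [map_add, hk, hk, hk, map_add, map_add]; abel)
        map_smul' := fun r a => inj W (by
          rw [RingHom.id_apply, map_smul, hk, hk, map_smul, map_smul, smul_sub]) }) ?_, ?_⟩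
    · intro W W' hW hW' a
      change mres _ _ (hval t _ (k W hW a)) = hval t _ (k W' _ (mres _ hW' a))
      rw [hval_nat]
      congr 1
      refine inj W' ?_
      rw [hk, happ_mres, hk, map_sub, hval_nat, happ_mres]
    · refine hom_sec_ext fun W hW y => ?_
      change hval t _ (k W hW (happ S.f W y)) = hval t _ y
      congr 1
      refine inj W ?_
      rw [hk, hz, map_zero, sub_zero]

namespace LieAlgebroid

variable {A : LieAlgebroid O}

lemma IsTransitive.epi (hA : A.IsTransitive) : Epi A.anchor :=
  (toShAb O).epi_of_epi_map (epi_toSheaf_of_locally A.anchor hA)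

variable (A) in
/-- The sequence `0 → g → A → T → 0`. -/
abbrev seq : ShortComplex O.Mod := ShortComplex.mk A.gι A.anchor (kernel.condition _)

lemma seq_shortExact (hA : A.IsTransitive) : A.seq.ShortExact where
  exact := ShortComplex.exact_of_f_is_kernel _ (kernelIsKernel A.anchor)
  mono_f := inferInstanceAs (Mono (kernel.ι A.anchor))
  epi_g := hA.epi

lemma InvariantPairing.fromOmega_snd (p : A.InvariantPairing) :
    p.fromOmega ≫ pullback.snd (homPre O.unit A.gι) p.toDual = 0 :=
  pullback.lift_snd _ _ _

/-- The sequence `0 → Ω^1 → ĝ → g → 0`. -/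
abbrev InvariantPairing.seq (p : A.InvariantPairing) : ShortComplex O.Mod :=
  ShortComplex.mk p.fromOmega (pullback.snd (homPre O.unit A.gι) p.toDual) p.fromOmega_snd

lemma InvariantPairing.seq_shortExact (p : A.InvariantPairing) (hA : A.IsTransitive)
    (hT : IsLocallyFree (tangent O)) : p.seq.ShortExact :=
  shortExact_pullback (dual_shortExact (S := A.seq) (LieAlgebroid.seq_shortExact hA) hT) p.toDual _

end LieAlgebroid

/-- The global section of `Hom(E, E)` given by the identity. -/
def idSec (E : O.Mod) : MSec (homMod E E) ⊤ :=
  mkHomSec (fun _ _ => LinearMap.id) fun _ _ _ _ _ => rfl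

/-- The canonical map `Ext^n(T, F) → H^n(X; Hom(T, F)) = H^n(X; Ω^1 ⊗ F)` for `T` locally free:
apply the exact functor `Hom(T, -)` and compose with the class of the section `id` of
`Hom(T, T)`. -/
def extToH {T : O.Mod} (hT : IsLocallyFree T) {F : O.Mod} [HasExt.{w} O.Mod] (n : ℕ)
    (x : Ext.{w} T F n) : Sheaf.H ((homFunctor T).obj F) n :=
  haveI := (homFunctor_exact hT).1
  haveI := (homFunctor_exact hT).2
  ((Sheaf.H.equiv₀ ((homFunctor T).obj T) (isTerminalTop (α := Opens X))).symm (idSec T)).comp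
    (x.mapExactFunctor (homFunctor T)) (zero_add n)

section Classes

variable [HasExt.{w} O.Mod] {A : LieAlgebroid O} (hT : IsLocallyFree (tangent O))
  (hA : A.IsTransitive)

/-- The Atiyah class `α(A) ∈ H^1(X; Ω^1 ⊗ g)`. -/
def atiyahClass : Sheaf.H ((homFunctor (tangent O)).obj A.g) 1 :=
  extToH hT 1 (LieAlgebroid.seq_shortExact hA).extClass

/-- The class in `H^2(X; Ω^1 ⊗ Ω^1)` of the 2-extension `0 → Ω^1 → ĝ → A → T → 0`. -/
def betaClass (p : A.InvariantPairing) :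
    Sheaf.H ((homFunctor (tangent O)).obj (Omega1 O)) 2 :=
  extToH hT 2 ((LieAlgebroid.seq_shortExact hA).extClass.comp (p.seq_shortExact hA hT).extClass rfl)

end Classes

/-! ### Differential forms -/

section Forms

variable {U V : Opens X}

lemma lie_add (ξ η ζ : MSec (tangent O) U) : lie ξ (η + ζ) = lie ξ η + lie ξ ζ :=
  vec_ext fun V hV f => by
    simp only [map_add, lie_res, lie_act, add_act, act_add]; ring

lemma lie_swap (ξ η : MSec (tangent O) U) : lie η ξ = -lie ξ η :=
  vec_ext fun V hV f => by
    have h : ∀ ζ : MSec (tangent O) V, act (-ζ) f = -act ζ f := fun _ => rfl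
    simp only [map_neg, lie_res, lie_act, h]; ring

lemma lie_smul (r : O.Sec U) (ξ η : MSec (tangent O) U) :
    lie ξ (r • η) = r • lie ξ η + act ξ r • η :=
  vec_ext fun V hV f => by
    simp only [map_add, mres_smul, lie_res, lie_act, add_act, smul_act, act_mul, act_res]; ring

lemma add_lie (ξ η ζ : MSec (tangent O) U) : lie (ξ + η) ζ = lie ξ ζ + lie η ζ :=
  vec_ext fun V hV f => by
    simp only [map_add, lie_res, lie_act, add_act, act_add]; ring

lemma smul_lie (r : O.Sec U) (ξ η : MSec (tangent O) U) :
    lie (r • ξ) η = r • lie ξ η + (-act η r) • ξ :=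
  vec_ext fun V hV f => by
    simp only [map_add, map_neg, mres_smul, lie_res, lie_act, add_act, smul_act, act_mul, act_res]
    ring

lemma lie_jacobi (ξ η ζ : MSec (tangent O) U) :
    lie (lie ξ η) ζ + lie (lie η ζ) ξ + lie (lie ζ ξ) η = 0 :=
  vec_ext fun V hV f => by
    have h : ∀ g : O.Sec V, act (0 : MSec (tangent O) V) g = 0 := fun _ => rfl
    simp only [map_add, map_zero, lie_res, lie_act, add_act, act_sub, h]; ring

variable (O) in
/-- Pairs of vector fields. -/
abbrev Tan2 : PSet X := ⟨fun U => MSec (tangent O) U × MSec (tangent O) U,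
  fun h x => (mres _ h x.1, mres _ h x.2),
  fun h k x => Prod.ext (mres_mres _ h k x.1) (mres_mres _ h k x.2)⟩

variable (O) in
/-- Triples of vector fields. -/
abbrev Tan3 : PSet X :=
  ⟨fun U => MSec (tangent O) U × MSec (tangent O) U × MSec (tangent O) U,
  fun h x => (mres _ h x.1, mres _ h x.2.1, mres _ h x.2.2),
  fun h k x => Prod.ext (mres_mres _ h k x.1)
    (Prod.ext (mres_mres _ h k x.2.1) (mres_mres _ h k x.2.2))⟩

/-- An alternating `O(U)`-bilinear map on vector fields. -/
structure IsForm2 (ω : MSec (tangent O) U × MSec (tangent O) U → O.Sec U) : Prop where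
  add : ∀ a b c, ω (a + b, c) = ω (a, c) + ω (b, c)
  smul : ∀ (r : O.Sec U) (a b), ω (r • a, b) = r * ω (a, b)
  swap : ∀ a b, ω (b, a) = -ω (a, b)

/-- An alternating `O(U)`-trilinear map on vector fields. -/
structure IsForm3 (ω : MSec (tangent O) U × MSec (tangent O) U × MSec (tangent O) U → O.Sec U) :
    Prop where
  add : ∀ a b c d, ω (a + b, c, d) = ω (a, c, d) + ω (b, c, d)
  smul : ∀ (r : O.Sec U) (a b c), ω (r • a, b, c) = r * ω (a, b, c)
  swap12 : ∀ a b c, ω (b, a, c) = -ω (a, b, c)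
  swap23 : ∀ a b c, ω (a, c, b) = -ω (a, b, c)

/-- The exterior derivative of a 2-form (Koszul formula). -/
def extD2 (ω : MSec (tangent O) U × MSec (tangent O) U → O.Sec U)
    (x : MSec (tangent O) U × MSec (tangent O) U × MSec (tangent O) U) : O.Sec U :=
  act x.1 (ω (x.2.1, x.2.2)) - act x.2.1 (ω (x.1, x.2.2)) + act x.2.2 (ω (x.1, x.2.1)) -
    ω (lie x.1 x.2.1, x.2.2) + ω (lie x.1 x.2.2, x.2.1) - ω (lie x.2.1 x.2.2, x.1)

/-- The exterior derivative of a 3-form (Koszul formula). -/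
def extD3 (ω : MSec (tangent O) U × MSec (tangent O) U × MSec (tangent O) U → O.Sec U)
    (a b c d : MSec (tangent O) U) : O.Sec U :=
  act a (ω (b, c, d)) - act b (ω (a, c, d)) + act c (ω (a, b, d)) - act d (ω (a, b, c)) -
    ω (lie a b, c, d) + ω (lie a c, b, d) - ω (lie a d, b, c) - ω (lie b c, a, d) +
    ω (lie b d, a, c) - ω (lie c d, a, b)

namespace IsForm2

variable {ω : MSec (tangent O) U × MSec (tangent O) U → O.Sec U}

lemma add' (h : IsForm2 ω) (a b c) : ω (a, b + c) = ω (a, b) + ω (a, c) := by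
  rw [h.swap, h.add, h.swap a b, h.swap a c]; ring

lemma smul' (h : IsForm2 ω) (r : O.Sec U) (a b) : ω (a, r • b) = r * ω (a, b) := by
  rw [h.swap, h.smul, h.swap a b]; ring

lemma neg (h : IsForm2 ω) (a b) : ω (-a, b) = -ω (a, b) := by
  have := h.smul (-1) a b
  rwa [neg_one_smul, neg_one_mul] at this

lemma neg' (h : IsForm2 ω) (a b) : ω (a, -b) = -ω (a, b) := by
  rw [h.swap, h.neg, h.swap a b, neg_neg]

lemma zero (h : IsForm2 ω) (b) : ω (0, b) = 0 := by
  have := h.smul 0 0 b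
  rwa [zero_smul, zero_mul] at this

lemma isForm3_extD2 (h : IsForm2 ω) : IsForm3 (extD2 ω) where
  add a b c d := by
    simp only [extD2, add_act, h.add, h.add', add_lie, act_add]
    ring
  smul r a b c := by
    simp only [extD2, smul_act, h.smul, h.smul', smul_lie, h.add, act_mul]
    rw [h.swap c b]
    ring
  swap12 a b c := by
    simp only [extD2, h.swap a, lie_swap a b, h.neg, act_neg]
    ring
  swap23 a b c := by
    simp only [extD2, h.swap b c, lie_swap b c, h.neg, act_neg]
    ring

lemma extD3_extD2 (h : IsForm2 ω) (a b c d) : extD3 (extD2 ω) a b c d = 0 := by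
  have jac : ∀ x y z w, ω (lie (lie x y) z, w) - ω (lie (lie x z) y, w) +
      ω (lie (lie y z) x, w) = 0 := fun x y z w => by
    have h1 : lie (lie x y) z + lie (lie y z) x = lie (lie x z) y := by
      have h2 := lie_jacobi x y z
      have h3 : lie (lie z x) y = -lie (lie x z) y := by
        have := smul_lie (-1) (lie x z) y
        rwa [neg_one_smul, neg_one_smul, ← lie_swap x z, act_neg,
          show act y (1 : O.Sec U) = 0 by simpa using act_mul y 1 1, neg_zero, neg_zero, zero_smul,
          add_zero] at this
      rw [h3] at h2
      exact add_neg_eq_zero.1 h2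
    rw [← h1, h.add]
    ring
  simp only [extD3, extD2, act_add, act_sub, lie_act]
  linear_combination jac a b c d - jac a b d c + jac a c d b - jac b c d a +
    h.swap (lie a b) (lie c d) - h.swap (lie a c) (lie b d) + h.swap (lie a d) (lie b c)

end IsForm2

end Forms

section Closure

variable {U : Opens X}

lemma IsForm2.addF {f g : MSec (tangent O) U × MSec (tangent O) U → O.Sec U} (hf : IsForm2 f)
    (hg : IsForm2 g) : IsForm2 (fun x => f x + g x) :=
  ⟨fun a b c => by rw [hf.add, hg.add]; ring, fun r a b => by rw [hf.smul, hg.smul]; ring,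
    fun a b => by rw [hf.swap, hg.swap]; ring⟩

lemma IsForm2.smulF {f : MSec (tangent O) U × MSec (tangent O) U → O.Sec U} (hf : IsForm2 f)
    (r : O.Sec U) : IsForm2 (fun x => r * f x) :=
  ⟨fun a b c => by rw [hf.add]; ring, fun s a b => by rw [hf.smul]; ring,
    fun a b => by rw [hf.swap]; ring⟩

lemma IsForm2.negF {f : MSec (tangent O) U × MSec (tangent O) U → O.Sec U} (hf : IsForm2 f) :
    IsForm2 (fun x => -f x) :=
  ⟨fun a b c => by rw [hf.add]; ring, fun r a b => by rw [hf.smul]; ring,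
    fun a b => by rw [hf.swap]⟩

/-- A closed 3-form. -/
structure IsClosed3
    (ω : MSec (tangent O) U × MSec (tangent O) U × MSec (tangent O) U → O.Sec U) : Prop where
  form : IsForm3 ω
  closed : ∀ a b c d, extD3 ω a b c d = 0

variable {f g : MSec (tangent O) U × MSec (tangent O) U × MSec (tangent O) U → O.Sec U}

lemma IsClosed3.addF (hf : IsClosed3 f) (hg : IsClosed3 g) : IsClosed3 (fun x => f x + g x) :=
  ⟨⟨fun a b c d => by rw [hf.1.add, hg.1.add]; ring, fun r a b c => by
      rw [hf.1.smul, hg.1.smul]; ring, fun a b c => by rw [hf.1.swap12, hg.1.swap12]; ring,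
      fun a b c => by rw [hf.1.swap23, hg.1.swap23]; ring⟩, fun a b c d => by
    have hf' := hf.closed a b c d
    have hg' := hg.closed a b c d
    simp only [extD3, act_add] at *
    linear_combination hf' + hg'⟩

lemma IsClosed3.negF (hf : IsClosed3 f) : IsClosed3 (fun x => -f x) :=
  ⟨⟨fun a b c d => by rw [hf.1.add]; ring, fun r a b c => by rw [hf.1.smul]; ring,
      fun a b c => by rw [hf.1.swap12], fun a b c => by rw [hf.1.swap23]⟩, fun a b c d => by
    have hf' := hf.closed a b c d
    simp only [extD3, act_neg] at *
    linear_combination -hf'⟩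

variable (O U) in
lemma isForm2_zero :
    IsForm2 (fun _ : MSec (tangent O) U × MSec (tangent O) U => (0 : O.Sec U)) :=
  ⟨fun _ _ _ => by ring, fun _ _ _ => by ring, fun _ _ => by ring⟩

variable (O U) in
lemma isClosed3_zero : IsClosed3
    (fun _ : MSec (tangent O) U × MSec (tangent O) U × MSec (tangent O) U => (0 : O.Sec U)) :=
  ⟨⟨fun _ _ _ _ => by ring, fun _ _ _ _ => by ring, fun _ _ _ => by ring, fun _ _ _ => by ring⟩,
    fun a b c d => by simp only [extD3, act_zero]; ring⟩

end Closure

variable (O) in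
/-- The condition of being a 2-form. -/
def form2Cond : Cond (Tan2 O) O.unit := fun V =>
  { carrier := {ω | IsForm2 (O := O) (U := V) ω}
    zero_mem' := isForm2_zero O V
    add_mem' := fun hf hg => IsForm2.addF hf hg
    neg_mem' := fun hf => IsForm2.negF hf }

variable (O) in
/-- The condition of being a closed 3-form. -/
def closed3Cond : Cond (Tan3 O) O.unit := fun V =>
  { carrier := {ω | IsClosed3 (O := O) (U := V) ω}
    zero_mem' := isClosed3_zero O V
    add_mem' := fun hf hg => IsClosed3.addF hf hg
    neg_mem' := fun hf => IsClosed3.negF hf }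

instance : (form2Cond O).IsLin where
  smul _ r _ hf := IsForm2.smulF hf r

variable (O) in
lemma form2Cond_isLocal : (form2Cond O).IsLocal := by
  intro V (ω : _ → O.Sec V) h
  refine ⟨fun a b c => osec_ext _ _ fun x hx => ?_, fun r a b => osec_ext _ _ fun x hx => ?_,
    fun a b => osec_ext _ _ fun x hx => ?_⟩ <;>
    obtain ⟨W, hW, hxW, (ε : _ → O.Sec W), (hε : IsForm2 ε), hf⟩ := h x hx <;>
    refine ⟨W, hW, hxW, ?_⟩ <;>
    replace hf : ∀ d1 d2, O.res hW (ω (d1, d2)) = ε (mres _ hW d1, mres _ hW d2) :=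
      fun d1 d2 => hf (d1, d2)
  · rw [map_add, hf, hf, hf, map_add, hε.add]
  · rw [map_mul, hf, hf, mres_smul, hε.smul]
  · rw [map_neg, hf, hf, hε.swap]

variable (O) in
lemma closed3Cond_isLocal : (closed3Cond O).IsLocal := by
  intro V (ω : _ → O.Sec V) h
  refine ⟨⟨fun a b c d => osec_ext _ _ fun x hx => ?_, fun r a b c => osec_ext _ _ fun x hx => ?_,
    fun a b c => osec_ext _ _ fun x hx => ?_, fun a b c => osec_ext _ _ fun x hx => ?_⟩,
    fun a b c d => osec_ext _ _ fun x hx => ?_⟩ <;>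
    obtain ⟨W, hW, hxW, (ε : _ → O.Sec W), (hε : IsClosed3 ε), hf⟩ := h x hx <;>
    refine ⟨W, hW, hxW, ?_⟩ <;>
    replace hf : ∀ d1 d2 d3, O.res hW (ω (d1, d2, d3)) =
      ε (mres _ hW d1, mres _ hW d2, mres _ hW d3) := fun d1 d2 d3 => hf (d1, d2, d3)
  · rw [map_add, hf, hf, hf, map_add, hε.form.add]
  · rw [map_mul, hf, hf, mres_smul, hε.form.smul]
  · rw [map_neg, hf, hf, hε.form.swap12]
  · rw [map_neg, hf, hf, hε.form.swap23]
  · rw [map_zero, ← hε.closed (mres _ hW a) (mres _ hW b) (mres _ hW c) (mres _ hW d)]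
    simp only [extD3, map_add, map_sub, act_res, hf, lie_res]

variable (O) in
/-- The sheaf of 2-forms. -/
abbrev Omega2 : O.Mod := famMod (form2Cond O) (form2Cond_isLocal O)

variable (O) in
/-- The abelian sheaf of closed 3-forms. -/
abbrev Omega3cl : ShAb X := famSheaf (closed3Cond O) (closed3Cond_isLocal O)

lemma extD2_res {U V : Opens X} (h : V ≤ U)
    {ω : MSec (tangent O) U × MSec (tangent O) U → O.Sec U}
    {ω' : MSec (tangent O) V × MSec (tangent O) V → O.Sec V}
    (hω : ∀ a b, O.res h (ω (a, b)) = ω' (mres _ h a, mres _ h b)) (a b c) :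
    O.res h (extD2 ω (a, b, c)) = extD2 ω' (mres _ h a, mres _ h b, mres _ h c) := by
  simp only [extD2, map_add, map_sub, act_res, hω, lie_res]

/-- The value over `V ⊆ U` of a 2-form over `U`. -/
def val2 {U V : Opens X} (ω : MSec (Omega2 O) U) (hV : V ≤ U)
    (x : MSec (tangent O) V × MSec (tangent O) V) : O.Sec V :=
  fval (P := form2Cond O) ω hV x

lemma isForm2_val2 {U V : Opens X} (ω : MSec (Omega2 O) U) (hV : V ≤ U) : IsForm2 (val2 ω hV) :=
  fval_mem (P := form2Cond O) ω hV

/-- The value over `V ⊆ U` of a closed 3-form over `U`. -/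
def val3 {U V : Opens X} (ω : (Omega3cl O).obj.obj (op U)) (hV : V ≤ U)
    (x : MSec (tangent O) V × MSec (tangent O) V × MSec (tangent O) V) : O.Sec V :=
  fval (P := closed3Cond O) ω hV x

/-- The exterior derivative of a 2-form. -/
def extDSec {U : Opens X} (ω : MSec (Omega2 O) U) : famSec (closed3Cond O) U :=
  mkFam (P := closed3Cond O) (fun _ hV => extD2 (val2 ω hV))
    (fun _ _ hV hW x => extD2_res hW
      (fun a b => fval_nat (P := form2Cond O) ω hV hW (a, b)) x.1 x.2.1 x.2.2)
    (fun _ hV => show IsClosed3 _ from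
      ⟨(isForm2_val2 ω hV).isForm3_extD2, (isForm2_val2 ω hV).extD3_extD2⟩)

variable (O) in
/-- The exterior derivative `Ω^2 → Ω^{3,cl}`. -/
def extD : (toShAb O).obj (Omega2 O) ⟶ Omega3cl O where
  hom :=
    { app := fun U => AddCommGrpCat.ofHom (AddMonoidHom.mk' (extDSec (U := U.unop))
        fun ω ω' => fam_ext (P := closed3Cond O) fun V hV x => by
          change extD2 (fun y => val2 ω hV y + val2 ω' hV y) x =
            extD2 (val2 ω hV) x + extD2 (val2 ω' hV) x
          simp only [extD2, act_add]
          ring)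
      naturality := fun _ _ _ => rfl }

variable (O) in
/-- The complex `Ω^2 → Ω^{3,cl}`, in degrees 0 and 1. -/
def formComplex : CochainComplex (ShAb X) ℤ :=
  HomologicalComplex.double (extD O) (i₀ := 0) (i₁ := 1) (c := ComplexShape.up ℤ) rfl

/-- The bilinear form `½ ω`, as a section of `Hom(T, Ω^1) = Ω^1 ⊗ Ω^1`. -/
def halfSec {U : Opens X} (ω : MSec (Omega2 O) U) : MSec (homMod (tangent O) (Omega1 O)) U :=
  mkHomSec (fun V hV =>
    { toFun := fun ξ => mkHomSec (fun W hW =>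
        { toFun := fun η => O.scalar W (1 / 2) * val2 ω (hW.trans hV) (mres _ hW ξ, η)
          map_add' := fun η ζ => (congrArg _ ((isForm2_val2 ω _).add' _ _ _)).trans
            (mul_add (O.scalar W (1 / 2)) _ _)
          map_smul' := fun r η => (congrArg _ ((isForm2_val2 ω _).smul' _ _ _)).trans
            (mul_left_comm (O.scalar W (1 / 2)) r _) })
        (fun W W' hW hW' η => by
          refine (map_mul (O.res hW') _ _).trans ?_
          have h1 : O.res hW' (O.scalar W (1 / 2)) = O.scalar W' (1 / 2) := O.scalar_res _ _ _ _
          have h2 : O.res hW' (val2 ω (hW.trans hV) (mres _ hW ξ, η)) = _ :=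
            fval_nat (P := form2Cond O) ω (hW.trans hV) hW' (mres _ hW ξ, η)
          rw [h1, h2]
          change _ * val2 ω _ (mres _ hW' (mres _ hW ξ), _) = _
          rw [mres_mres]; rfl)
      map_add' := fun ξ ζ => hom_sec_ext fun W hW η => by
        change _ * val2 ω _ (mres _ hW (ξ + ζ), η) =
          _ * val2 ω _ (mres _ hW ξ, η) + _ * val2 ω _ (mres _ hW ζ, η)
        rw [map_add, (isForm2_val2 ω _).add, mul_add]
      map_smul' := fun r ξ => hom_sec_ext fun W hW η => by
        change _ * val2 ω _ (mres _ hW (r • ξ), η) =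
          O.res hW r * (_ * val2 ω _ (mres _ hW ξ, η))
        rw [mres_smul, (isForm2_val2 ω _).smul, mul_left_comm] })
    (fun V W hV hW ξ => hom_sec_ext fun A hA η => by
      change _ * val2 ω _ (mres _ _ ξ, η) = _ * val2 ω _ (mres _ hA (mres _ hW ξ), η)
      rw [mres_mres])

variable (O) in
/-- The inclusion `Ω^2 → Ω^1 ⊗ Ω^1 = Hom(T, Ω^1)` as the antisymmetric tensors,
`α ∧ β ↦ ½ (α ⊗ β - β ⊗ α)`, where `(α ∧ β)(ξ, η) = α(ξ) β(η) - α(η) β(ξ)`. It splits the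
projection `α ⊗ β ↦ α ∧ β`. -/
def antisymm : (toShAb O).obj (Omega2 O) ⟶ (homFunctor (tangent O)).obj (Omega1 O) where
  hom :=
    { app := fun U => AddCommGrpCat.ofHom (AddMonoidHom.mk' (halfSec (U := U.unop))
        fun ω ω' => hom_sec_ext fun V hV ξ => hom_sec_ext fun W hW η => by
          change _ * (val2 ω _ (mres _ hW ξ, η) + val2 ω' _ (mres _ hW ξ, η)) =
            _ * val2 ω _ (mres _ hW ξ, η) + _ * val2 ω' _ (mres _ hW ξ, η)
          rw [mul_add])
      naturality := fun _ _ _ => rfl }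

/-! ### The Čech resolution -/

variable (X) in
/-- The constant sheaf `ℤ`. -/
abbrev constZ : ShAb X :=
  (constantSheaf (Opens.grothendieckTopology X) AddCommGrpCat.{u}).obj
    (AddCommGrpCat.of (ULift.{u} ℤ))

/-- The complex with `F` in degree 0. -/
abbrev single₀ (F : ShAb X) : CochainComplex (ShAb X) ℤ :=
  (CochainComplex.singleFunctor (ShAb X) 0).obj F

section Cech

variable {ι : Type u} (U : ι → Opens X)

/-- The Čech nerve of a family of open sets: `n`-simplices over `V` are the families
`(i_0, …, i_n)` of indices with `V ⊆ U_{i_0} ∩ … ∩ U_{i_n}`. -/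
def coverNerve : SimplicialObject ((Opens X)ᵒᵖ ⥤ Type u) where
  obj n :=
    { obj := fun V => Fin (n.unop.len + 1) → {i : ι // V.unop ≤ U i}
      map := fun k => TypeCat.ofHom fun s j => ⟨(s j).1, k.unop.le.trans (s j).2⟩ }
  map θ := { app := fun _ => TypeCat.ofHom fun s j => s (θ.unop.toOrderHom j) }

/-- The free presheaf of abelian groups on the `n`-simplices of the nerve. -/
abbrev freeNerve : SimplicialObject ((Opens X)ᵒᵖ ⥤ AddCommGrpCat.{u}) :=
  coverNerve U ⋙ (Functor.whiskeringRight _ _ _).obj AddCommGrpCat.free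

/-- The augmentation of the nerve, which sends every 0-simplex to 1. -/
def nerveAug : (freeNerve U).obj (op (SimplexCategory.mk 0)) ⟶
    (Functor.const _).obj (AddCommGrpCat.of (ULift.{u} ℤ)) where
  app _ := AddCommGrpCat.ofHom (FreeAbelianGroup.lift fun _ => ULift.up 1)
  naturality _ _ _ := AddCommGrpCat.hom_ext (FreeAbelianGroup.lift_ext _ _ fun _ => rfl)

/-- The free simplicial abelian sheaf on the nerve. -/
abbrev sheafNerve : SimplicialObject (ShAb X) :=
  freeNerve U ⋙ presheafToSheaf (Opens.grothendieckTopology X) AddCommGrpCat.{u}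

/-- The Čech resolution `… → ⊕ ℤ_{U_{ijk}} → ⊕ ℤ_{U_{ij}} → ⊕ ℤ_{U_i}`, with
`⊕ ℤ_{U_{i_0 … i_p}}` in degree `-p` and differential the alternating sum of the face maps. -/
def cech : CochainComplex (ShAb X) ℤ :=
  ((AlgebraicTopology.alternatingFaceMapComplex (ShAb X)).obj (sheafNerve U)).extend
    ComplexShape.embeddingDownNat

/-- The term of degree `-p` of the Čech resolution. -/
def cechXIso (p : ℕ) :
    (cech U).X (-(p : ℤ)) ≅ (sheafNerve U).obj (op (SimplexCategory.mk p)) :=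
  HomologicalComplex.extendXIso _ ComplexShape.embeddingDownNat rfl

/-- The section of the term of degree `-p` given by a `p`-simplex `(i_0, …, i_p)` over `V`. -/
def cechGen (p : ℕ) (V : Opens X) (s : Fin (p + 1) → {i : ι // V ≤ U i}) :
    ((cech U).X (-(p : ℤ))).obj.obj (op V) :=
  sapp (cechXIso U p).inv V
    (((toSheafify (Opens.grothendieckTopology X)
      ((freeNerve U).obj (op (SimplexCategory.mk p)))).app (op V)).hom (FreeAbelianGroup.of s))

/-- The augmentation `⊕ ℤ_{U_i} → ℤ`. -/
def sheafAug : (sheafNerve U).obj (op (SimplexCategory.mk 0)) ⟶ constZ X :=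
  (presheafToSheaf (Opens.grothendieckTopology X) AddCommGrpCat.{u}).map (nerveAug U)

/-- The term of degree 0 of the Čech resolution. -/
def cechXIso₀ : (cech U).X 0 ≅ (sheafNerve U).obj (op (SimplexCategory.mk 0)) :=
  HomologicalComplex.extendXIso _ ComplexShape.embeddingDownNat rfl

/-- The augmentation on the term of degree 0 of the Čech resolution. -/
def cechAug₀ : (cech U).X (0 : ℤ) ⟶ constZ X := (cechXIso₀ U).hom ≫ sheafAug U

lemma nerveAug_face (i : Fin 2) : (freeNerve U).map (SimplexCategory.δ i).op ≫ nerveAug U =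
    (freeNerve U).map (SimplexCategory.δ 0).op ≫ nerveAug U := by
  ext V : 2
  exact AddCommGrpCat.hom_ext (FreeAbelianGroup.lift_ext _ _ fun _ => rfl)

lemma d_cechAug₀ (i : ℤ) (hi : (ComplexShape.up ℤ).Rel i 0) : (cech U).d i 0 ≫ cechAug₀ U = 0 := by
  obtain rfl : i = -((1 : ℕ) : ℤ) := by
    have : i + 1 = 0 := hi
    omega
  have h := HomologicalComplex.extend_d_eq
    ((AlgebraicTopology.alternatingFaceMapComplex (ShAb X)).obj (sheafNerve U))
    ComplexShape.embeddingDownNat (i := 1) (j := 0) (i' := -((1 : ℕ) : ℤ)) (j' := 0) rfl rfl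
  have h1 : (cech U).d (-((1 : ℕ) : ℤ)) 0 = (cechXIso U 1).hom ≫
    ((AlgebraicTopology.alternatingFaceMapComplex (ShAb X)).obj (sheafNerve U)).d 1 0 ≫
      (cechXIso₀ U).inv := h
  rw [h1, cechAug₀, Category.assoc, Category.assoc, Iso.inv_hom_id_assoc,
    AlgebraicTopology.alternatingFaceMapComplex_obj_d,
    AlgebraicTopology.AlternatingFaceMapComplex.objD, Fin.sum_univ_two]
  have h2 (i : Fin 2) : (sheafNerve U).δ i ≫ sheafAug U = (sheafNerve U).δ (0 : Fin 2) ≫ sheafAug U :=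
    let F := presheafToSheaf (Opens.grothendieckTopology X) AddCommGrpCat.{u}
    (F.map_comp ((freeNerve U).map (SimplexCategory.δ i).op) (nerveAug U)).symm.trans
      ((congrArg F.map (nerveAug_face U i)).trans
        (F.map_comp ((freeNerve U).map (SimplexCategory.δ 0).op) (nerveAug U)))
  rw [Preadditive.add_comp, Preadditive.zsmul_comp, Preadditive.zsmul_comp, h2 1, ← add_smul]
  have h3 : (-1 : ℤ) ^ ((0 : Fin 2) : ℕ) + (-1 : ℤ) ^ ((1 : Fin 2) : ℕ) = 0 := by norm_num
  rw [h3, zero_smul, comp_zero]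

/-- The augmentation of the Čech resolution. -/
def cechAug : cech U ⟶ single₀ (constZ X) :=
  HomologicalComplex.mkHomToSingle (cechAug₀ U) (d_cechAug₀ U)

end Cech

section Classes

open DerivedCategory

variable [HasDerivedCategory.{w1} (ShAb X)] {ι : Type u} {U : ι → Opens X}

/-- The hypercohomology `H^n(X; K)` of a complex of abelian sheaves. -/
abbrev HyperH (K : CochainComplex (ShAb X) ℤ) (n : ℕ) :=
  ShiftedHom ((singleFunctor (ShAb X) 0).obj (constZ X)) (Q.obj K) (n : ℤ)

/-- The map on hypercohomology induced by a morphism of complexes. -/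
def HyperH.map {K L : CochainComplex (ShAb X) ℤ} (φ : K ⟶ L) {n : ℕ} (x : HyperH K n) :
    HyperH L n :=
  x ≫ (Q.map φ)⟦(n : ℤ)⟧'

/-- A sheaf cohomology class, as a hypercohomology class. -/
def toHyperH {F : ShAb X} {n : ℕ} (x : Sheaf.H F n) : HyperH (single₀ F) n :=
  Ext.hom x

/-- A Čech cocycle of degree `n` with values in a complex `K`, i.e. a morphism of complexes from
the Čech resolution to `K[n]`, represents the hypercohomology class `x` if it agrees in the
derived category with `x` composed with the augmentation (a quasi-isomorphism, for a cover). -/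
def Represents {K : CochainComplex (ShAb X) ℤ} {n : ℕ} (f : cech U ⟶ K⟦(n : ℤ)⟧)
    (x : HyperH K n) : Prop :=
  Q.map (cechAug U) ≫ x = Q.map f ≫ (Q.commShiftIso (n : ℤ)).hom.app K

/-- The component in `K^q(V)` of a Čech cocycle at a `p`-simplex `(i_0, …, i_p)` over `V`. -/
def cval {K : CochainComplex (ShAb X) ℤ} {n : ℕ} (f : cech U ⟶ K⟦(n : ℤ)⟧) (p : ℕ) (q : ℤ)
    (h : q = -(p : ℤ) + n) (V : Opens X) (s : Fin (p + 1) → {i : ι // V ≤ U i}) :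
    (K.X q).obj.obj (op V) :=
  sapp (f.f (-(p : ℤ)) ≫ (CochainComplex.shiftFunctorObjXIso K n (-(p : ℤ)) q h).hom) V
    (cechGen U p V s)

/-- The component in `F(V)` of a Čech cocycle with values in a sheaf `F`. -/
def cval₀ {F : ShAb X} {n : ℕ} (f : cech U ⟶ (single₀ F)⟦(n : ℤ)⟧) (V : Opens X)
    (s : Fin (n + 1) → {i : ι // V ≤ U i}) : F.obj.obj (op V) :=
  sapp (HomologicalComplex.singleObjXSelf (ComplexShape.up ℤ) 0 F).hom V
    (cval f n 0 (by omega) V s)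

/-- A bilinear pairing `E × F → G` of abelian sheaves. -/
structure Pairing (E F G : ShAb X) where
  app : ∀ V : Opens X, E.obj.obj (op V) →+ F.obj.obj (op V) →+ G.obj.obj (op V)
  nat : ∀ (V W : Opens X) (h : W ≤ V) (a : E.obj.obj (op V)) (b : F.obj.obj (op V)),
    (G.obj.map (homOfLE h).op).hom (app V a b) =
      app W ((E.obj.map (homOfLE h).op).hom a) ((F.obj.map (homOfLE h).op).hom b)

/-- `z = μ(x ⌣ y)`, computed by Čech cocycles `a`, `b` over an open cover: with the Koszul sign,
`(a ⌣ b)_{i_0 … i_{p+q}} = (-1)^{pq} μ(a_{i_0 … i_p}, b_{i_p … i_{p+q}})`. -/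
def IsCup {E F G : ShAb X} (μ : Pairing E F G) {p q n : ℕ} (h : p + q = n) (x : Sheaf.H E p)
    (y : Sheaf.H F q) (z : Sheaf.H G n) : Prop :=
  ∃ (ι : Type u) (U : ι → Opens X) (_ : iSup U = ⊤) (a : cech U ⟶ (single₀ E)⟦(p : ℤ)⟧)
    (b : cech U ⟶ (single₀ F)⟦(q : ℤ)⟧) (c : cech U ⟶ (single₀ G)⟦(n : ℤ)⟧),
    Represents a (toHyperH x) ∧ Represents b (toHyperH y) ∧ Represents c (toHyperH z) ∧
    ∀ (V : Opens X) (s : Fin (n + 1) → {i : ι // V ≤ U i}),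
      cval₀ c V s = (-1 : ℤ) ^ (p * q) • μ.app V
        (cval₀ a V fun j => s ⟨j, by omega⟩) (cval₀ b V fun j => s ⟨p + j, by omega⟩)

end Classes

/-! ### The cup square of the Atiyah class and the first Pontryagin class -/

namespace LieAlgebroid

variable {A : LieAlgebroid O}

section Pairing

variable (p : A.InvariantPairing)

/-- For sections `a`, `b` of `Hom(T, g)`, the section `ξ ↦ (η ↦ ⟨a ξ, b η⟩)` of
`Hom(T, Ω^1)`. -/
def InvariantPairing.homPairSec {U : Opens X} (a b : MSec (homMod (tangent O) A.g) U) :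
    MSec (homMod (tangent O) (Omega1 O)) U :=
  mkHomSec (fun V hV =>
    { toFun := fun ξ => mkHomSec (fun W hW =>
        { toFun := fun η => (p.pair W (toKer (mres A.g hW (hval a hV ξ)))
            (toKer (hval b (hW.trans hV) η)) : O.Sec W)
          map_add' := fun η ζ => by rw [map_add, map_add]; exact p.pair_add W _ _ _
          map_smul' := fun r η => by rw [map_smul, map_smul]; exact p.pair_smul W _ _ _ })
        (fun W W' hW hW' η => (p.pair_res W W' hW' _ _).trans (by
          rw [← toKer_mres, ← toKer_mres, mres_mres, hval_nat a]
          exact congrArg (fun c => p.pair W' (toKer (hval a _ (mres _ _ ξ))) (toKer c))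
            (hval_nat b _ hW' η)))
      map_add' := fun ξ ζ => hom_sec_ext fun W hW η => by
        change p.pair W (toKer (mres A.g hW (hval a hV (ξ + ζ)))) _ =
          p.pair W (toKer (mres A.g hW (hval a hV ξ))) _ +
            p.pair W (toKer (mres A.g hW (hval a hV ζ))) _
        rw [map_add, map_add, map_add, p.add_pair]
      map_smul' := fun r ξ => hom_sec_ext fun W hW η => by
        change p.pair W (toKer (mres A.g hW (hval a hV (r • ξ)))) _ =
          O.res hW r * p.pair W (toKer (mres A.g hW (hval a hV ξ))) _
        rw [map_smul, mres_smul, map_smul, p.smul_pair] })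
    (fun V W hV hW ξ => hom_sec_ext fun W' hW' η => by
      change p.pair W' (toKer (mres A.g _ (hval a hV ξ))) _ =
        p.pair W' (toKer (mres A.g hW' (hval a (hW.trans hV) (mres _ hW ξ)))) _
      rw [← hval_nat, mres_mres])

/-- The pairing `(Ω^1 ⊗ g) × (Ω^1 ⊗ g) → Ω^1 ⊗ Ω^1` induced by the pairing on `g`. -/
def InvariantPairing.homPair : Pairing ((homFunctor (tangent O)).obj A.g)
    ((homFunctor (tangent O)).obj A.g) ((homFunctor (tangent O)).obj (Omega1 O)) where
  app V := AddMonoidHom.mk' (fun a => AddMonoidHom.mk' (fun b => p.homPairSec (U := V) a b)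
      fun b c => hom_sec_ext fun W hW ξ => hom_sec_ext fun W' hW' η => by
        change p.pair W' _ (toKer (hval b _ η + hval c _ η)) =
          p.pair W' _ (toKer (hval b _ η)) + p.pair W' _ (toKer (hval c _ η))
        rw [map_add, p.pair_add])
    fun a b => AddMonoidHom.ext fun c =>
      hom_sec_ext fun W hW ξ => hom_sec_ext fun W' hW' η => by
        change p.pair W' (toKer (mres A.g hW' (hval a hW ξ + hval b hW ξ))) _ =
          p.pair W' (toKer (mres A.g hW' (hval a hW ξ))) _ +
            p.pair W' (toKer (mres A.g hW' (hval b hW ξ))) _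
        rw [map_add, map_add, p.add_pair]
  nat _ _ _ _ _ := rfl

end Pairing

/-- A flat connection on `A` over `U`: an `O`-linear section of the anchor that commutes with
brackets. -/
structure IsFlatConnection {U : Opens X} (D : MSec (homMod (tangent O) A.mod) U) : Prop where
  anchor : ∀ (V : Opens X) (hV : V ≤ U) (ξ : MSec (tangent O) V),
    happ A.anchor V (hval D hV ξ) = ξ
  flat : ∀ (V : Opens X) (hV : V ≤ U) (ξ η : MSec (tangent O) V),
    A.bracket V (hval D hV ξ) (hval D hV η) = hval D hV (lie ξ η)

section Pontryagin

variable {ι : Type u} {U : ι → Opens X} {D : ∀ i, MSec (homMod (tangent O) A.mod) (U i)}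
  (hD : ∀ i, IsFlatConnection (D i)) (p : A.InvariantPairing)

/-- The difference `A_{ij} = ∇_j - ∇_i` of two connections, with values in the kernel of the
anchor. -/
def connDiff {V : Opens X} (i j : {i : ι // V ≤ U i}) (ξ : MSec (tangent O) V) : A.ker V :=
  ⟨hval (D j.1) j.2 ξ - hval (D i.1) i.2 ξ, by
    rw [LinearMap.mem_ker, map_sub, (hD _).anchor, (hD _).anchor, sub_self]⟩

/-- For `a`, `b` with values in `g`, the 2-form `⟨a ∧ b⟩(ξ, η) = ⟨a ξ, b η⟩ - ⟨a η, b ξ⟩`. -/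
def InvariantPairing.wedge {V : Opens X} (a b : MSec (tangent O) V → A.ker V)
    (ξ η : MSec (tangent O) V) : O.Sec V :=
  p.pair V (a ξ) (b η) - p.pair V (a η) (b ξ)

/-- `B_{ijk} = -⟨A_{ij} ∧ A_{jk}⟩ - ⟨A_{jk} ∧ A_{ki}⟩ + ⟨A_{ki} ∧ A_{ij}⟩`. -/
def InvariantPairing.formB {V : Opens X} (i j k : {i : ι // V ≤ U i})
    (ξ η : MSec (tangent O) V) : O.Sec V :=
  -p.wedge (connDiff hD i j) (connDiff hD j k) ξ η -
    p.wedge (connDiff hD j k) (connDiff hD k i) ξ η +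
    p.wedge (connDiff hD k i) (connDiff hD i j) ξ η

/-- `H_{ij}(ξ, η, ζ) = ⟨A_{ij} ξ, [A_{ij} η, A_{ij} ζ]⟩`. -/
def InvariantPairing.formH {V : Opens X} (i j : {i : ι // V ≤ U i})
    (ξ η ζ : MSec (tangent O) V) : O.Sec V :=
  p.pair V (connDiff hD i j ξ) (ad (connDiff hD i j η : MSec A.mod V) (connDiff hD i j ζ))

variable [HasDerivedCategory.{w1} (ShAb X)]

/-- `P ∈ H^2(X; Ω^2 → Ω^{3,cl})` is the class `Π` computed by the cover `U` and the flat
connections `∇_i`, i.e. the class of the Čech cocycle with components `B_{ijk} ∈ Ω^2` and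
`H_{ij} ∈ Ω^{3,cl}`. -/
def InvariantPairing.IsPontryagin (P : HyperH (formComplex O) 2) : Prop :=
  ∃ f : cech U ⟶ (formComplex O)⟦((2 : ℕ) : ℤ)⟧, Represents f P ∧
    (∀ (V : Opens X) (s : Fin 3 → {i : ι // V ≤ U i}) (ξ η : MSec (tangent O) V),
      val2 (sapp (HomologicalComplex.doubleXIso₀ (extD O) _).hom V
        (cval f 2 0 (by norm_num) V s)) le_rfl (ξ, η) = p.formB hD (s 0) (s 1) (s 2) ξ η) ∧
    ∀ (V : Opens X) (s : Fin 2 → {i : ι // V ≤ U i}) (ξ η ζ : MSec (tangent O) V),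
      val3 (sapp (HomologicalComplex.doubleXIso₁ (extD O) _ (by norm_num)).hom V
        (cval f 1 1 (by norm_num) V s)) le_rfl (ξ, η, ζ) = p.formH hD (s 0) (s 1) ξ η ζ

end Pontryagin

end LieAlgebroid

variable (O) in
/-- The morphism of complexes `(Ω^2 → Ω^{3,cl}) → Ω^1 ⊗ Ω^1` given by the projection to `Ω^2`
and the inclusion of antisymmetric tensors. -/
def formsToTensors : formComplex O ⟶ single₀ ((homFunctor (tangent O)).obj (Omega1 O)) :=
  HomologicalComplex.mkHomToSingle
    ((HomologicalComplex.doubleXIso₀ (extD O) _).hom ≫ antisymm O) (fun i hi => by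
      have h : i ≠ 0 := by
        have : i + 1 = 0 := hi
        omega
      have h1 : (formComplex O).d i 0 = 0 := HomologicalComplex.double_d_eq_zero₀ _ _ _ _ h
      rw [h1, zero_comp])

end AtiyahPontryagin

end

open AtiyahPontryagin

noncomputable section

namespace AtiyahPontryagin

section

variable {X : TopCat.{u}}

/-! ### Exactness of sequences of sheafified presheaves -/

section Sheafify

/-! Both statements come from computing connecting homomorphisms on explicit Čech cochains. Over an
open set contained in a single `U_i` the Čech complex is contracted by coning with the vertex `i`.
For a cover the augmentation is therefore a quasi-isomorphism, and every Čech cocycle represents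
exactly one class. If a cocycle of degree `n` lifts to a cochain `g` in the middle term of a short
exact sequence, its product with the extension class is represented by `(-1)^(n+1) dg`
(`Represents.comp_extClass`).

Since `T` is locally free, `Hom(T, -)` is exact, and `α(A)` is the connecting class of the global
section `id` of `Hom(T, T)`. Local lifts of `id` along the anchor are local connections `∇_i`, so
`α(A)` is represented by `b_{ij} = -(∇_j - ∇_i)`. Every cocycle representing `α(A)` has this form,
because Čech `H^1` of a cover injects into `H^1` (`exists_d_comp_eq_of_represents_zero`,
`exists_lift_of_represents`).

The class `β` is the image of `α(A)` under the connecting map of `0 → Ω^1 → ĝ → g → 0`. A connection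
`∇` splits `ĝ → g` by sending `c` to the pair `(⟨c, 1 - ∇π⟩, c)`. Lift a cocycle `a_{ij}` of `α(A)`
by the splitting that belongs to `∇_j`, where the `∇_i` are the connections attached to a second
cocycle `b`. In the coboundary of the lift the `g`-component vanishes, and the other component
reduces to `a_{ij}` paired with the change of splitting from `∇_j` to `∇_k`, which is `-⟨a_{ij},
b_{jk}⟩`. Its minus sign is exactly the Koszul sign of the cup product
(`exists_represents_betaClass`).

For flat connections the differences `A_{ij}` satisfy Maurer-Cartan equations. Symmetry of the
pairing reduces `B_{ijk}` to `-⟨A_{ij} ∧ A_{jk}⟩`. Invariance and the Maurer-Cartan equations then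
show that `H` is closed and that the exterior derivative of `B` is the Čech coboundary of `H`
(`extD3_triple`, `extD2_wedge`), so `(B, H)` is a cocycle. Finally `½B_{ijk}` is the antisymmetric
part of the cup cocycle `-⟨A_{ij}, A_{jk}⟩`. By polarisation the two differ by the coboundary of
`-½⟨A_{ij}, A_{ij}⟩` (`half_formB_add`). -/

/-- Restriction of sections of an abelian sheaf. -/
abbrev sres (F : ShAb X) {U V : Opens X} (h : V ≤ U) (s : F.obj.obj (op U)) : F.obj.obj (op V) :=
  (F.obj.map (homOfLE h).op).hom s

lemma sapp_sres {F G : ShAb X} (φ : F ⟶ G) {U V : Opens X} (h : V ≤ U) (s : F.obj.obj (op U)) :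
    sapp φ V (sres F h s) = sres G h (sapp φ U s) :=
  ConcreteCategory.congr_hom (φ.hom.naturality (homOfLE h).op) s

lemma sres_sres (F : ShAb X) {U V W : Opens X} (h : V ≤ U) (k : W ≤ V) (s : F.obj.obj (op U)) :
    sres F k (sres F h s) = sres F (k.trans h) s :=
  (ConcreteCategory.congr_hom (F.obj.map_comp (homOfLE h).op (homOfLE k).op) s).symm

lemma sapp_comp {F G H : ShAb X} (φ : F ⟶ G) (ψ : G ⟶ H) (U : Opens X) (s : F.obj.obj (op U)) :
    sapp (φ ≫ ψ) U s = sapp ψ U (sapp φ U s) := rfl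

lemma sapp_sum {F G : ShAb X} (φ : F ⟶ G) (U : Opens X) {κ : Type*} (A : Finset κ)
    (s : κ → F.obj.obj (op U)) : sapp φ U (∑ i ∈ A, s i) = ∑ i ∈ A, sapp φ U (s i) :=
  map_sum (φ.hom.app (op U)).hom s A

lemma sapp_zsmul {F G : ShAb X} (φ : F ⟶ G) (U : Opens X) (n : ℤ) (s : F.obj.obj (op U)) :
    sapp φ U (n • s) = n • sapp φ U s :=
  map_zsmul (φ.hom.app (op U)).hom n s

lemma sapp_injective {F G : ShAb X} (φ : F ⟶ G) [Mono φ] (U : Opens X) :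
    Function.Injective (sapp φ U) := by
  have : Mono ((sheafToPresheaf _ _).map φ) := inferInstance
  have h : Mono (((sheafToPresheaf _ _).map φ).app (op U)) := inferInstance
  exact (AddCommGrpCat.mono_iff_injective _).1 h

/-- Exactness means that the map to `kernel S.g` is an epimorphism, which for sheaves is local
surjectivity. The inclusion of the kernel is injective on sections, so local lifts may be compared
in `S.X₂`. -/
lemma exact_of_locally (S : ShortComplex (ShAb X))
    (h : ∀ (U : Opens X) (t : S.X₂.obj.obj (op U)), sapp S.g U t = 0 → ∀ x ∈ U,
      ∃ V : Opens X, ∃ hV : V ≤ U, x ∈ V ∧ ∃ s, sapp S.f V s = sres S.X₂ hV t) : S.Exact := by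
  rw [ShortComplex.exact_iff_epi_kernel_lift, epi_iff_locally]
  intro U t x hx
  have h0 : sapp S.g U (sapp (kernel.ι S.g) U t) = 0 := by
    rw [← sapp_comp, kernel.condition]
    rfl
  obtain ⟨V, hV, hxV, s, hs⟩ := h U _ h0 x hx
  refine ⟨V, hV, hxV, s, sapp_injective (kernel.ι S.g) V ?_⟩
  rw [← sapp_comp, kernel.lift_ι, hs]
  exact (sapp_sres (kernel.ι S.g) hV t).symm

/-- The sheafification of presheaves of abelian groups. -/
abbrev shf (X : TopCat.{u}) : ((Opens X)ᵒᵖ ⥤ AddCommGrpCat.{u}) ⥤ ShAb X :=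
  presheafToSheaf (Opens.grothendieckTopology X) AddCommGrpCat.{u}

/-- The section of the sheafification given by a section of a presheaf. -/
abbrev toShf (P : (Opens X)ᵒᵖ ⥤ AddCommGrpCat.{u}) (U : Opens X) :
    P.obj (op U) →+ ((shf X).obj P).obj.obj (op U) :=
  ((toSheafify (Opens.grothendieckTopology X) P).app (op U)).hom

variable {P Q R : (Opens X)ᵒᵖ ⥤ AddCommGrpCat.{u}}

lemma sapp_toShf (f : P ⟶ Q) (U : Opens X) (s : P.obj (op U)) :
    sapp ((shf X).map f) U (toShf P U s) = toShf Q U ((f.app (op U)).hom s) :=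
  (ConcreteCategory.congr_hom (NatTrans.congr_app
    (toSheafify_naturality (Opens.grothendieckTopology X) f) (op U)) s).symm

lemma sres_toShf (P : (Opens X)ᵒᵖ ⥤ AddCommGrpCat.{u}) {U V : Opens X} (h : V ≤ U)
    (s : P.obj (op U)) :
    sres ((shf X).obj P) h (toShf P U s) = toShf P V ((P.map (homOfLE h).op).hom s) :=
  (ConcreteCategory.congr_hom
    ((toSheafify (Opens.grothendieckTopology X) P).naturality (homOfLE h).op) s).symm

/-- Together with `toShf_locally_injective`, this allows exactness after sheafification to be
checked on presheaf sections over small open sets. -/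
lemma toShf_locally_surjective (P : (Opens X)ᵒᵖ ⥤ AddCommGrpCat.{u}) (U : Opens X)
    (t : ((shf X).obj P).obj.obj (op U)) (x : X) (hx : x ∈ U) :
    ∃ V : Opens X, ∃ hV : V ≤ U, x ∈ V ∧ ∃ s, toShf P V s = sres ((shf X).obj P) hV t := by
  have h : TopCat.Presheaf.IsLocallySurjective (toSheafify (Opens.grothendieckTopology X) P) :=
    inferInstanceAs (Presheaf.IsLocallySurjective (Opens.grothendieckTopology X)
      (toSheafify (Opens.grothendieckTopology X) P))
  obtain ⟨V, hV, h1, h2⟩ := (TopCat.Presheaf.isLocallySurjective_iff _).1 h U t x hx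
  exact ⟨V, hV, h2, h1⟩

lemma toShf_locally_injective (P : (Opens X)ᵒᵖ ⥤ AddCommGrpCat.{u}) (U : Opens X)
    (s : P.obj (op U)) (hs : toShf P U s = 0) (x : X) (hx : x ∈ U) :
    ∃ V : Opens X, ∃ hV : V ≤ U, x ∈ V ∧ (P.map (homOfLE hV).op).hom s = 0 := by
  have h := Presheaf.equalizerSieve_mem (Opens.grothendieckTopology X)
    (toSheafify (Opens.grothendieckTopology X) P) (X := op U) s 0 (hs.trans (map_zero _).symm)
  obtain ⟨V, f, hf, hxV⟩ := h x hx
  exact ⟨V, f.le, hxV, (show _ = _ from hf).trans (map_zero (P.map f.op).hom)⟩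

/-- A complex of presheaves which is exact on small open sets is exact after sheafification. -/
lemma exact_shf (f : P ⟶ Q) (g : Q ⟶ R) (w : (shf X).map f ≫ (shf X).map g = 0)
    (h : ∀ x : X, ∃ W : Opens X, x ∈ W ∧ ∀ V ≤ W, ∀ t : Q.obj (op V),
      (g.app (op V)).hom t = 0 → ∃ s, (f.app (op V)).hom s = t) :
    (ShortComplex.mk _ _ w).Exact := by
  refine exact_of_locally _ fun U t ht x hx => ?_
  obtain ⟨W, hxW, hW⟩ := h x
  obtain ⟨V, hV, hxV, t', ht'⟩ := toShf_locally_surjective Q U t x hx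
  have h1 : toShf R V ((g.app (op V)).hom t') = 0 := by
    rw [← sapp_toShf, ht', sapp_sres]
    exact (congrArg _ ht).trans (map_zero _)
  obtain ⟨V', hV', hxV', h2⟩ := toShf_locally_injective R V _ h1 x hxV
  -- The presheaf representative `t'` is a cycle only after a further shrinking to `V'`.
  -- Intersecting with `W` reaches the range where the presheaf complex is exact.
  obtain ⟨s, hs⟩ := hW (V' ⊓ W) inf_le_right
    ((Q.map (homOfLE (inf_le_left.trans hV') : V' ⊓ W ⟶ V).op).hom t') (by
      have e1 : (g.app (op (V' ⊓ W))).hom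
          ((Q.map (homOfLE (inf_le_left.trans hV') : V' ⊓ W ⟶ V).op).hom t') =
          (R.map (homOfLE inf_le_left : V' ⊓ W ⟶ V').op).hom
            ((R.map (homOfLE hV').op).hom ((g.app (op V)).hom t')) :=
        (ConcreteCategory.congr_hom
          (g.naturality (homOfLE (inf_le_left.trans hV') : V' ⊓ W ⟶ V).op) t').trans
          (ConcreteCategory.congr_hom (R.map_comp (homOfLE hV').op
            (homOfLE inf_le_left : V' ⊓ W ⟶ V').op) _)
      rw [e1, h2, map_zero])
  refine ⟨V' ⊓ W, inf_le_left.trans (hV'.trans hV), ⟨hxV', hxW⟩, toShf P _ s, ?_⟩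
  refine (sapp_toShf f _ s).trans ?_
  rw [hs, ← sres_toShf, ht']
  exact sres_sres ((shf X).obj Q) _ _ t

lemma epi_shf (f : P ⟶ Q) (h : ∀ x : X, ∃ W : Opens X, x ∈ W ∧ ∀ V ≤ W, ∀ t : Q.obj (op V),
      ∃ s, (f.app (op V)).hom s = t) : Epi ((shf X).map f) := by
  rw [epi_iff_locally]
  intro U t x hx
  obtain ⟨W, hxW, hW⟩ := h x
  obtain ⟨V, hV, hxV, t', ht'⟩ := toShf_locally_surjective Q U t x hx
  obtain ⟨s, hs⟩ := hW (V ⊓ W) inf_le_right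
    ((Q.map (homOfLE inf_le_left : V ⊓ W ⟶ V).op).hom t')
  refine ⟨V ⊓ W, inf_le_left.trans hV, ⟨hxV, hxW⟩, toShf P _ s, ?_⟩
  refine (sapp_toShf f _ s).trans ?_
  rw [hs, ← sres_toShf, ht']
  exact sres_sres ((shf X).obj Q) _ _ t

/-- Morphisms from a sheafification are determined by their values on sections of the presheaf. -/
lemma shf_hom_ext {G : ShAb X} {φ ψ : (shf X).obj P ⟶ G}
    (h : ∀ U s, sapp φ U (toShf P U s) = sapp ψ U (toShf P U s)) : φ = ψ := by
  refine ((sheafificationAdjunction (Opens.grothendieckTopology X) AddCommGrpCat.{u}).homEquiv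
    P G).injective ?_
  ext U s
  exact h U.unop s

/-- The morphism from the sheafification given by a morphism from the presheaf. -/
def shfDesc {G : ShAb X} (φ : P ⟶ G.obj) : (shf X).obj P ⟶ G :=
  ⟨sheafifyLift (Opens.grothendieckTopology X) φ G.property⟩

lemma sapp_shfDesc {G : ShAb X} (φ : P ⟶ G.obj) (U : Opens X) (s : P.obj (op U)) :
    sapp (shfDesc φ) U (toShf P U s) = (φ.app (op U)).hom s :=
  ConcreteCategory.congr_hom (NatTrans.congr_app
    (toSheafify_sheafifyLift (Opens.grothendieckTopology X) φ G.property) (op U)) s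

end Sheafify

end

section

variable {X : TopCat.{u}}

/-! ### The Čech resolution -/

section CechExact

variable {ι : Type u} (U : ι → Opens X)

/-- The presheaf of chains on the nerve. -/
abbrev chains (p : ℕ) : (Opens X)ᵒᵖ ⥤ AddCommGrpCat.{u} :=
  (freeNerve U).obj (op (SimplexCategory.mk p))

/-- The simplices of the nerve over `V`. -/
abbrev Simp (p : ℕ) (V : Opens X) : Type u := Fin (p + 1) → {i : ι // V ≤ U i}

variable {U} in
/-- The generator of the group of chains given by a simplex. -/
def chainOf {p : ℕ} {V : Opens X} (s : Simp U p V) : (chains U p).obj (op V) :=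
  FreeAbelianGroup.of s

variable {U} in
/-- Restriction of simplices. -/
def simpRes {p : ℕ} {V W : Opens X} (h : W ≤ V) (s : Simp U p V) : Simp U p W :=
  fun j => ⟨(s j).1, h.trans (s j).2⟩

variable {U} in
lemma chains_hom_ext {p : ℕ} {V : Opens X} {A : Type*} [AddCommGroup A]
    {f g : (chains U p).obj (op V) →+ A} (h : ∀ s, f (chainOf s) = g (chainOf s)) : f = g :=
  FreeAbelianGroup.lift_ext f g h

/-- The boundary of chains. -/
def chainD (p : ℕ) : chains U (p + 1) ⟶ chains U p :=
  ∑ i : Fin (p + 2), (-1 : ℤ) ^ (i : ℕ) • (freeNerve U).δ i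

lemma chainD_of (p : ℕ) {V : Opens X} (s : Simp U (p + 1) V) :
    ((chainD U p).app (op V)).hom (chainOf s) =
      ∑ i : Fin (p + 2), (-1 : ℤ) ^ (i : ℕ) • chainOf (fun j => s (i.succAbove j)) := by
  let ev : (chains U (p + 1) ⟶ chains U p) →+ (chains U p).obj (op V) :=
    AddMonoidHom.mk' (fun f => (f.app (op V)).hom (chainOf s)) fun _ _ => rfl
  change ev (∑ i : Fin (p + 2), (-1 : ℤ) ^ (i : ℕ) • (freeNerve U).δ i) = _
  rw [map_sum]
  refine Finset.sum_congr rfl fun i _ => ?_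
  rw [map_zsmul]
  rfl

lemma nerveAug_of {V : Opens X} (s : Simp U 0 V) :
    ((nerveAug U).app (op V)).hom (chainOf s) = ULift.up 1 :=
  FreeAbelianGroup.lift_apply_of _ s

variable {U} in
/-- The cone contraction of the chains over `V ⊆ U_i`. -/
def coneMap (p : ℕ) {V : Opens X} (i : {i : ι // V ≤ U i}) :
    (chains U p).obj (op V) →+ (chains U (p + 1)).obj (op V) :=
  FreeAbelianGroup.lift fun s => chainOf (Fin.cons i s)

variable {U} in
lemma coneMap_of (p : ℕ) {V : Opens X} (i : {i : ι // V ≤ U i}) (s : Simp U p V) :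
    coneMap p i (chainOf s) = chainOf (Fin.cons i s) :=
  FreeAbelianGroup.lift_apply_of _ s

/-- Deleting the cone vertex returns the simplex, and every other face is the cone over a face whose
index is one lower. This is the contracting homotopy; it needs an index `i` with `V ⊆ U_i`. -/
lemma chainD_coneMap (p : ℕ) {V : Opens X} (i : {i : ι // V ≤ U i})
    (t : (chains U (p + 1)).obj (op V)) :
    ((chainD U (p + 1)).app (op V)).hom (coneMap (p + 1) i t) =
      t - coneMap p i (((chainD U p).app (op V)).hom t) := by
  refine DFunLike.congr_fun (f := ((chainD U (p + 1)).app (op V)).hom.comp (coneMap (p + 1) i))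
    (g := AddMonoidHom.id _ - (coneMap p i).comp ((chainD U p).app (op V)).hom)
    (chains_hom_ext fun s => ?_) t
  change ((chainD U (p + 1)).app (op V)).hom (coneMap (p + 1) i (chainOf s)) =
    chainOf s - coneMap p i (((chainD U p).app (op V)).hom (chainOf s))
  simp only [coneMap_of, chainD_of, map_sum, map_zsmul]
  rw [Fin.sum_univ_succ, sub_eq_add_neg, ← Finset.sum_neg_distrib]
  congr 1
  refine Finset.sum_congr rfl fun k _ => ?_
  -- Coning raises the index of a face by one, which flips its sign.
  rw [Fin.val_succ, pow_succ, mul_neg_one, neg_smul]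
  congr 3
  funext j
  refine Fin.cases ?_ (fun j => ?_) j
  · rw [Fin.succ_succAbove_zero, Fin.cons_zero, Fin.cons_zero]
  · rw [Fin.succ_succAbove_succ, Fin.cons_succ, Fin.cons_succ]

/-- At the bottom the second face of the edge `(i, s)` is the vertex `i` itself, so the error term
is the augmentation times that vertex. -/
lemma chainD_coneMap_zero {V : Opens X} (i : {i : ι // V ≤ U i})
    (t : (chains U 0).obj (op V)) :
    ((chainD U 0).app (op V)).hom (coneMap 0 i t) =
      t - (((nerveAug U).app (op V)).hom t : ULift ℤ).down • chainOf (fun _ => i) := by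
  refine DFunLike.congr_fun (f := ((chainD U 0).app (op V)).hom.comp (coneMap 0 i))
    (g := AddMonoidHom.id _ - (AddMonoidHom.flip (smulAddHom ℤ _) (chainOf (U := U) (fun _ => i))).comp
      (AddEquiv.ulift.toAddMonoidHom.comp ((nerveAug U).app (op V)).hom))
    (chains_hom_ext fun s => ?_) t
  change ((chainD U 0).app (op V)).hom (coneMap 0 i (chainOf s)) = chainOf s -
    (((nerveAug U).app (op V)).hom (chainOf s) : ULift ℤ).down • chainOf (fun _ => i)
  rw [coneMap_of, chainD_of, Fin.sum_univ_two, nerveAug_of, sub_eq_add_neg]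
  congr 1
  change (-1 : ℤ) ^ 1 • chainOf _ = -((1 : ℤ) • chainOf _)
  rw [pow_one, neg_one_smul, one_smul]
  congr 2
  funext j
  obtain rfl : j = 0 := Subsingleton.elim (α := Fin 1) j 0
  rfl

instance : (shf X).Additive := inferInstance

/-- The boundary of the sheafified chains. -/
lemma sheafNerve_d (p : ℕ) :
    ((AlgebraicTopology.alternatingFaceMapComplex (ShAb X)).obj (sheafNerve U)).d (p + 1) p =
      (shf X).map (chainD U p) := by
  rw [AlgebraicTopology.alternatingFaceMapComplex_obj_d,
    AlgebraicTopology.AlternatingFaceMapComplex.objD, chainD, Functor.map_sum]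
  refine Finset.sum_congr rfl fun i _ => ?_
  rw [Functor.map_zsmul]
  rfl

lemma cech_d (p : ℕ) : (cech U).d (-((p + 1 : ℕ) : ℤ)) (-(p : ℤ)) =
    (cechXIso U (p + 1)).hom ≫ (shf X).map (chainD U p) ≫ (cechXIso U p).inv := by
  rw [← sheafNerve_d]
  exact HomologicalComplex.extend_d_eq
    ((AlgebraicTopology.alternatingFaceMapComplex (ShAb X)).obj (sheafNerve U))
    ComplexShape.embeddingDownNat rfl rfl

variable {U}

lemma exists_nbhd_le (hU : iSup U = ⊤) (x : X) : ∃ i, x ∈ U i :=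
  Opens.mem_iSup.1 (hU.symm ▸ Opens.mem_top x)

/-- The cone contraction is not global, but it exists over every open subset of a member of the
cover, and this suffices after sheafification. -/
lemma sheafNerve_exactAt (hU : iSup U = ⊤) (p : ℕ) :
    ((AlgebraicTopology.alternatingFaceMapComplex (ShAb X)).obj (sheafNerve U)).ExactAt (p + 1) := by
  rw [HomologicalComplex.exactAt_iff' _ (p + 2) (p + 1) p (by simp) (by simp)]
  have w : (shf X).map (chainD U (p + 1)) ≫ (shf X).map (chainD U p) = 0 := by
    rw [← sheafNerve_d, ← sheafNerve_d, HomologicalComplex.d_comp_d]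
  have h := exact_shf _ _ w fun x => by
    obtain ⟨i, hi⟩ := exists_nbhd_le hU x
    refine ⟨U i, hi, fun V hV t ht => ⟨coneMap (p + 1) ⟨i, hV⟩ t, ?_⟩⟩
    rw [chainD_coneMap, ht, map_zero, sub_zero]
  let K := (AlgebraicTopology.alternatingFaceMapComplex (ShAb X)).obj (sheafNerve U)
  let e : K.sc' (p + 2) (p + 1) p ≅ ShortComplex.mk _ _ w :=
    ShortComplex.isoMk (Iso.refl _) (Iso.refl _) (Iso.refl _)
      ((Category.id_comp _).trans
        ((sheafNerve_d U (p + 1)).symm.trans (Category.comp_id (K.d (p + 2) (p + 1))).symm))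
      ((Category.id_comp _).trans
        ((sheafNerve_d U p).symm.trans (Category.comp_id (K.d (p + 1) p)).symm))
  exact (ShortComplex.exact_iff_of_iso e).2 h

lemma sheafAug_exact (hU : iSup U = ⊤) (w : (shf X).map (chainD U 0) ≫ sheafAug U = 0) :
    (ShortComplex.mk _ _ w).Exact := by
  refine exact_shf _ (nerveAug U) w fun x => ?_
  obtain ⟨i, hi⟩ := exists_nbhd_le hU x
  -- A 0-chain of augmentation zero is the boundary of its cone.
  refine ⟨U i, hi, fun V hV t ht => ⟨coneMap 0 ⟨i, hV⟩ t, ?_⟩⟩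
  rw [chainD_coneMap_zero, ht]
  exact (congrArg (t - ·) (zero_smul ℤ _)).trans (sub_zero t)

lemma sheafAug_epi (hU : iSup U = ⊤) : Epi (sheafAug U) := by
  refine epi_shf (nerveAug U) fun x => ?_
  obtain ⟨i, hi⟩ := exists_nbhd_le hU x
  refine ⟨U i, hi, fun V hV t => ⟨(t : ULift ℤ).down • chainOf (fun _ => ⟨i, hV⟩), ?_⟩⟩
  rw [map_zsmul, nerveAug_of]
  refine ULift.ext _ _ ?_
  change (t : ULift ℤ).down • (1 : ℤ) = (t : ULift ℤ).down
  simp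

end CechExact

end

section

variable {X : TopCat.{u}}

/-! ### The augmentation of the Čech resolution is a quasi-isomorphism. -/

section CechQuasiIso

variable {ι : Type u} {U : ι → Opens X}

lemma cech_d_zero : (cech U).d (-((1 : ℕ) : ℤ)) 0 =
    (cechXIso U 1).hom ≫ (shf X).map (chainD U 0) ≫ (cechXIso₀ U).inv :=
  cech_d U 0

lemma cechAug₀_exact (hU : iSup U = ⊤) :
    (ShortComplex.mk ((cech U).d (-1) 0) (cechAug₀ U) (d_cechAug₀ U (-1) rfl)).Exact := by
  have w : (shf X).map (chainD U 0) ≫ sheafAug U = 0 := by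
    have h := d_cechAug₀ U (-((1 : ℕ) : ℤ)) rfl
    rw [cech_d_zero, cechAug₀, Category.assoc, Category.assoc, Iso.inv_hom_id_assoc] at h
    exact (cancel_epi (cechXIso U 1).hom).1 (h.trans comp_zero.symm)
  let e : ShortComplex.mk ((cech U).d (-1) 0) (cechAug₀ U) (d_cechAug₀ U (-1) rfl) ≅
      ShortComplex.mk _ _ w :=
    ShortComplex.isoMk (cechXIso U 1) (cechXIso₀ U) (Iso.refl _)
      (by
        change _ = (cech U).d (-((1 : ℕ) : ℤ)) 0 ≫ (cechXIso₀ U).hom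
        rw [cech_d_zero, Category.assoc, Category.assoc, Iso.inv_hom_id, Category.comp_id])
      (Category.comp_id (cechAug₀ U)).symm
  exact (ShortComplex.exact_iff_of_iso e).2 (sheafAug_exact hU w)

lemma cechAug₀_epi (hU : iSup U = ⊤) : Epi (cechAug₀ U) := by
  have := sheafAug_epi hU
  exact epi_comp _ _

lemma cech_exactAt (hU : iSup U = ⊤) {n : ℤ} (hn : n ≠ 0) : (cech U).ExactAt n := by
  by_cases h : 0 < n
  · refine HomologicalComplex.extend_exactAt _ _ _ fun j hj => ?_
    have : -(j : ℤ) = n := hj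
    omega
  · obtain ⟨p, rfl⟩ : ∃ p : ℕ, n = -((p + 1 : ℕ) : ℤ) := ⟨(-n).toNat - 1, by omega⟩
    exact (HomologicalComplex.extend_exactAt_iff _ _ rfl).2 (sheafNerve_exactAt hU p)

/-- The term of degree 0 of a complex concentrated in degree 0. -/
def singleX (F : ShAb X) : (single₀ F).X 0 ≅ F :=
  HomologicalComplex.singleObjXSelf (ComplexShape.up ℤ) 0 F

lemma cechAug_f_zero : (cechAug U).f 0 = cechAug₀ U ≫ (singleX (constZ X)).inv :=
  HomologicalComplex.mkHomToSingle_f _ _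

lemma quasiIso_cechAug (hU : iSup U = ⊤) : QuasiIso (cechAug U) where
  quasiIsoAt n := by
    by_cases hn : n = 0
    · subst hn
      -- The term of degree 1 of the Čech complex and the neighbours of degree 0 in the target
      -- vanish. In degree 0 the claim therefore reduces to exactness of the end of the augmented
      -- complex.
      rw [quasiIsoAt_iff' _ (-1) 0 1 (by simp) (by simp),
        ShortComplex.quasiIso_iff_of_zeros']
      · have hw : (cech U).d (-1) 0 ≫ (cechAug U).f 0 = 0 := by
          have hd : (cech U).d (-1) 0 ≫ cechAug₀ U = 0 := d_cechAug₀ U (-1) rfl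
          rw [cechAug_f_zero, ← Category.assoc, hd, zero_comp]
        have he : Epi ((cechAug U).f 0) := by
          have := cechAug₀_epi hU
          rw [cechAug_f_zero]
          exact epi_comp _ _
        have hc : cechAug₀ U = (cechAug U).f 0 ≫ (singleX (constZ X)).hom := by
          rw [cechAug_f_zero, Category.assoc, Iso.inv_hom_id, Category.comp_id]
        let e : ShortComplex.mk ((cech U).d (-1) 0) ((cechAug U).f 0) hw ≅
            ShortComplex.mk ((cech U).d (-1) 0) (cechAug₀ U) (d_cechAug₀ U (-1) rfl) :=
          ShortComplex.isoMk (Iso.refl _) (Iso.refl _)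
            (singleX (constZ X))
            ((Category.id_comp _).trans (Category.comp_id _).symm)
            ((Category.id_comp _).trans hc)
        exact ⟨(ShortComplex.exact_iff_of_iso e).2 (cechAug₀_exact hU), he⟩
      · exact (HomologicalComplex.isZero_extend_X _ _ _ (fun i hi => by
          have : -(i : ℤ) = 1 := hi
          omega)).eq_of_tgt _ _
      · exact (HomologicalComplex.isZero_single_obj_X (ComplexShape.up ℤ) 0 (constZ X) (-1)
          (by omega)).eq_of_src _ _
      · exact (HomologicalComplex.isZero_single_obj_X (ComplexShape.up ℤ) 0 (constZ X) 1
          (by omega)).eq_of_tgt _ _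
    · have h := HomologicalComplex.exactAt_single_obj (ComplexShape.up ℤ) 0 (constZ X) n hn
      exact (quasiIsoAt_iff_exactAt' _ _ h).2 (cech_exactAt hU hn)

end CechQuasiIso

/-! ### Čech cochains as compatible families of sections. -/

section CechHom

variable {ι : Type u} {U : ι → Opens X} {F : ShAb X}

lemma cechGen_eq (p : ℕ) (V : Opens X) (s : Simp U p V) :
    cechGen U p V s = sapp (cechXIso U p).inv V (toShf (chains U p) V (chainOf s)) := rfl

lemma sres_cechGen (p : ℕ) {V W : Opens X} (h : W ≤ V) (s : Simp U p V) :
    sres _ h (cechGen U p V s) = cechGen U p W (simpRes h s) := by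
  rw [cechGen_eq, ← sapp_sres]
  exact congrArg (sapp (cechXIso U p).inv W) (sres_toShf (chains U p) h (chainOf s))

/-- Each term is the sheafification of a presheaf free on simplices, so the simplices detect
morphisms to a sheaf. Together with `cechDesc`, cochains become families of sections compatible with
restriction. -/
lemma cechX_hom_ext {p : ℕ} {φ ψ : (cech U).X (-(p : ℤ)) ⟶ F}
    (h : ∀ V s, sapp φ V (cechGen U p V s) = sapp ψ V (cechGen U p V s)) : φ = ψ := by
  refine (cancel_epi (cechXIso U p).inv).1 (shf_hom_ext fun V t => ?_)
  refine DFunLike.congr_fun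
    (f := (((cechXIso U p).inv ≫ φ).hom.app (op V)).hom.comp (toShf (chains U p) V))
    (g := (((cechXIso U p).inv ≫ ψ).hom.app (op V)).hom.comp (toShf (chains U p) V))
    (chains_hom_ext fun s => ?_) t
  exact h V s

/-- The morphism from a term of the Čech resolution given by a family of sections. -/
def cechDesc (p : ℕ) (c : ∀ V : Opens X, Simp U p V → F.obj.obj (op V))
    (hc : ∀ (V W : Opens X) (h : W ≤ V) (s : Simp U p V),
      sres F h (c V s) = c W (simpRes h s)) : (cech U).X (-(p : ℤ)) ⟶ F :=
  (cechXIso U p).hom ≫ shfDesc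
    { app := fun V => AddCommGrpCat.ofHom (FreeAbelianGroup.lift (c V.unop))
      naturality := fun V W i => AddCommGrpCat.hom_ext (chains_hom_ext fun s => by
        have h1 : FreeAbelianGroup.lift (c V.unop) (FreeAbelianGroup.of s) = c V.unop s :=
          FreeAbelianGroup.lift_apply_of _ _
        have h2 : FreeAbelianGroup.lift (c W.unop) (FreeAbelianGroup.of (simpRes i.unop.le s)) =
          c W.unop _ := FreeAbelianGroup.lift_apply_of _ _
        exact h2.trans ((hc V.unop W.unop i.unop.le s).symm.trans (congrArg (F.obj.map i).hom h1).symm)) }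

lemma sapp_cechDesc (p : ℕ) (c : ∀ V : Opens X, Simp U p V → F.obj.obj (op V)) (hc)
    (V : Opens X) (s : Simp U p V) : sapp (cechDesc p c hc) V (cechGen U p V s) = c V s := by
  have h : sapp (cechXIso U p).hom V (cechGen U p V s) = toShf (chains U p) V (chainOf s) := by
    rw [cechGen_eq, ← sapp_comp, Iso.inv_hom_id]
    rfl
  rw [cechDesc, sapp_comp, h, sapp_shfDesc]
  exact FreeAbelianGroup.lift_apply_of _ _

lemma cech_d_cechGen (p : ℕ) (V : Opens X) (s : Simp U (p + 1) V) :
    sapp ((cech U).d (-((p + 1 : ℕ) : ℤ)) (-(p : ℤ))) V (cechGen U (p + 1) V s) =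
      ∑ i : Fin (p + 2), (-1 : ℤ) ^ (i : ℕ) • cechGen U p V (fun j => s (i.succAbove j)) := by
  have h : sapp (cechXIso U (p + 1)).hom V (cechGen U (p + 1) V s) =
      toShf (chains U (p + 1)) V (chainOf s) := by
    rw [cechGen_eq, ← sapp_comp, Iso.inv_hom_id]
    rfl
  rw [cech_d, sapp_comp, h, sapp_comp, sapp_toShf, chainD_of, map_sum]
  refine (sapp_sum (cechXIso U p).inv V _ _).trans (Finset.sum_congr rfl fun i _ => ?_)
  rw [map_zsmul]
  exact sapp_zsmul (cechXIso U p).inv V _ _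

lemma sapp_cech_d_comp (p : ℕ) (φ : (cech U).X (-(p : ℤ)) ⟶ F) (V : Opens X)
    (s : Simp U (p + 1) V) :
    sapp ((cech U).d (-((p + 1 : ℕ) : ℤ)) (-(p : ℤ)) ≫ φ) V (cechGen U (p + 1) V s) =
      ∑ i : Fin (p + 2), (-1 : ℤ) ^ (i : ℕ) •
        sapp φ V (cechGen U p V (fun j => s (i.succAbove j))) := by
  rw [sapp_comp, cech_d_cechGen, sapp_sum]
  exact Finset.sum_congr rfl fun i _ => sapp_zsmul φ V _ _

end CechHom

end

section

variable {X : TopCat.{u}}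

/-! ### Connecting homomorphisms on classes of cocycles -/

section Connecting

open CochainComplex HomComplex DerivedCategory

variable {C : Type*} [Category* C] [Abelian C] 

/-- The morphism `K ⟶ F[n]` given by a morphism `K^p ⟶ F` with `p = -n`. -/
def toSingleHom {K : CochainComplex C ℤ} {F : C} {p n : ℤ} (f : K.X p ⟶ F) (h : p + n = 0) (p' : ℤ)
    (hp' : p' + 1 = p) (hf : K.d p' p ≫ f = 0) :
    K ⟶ ((CochainComplex.singleFunctor C 0).obj F)⟦n⟧ :=
  Cocycle.equivHomShift.symm (Cocycle.toSingleMk f h p' hp' hf)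

/-- This translates composition of shifted morphisms into composition of cochains. No sign appears,
which matters for the bookkeeping in `cocycle_comp_triangleOfSESδ`. -/
lemma equivHomShift_shiftedHom_comp {K L M : CochainComplex C ℤ} {n m k : ℤ} (l : K ⟶ L⟦n⟧)
    (t : L ⟶ M⟦k⟧) (h : k + n = m) :
    (Cocycle.equivHomShift (ShiftedHom.comp l t h : K ⟶ M⟦m⟧)).1 =
      (Cocycle.equivHomShift l).1.comp (Cocycle.equivHomShift t).1 (by omega) := by
  ext p q hpq
  have h1 : ∀ {A B : CochainComplex C ℤ} {r : ℤ} (f : A ⟶ B⟦r⟧) (p q : ℤ) (hpq : p + r = q),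
      (Cocycle.equivHomShift f).1.v p q hpq =
        f.f p ≫ (CochainComplex.shiftFunctorObjXIso B r p q hpq.symm).hom := by
    intro A B r f p q hpq
    simp [Cocycle.equivHomShift_apply, Cochain.rightUnshift_v _ _ _ _ _ _ _ (add_zero p)]
  rw [Cochain.comp_v _ _ _ p (p + n) q rfl (by omega), h1, h1, h1, ShiftedHom.comp,
    HomologicalComplex.comp_f, HomologicalComplex.comp_f, CochainComplex.shiftFunctorAdd'_inv_app_f']
  subst h
  obtain rfl : p + (k + n) = q := hpq
  simp [CochainComplex.shiftFunctor_map_f']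
  exact congrArg (· ≫ t.f (p + n) ≫ (HomologicalComplex.XIsoOfEq M _).hom)
    (Category.comp_id (l.f p)).symm

variable [HasDerivedCategory.{w1} C]

/-- In the derived category the third term of a short exact sequence is the mapping cone, and the
connecting morphism becomes the third morphism of the cone triangle. A class that lifts to the cone
can thus be pushed forward at the level of complexes. -/
lemma map_comp_triangleOfSESδ {S : ShortComplex (CochainComplex C ℤ)} (hS : S.ShortExact)
    {K : CochainComplex C ℤ} {n m : ℤ} (h : 1 + n = m) (l : K ⟶ (mappingCone S.f)⟦n⟧) :
    (ShiftedHom.map (l ≫ (mappingCone.descShortComplex S)⟦n⟧') Q).comp (triangleOfSESδ hS) h =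
      ShiftedHom.map (ShiftedHom.comp l (mappingCone.triangle S.f).mor₃ h) Q := by
  have h1 : ShiftedHom.map (l ≫ (mappingCone.descShortComplex S)⟦n⟧') Q =
      (ShiftedHom.map l Q).comp (ShiftedHom.mk₀ 0 rfl (Q.map (mappingCone.descShortComplex S)))
        (zero_add n) := by
    rw [← ShiftedHom.map_mk₀, ← ShiftedHom.map_comp, ShiftedHom.comp_mk₀]
  rw [h1, ShiftedHom.comp_assoc _ _ _ _ (add_zero 1) (by omega), ShiftedHom.mk₀_comp]
  refine Eq.trans ?_ (ShiftedHom.map_comp l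
    (show ShiftedHom (mappingCone S.f) S.X₁ (1 : ℤ) from (mappingCone.triangle S.f).mor₃) h Q).symm
  exact congrArg (fun t => (ShiftedHom.map l Q).comp t h) (descShortComplex_triangleOfSESδ hS)

/-- The classical zigzag: lift `z` to a cochain `β`, differentiate, and pull back to `T.X₁`. The
pair `(-α, β)` is a cocycle in the mapping cone of `T.f` that lies over `z`. -/
lemma cocycle_comp_triangleOfSESδ {T : ShortComplex (CochainComplex C ℤ)} (hT : T.ShortExact)
    {K : CochainComplex C ℤ} {n m : ℤ} (hm : 1 + n = m) (α : Cocycle K T.X₁ m)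
    (β : Cochain K T.X₂ n) (z : Cocycle K T.X₃ n)
    (hβ : β.comp (Cochain.ofHom T.g) (add_zero n) = z.1)
    (hα : δ n m β = α.1.comp (Cochain.ofHom T.f) (add_zero m)) :
    (ShiftedHom.map (Cocycle.equivHomShift.symm z) Q).comp (triangleOfSESδ hT) hm =
      ShiftedHom.map (Cocycle.equivHomShift.symm α) Q := by
  have hnm : n + 1 = m := by omega
  have eq : δ n m β + (-α).1.comp (Cochain.ofHom T.f) (add_zero m) = 0 := by
    rw [hα]
    simp
  let l := Cocycle.equivHomShift.symm (mappingCone.liftCocycle T.f (-α) β hnm eq)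
  have h1 : l ≫ (mappingCone.descShortComplex T)⟦n⟧' = Cocycle.equivHomShift.symm z := by
    apply Cocycle.equivHomShift.injective
    rw [Cocycle.equivHomShift_comp_shift, AddEquiv.apply_symm_apply, AddEquiv.apply_symm_apply]
    ext : 1
    rw [← hβ, Cocycle.postcomp_coe, mappingCone.liftCocycle_coe, mappingCone.descShortComplex]
    ext p q hpq
    simp [mappingCone.liftCochain]
  have h2 : ShiftedHom.comp l (show ShiftedHom (mappingCone T.f) T.X₁ (1 : ℤ) from
      (mappingCone.triangle T.f).mor₃) hm = Cocycle.equivHomShift.symm α := by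
    apply Cocycle.equivHomShift.injective
    ext : 1
    -- The third morphism of the cone triangle is minus the first projection. This cancels the sign
    -- of `-α`.
    have h3 : (Cocycle.equivHomShift (show mappingCone T.f ⟶ T.X₁⟦(1 : ℤ)⟧ from
        (mappingCone.triangle T.f).mor₃)) = -mappingCone.fst T.f :=
      AddEquiv.apply_symm_apply Cocycle.equivHomShift (-mappingCone.fst T.f)
    rw [equivHomShift_shiftedHom_comp, AddEquiv.apply_symm_apply, AddEquiv.apply_symm_apply]
    refine (congrArg (fun t : Cocycle _ _ 1 => (mappingCone.liftCocycle T.f (-α) β hnm eq).1.comp t.1 hnm) h3).trans ?_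
    simp
  rw [← h1, ← h2]
  exact map_comp_triangleOfSESδ _ hm l

/-- A complex concentrated in degree 0 has zero differential, so the differential of a cochain with
values in it is only precomposition with `d`, multiplied by `(-1)^m`. This is the origin of the sign
of the connecting map. -/
lemma toSingleHom_comp_triangleOfSESδ {S : ShortComplex C} (hS : S.ShortExact)
    {K : CochainComplex C ℤ} {n m p p' p'' : ℤ} (h : p + n = 0) (hm : 1 + n = m) (hp' : p' + 1 = p)
    (hp'' : p'' + 1 = p') (g : K.X p ⟶ S.X₂) (u : K.X p' ⟶ S.X₁) (hu : u ≫ S.f = K.d p' p ≫ g)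
    (hf : K.d p' p ≫ g ≫ S.g = 0) (hu' : K.d p'' p' ≫ (m.negOnePow • u) = 0) :
    (ShiftedHom.map (toSingleHom (g ≫ S.g) h p' hp' hf) Q).comp
      (triangleOfSESδ (hS.map_of_exact (HomologicalComplex.single C (ComplexShape.up ℤ) 0))) hm =
    ShiftedHom.map (toSingleHom (m.negOnePow • u) (by omega) p'' hp'' hu') Q := by
  refine cocycle_comp_triangleOfSESδ
    (hS.map_of_exact (HomologicalComplex.single C (ComplexShape.up ℤ) 0)) hm
    (Cocycle.toSingleMk (m.negOnePow • u) (by omega) p'' hp'' hu')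
    (Cochain.toSingleMk g h) (Cocycle.toSingleMk (g ≫ S.g) h p' hp' hf)
    (Cochain.toSingleMk_postcomp g h S.g).symm ?_
  have hpm : p' + m = 0 := by omega
  refine Eq.trans ?_ (Cochain.toSingleMk_postcomp (m.negOnePow • u) hpm S.f)
  have h2 : m.negOnePow • Cochain.toSingleMk (K.d p' p ≫ g) hpm =
      Cochain.toSingleMk (m.negOnePow • (K.d p' p ≫ g)) hpm := by
    rw [Units.smul_def, Units.smul_def]
    exact (map_zsmul (Cochain.toSingleEquiv hpm).symm _ _).symm
  refine (Cochain.δ_toSingleMk _ _ _ _ _).trans (h2.trans ?_)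
  rw [← hu, Units.smul_def, Units.smul_def, Preadditive.zsmul_comp]

end Connecting

end

section

variable {X : TopCat.{u}}

/-! ### Čech cocycles with values in a sheaf -/

section Cocycles

open CochainComplex HomComplex DerivedCategory

variable {ι : Type u} {U : ι → Opens X} {F G : ShAb X}

/-- The Čech cocycle given by its component. -/
def cechHom (n : ℕ) (f : (cech U).X (-(n : ℤ)) ⟶ F)
    (hf : (cech U).d (-((n + 1 : ℕ) : ℤ)) (-(n : ℤ)) ≫ f = 0) : cech U ⟶ (single₀ F)⟦(n : ℤ)⟧ :=
  toSingleHom f (by omega) _ (by push_cast; ring) hf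

/-- The component of a Čech cocycle. -/
def cechComp {n : ℕ} (a : cech U ⟶ (single₀ F)⟦(n : ℤ)⟧) : (cech U).X (-(n : ℤ)) ⟶ F :=
  (a.f (-(n : ℤ)) ≫
    (CochainComplex.shiftFunctorObjXIso (single₀ F) n (-(n : ℤ)) 0 (by omega)).hom) ≫
      (singleX F).hom

lemma cechComp_eq {n : ℕ} (a : cech U ⟶ (single₀ F)⟦(n : ℤ)⟧) :
    cechComp a = Cochain.toSingleEquiv (p := -(n : ℤ)) (q := 0) (by omega)
      (Cocycle.equivHomShift a).1 := by
  have h1 : (Cocycle.equivHomShift a).1.v (-(n : ℤ)) 0 (by omega) =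
        a.f (-(n : ℤ)) ≫ (CochainComplex.shiftFunctorObjXIso (single₀ F) n (-(n : ℤ)) 0
          (by omega)).hom := by
    simp [Cocycle.equivHomShift_apply, Cochain.rightUnshift_v _ _ _ _ _ _ _ (add_zero (-(n : ℤ)))]
  change _ = (Cocycle.equivHomShift a).1.v (-(n : ℤ)) 0 _ ≫ (singleX F).hom
  rw [h1]
  rfl

lemma cechComp_cechHom (n : ℕ) (f : (cech U).X (-(n : ℤ)) ⟶ F) (hf) :
    cechComp (cechHom n f hf) = f := by
  rw [cechComp_eq, cechHom, toSingleHom]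
  refine (congrArg (fun t : Cocycle (cech U) (single₀ F) (n : ℤ) =>
    Cochain.toSingleEquiv (p := -(n : ℤ)) (q := 0) (by omega) t.1)
      (AddEquiv.apply_symm_apply Cocycle.equivHomShift _)).trans ?_
  exact Cochain.toSingleEquiv_toSingleMk _ _

lemma exists_cechHom {n : ℕ} (a : cech U ⟶ (single₀ F)⟦(n : ℤ)⟧) : ∃ f hf, cechHom n f hf = a := by
  obtain ⟨f, hf, h⟩ := Cocycle.toSingleMk_surjective (Cocycle.equivHomShift a) (-(n : ℤ)) (by omega)
    (-((n + 1 : ℕ) : ℤ)) (by push_cast; ring)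
  exact ⟨f, hf, Cocycle.equivHomShift.injective (by
    rw [← h]; exact AddEquiv.apply_symm_apply Cocycle.equivHomShift _)⟩

lemma d_cechComp {n : ℕ} (a : cech U ⟶ (single₀ F)⟦(n : ℤ)⟧) :
    (cech U).d (-((n + 1 : ℕ) : ℤ)) (-(n : ℤ)) ≫ cechComp a = 0 := by
  obtain ⟨f, hf, rfl⟩ := exists_cechHom a
  rw [cechComp_cechHom, hf]

lemma cechHom_cechComp {n : ℕ} (a : cech U ⟶ (single₀ F)⟦(n : ℤ)⟧) :
    cechHom n (cechComp a) (d_cechComp a) = a := by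
  obtain ⟨f, hf, rfl⟩ := exists_cechHom a
  congr 1
  exact cechComp_cechHom n f hf

/-- The target has only one nonzero term, so cocycles with values in a sheaf can be handled through
a single component. -/
lemma cechComp_injective {n : ℕ} {a b : cech U ⟶ (single₀ F)⟦(n : ℤ)⟧}
    (h : cechComp a = cechComp b) : a = b := by
  rw [← cechHom_cechComp a, ← cechHom_cechComp b]
  congr 1

lemma cechComp_add {n : ℕ} (a b : cech U ⟶ (single₀ F)⟦(n : ℤ)⟧) :
    cechComp (a + b) = cechComp a + cechComp b := by
  rw [cechComp_eq, cechComp_eq, cechComp_eq, map_add]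
  exact map_add (Cochain.toSingleEquiv _) _ _

lemma cechComp_neg {n : ℕ} (a : cech U ⟶ (single₀ F)⟦(n : ℤ)⟧) :
    cechComp (-a) = -cechComp a := by
  rw [cechComp_eq, cechComp_eq, map_neg]
  exact map_neg (Cochain.toSingleEquiv _) _

lemma cechComp_postcomp {n : ℕ} (a : cech U ⟶ (single₀ F)⟦(n : ℤ)⟧) (φ : F ⟶ G) :
    cechComp (a ≫ ((CochainComplex.singleFunctor (ShAb X) 0).map φ)⟦(n : ℤ)⟧') = cechComp a ≫ φ := by
  obtain ⟨f, hf, rfl⟩ := exists_cechHom a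
  have h := Cocycle.toSingleMk_postcomp f (by omega) (-((n + 1 : ℕ) : ℤ)) (by push_cast; ring) hf φ
    (n := n) (q := 0)
  rw [cechComp_cechHom]
  have h2 := Cocycle.equivHomShift_symm_postcomp
    (Cocycle.toSingleMk f (by omega) (-((n + 1 : ℕ) : ℤ)) (by push_cast; ring) hf)
    ((CochainComplex.singleFunctor (ShAb X) 0).map φ) (n := n)
  have h3 : cechHom n f hf ≫ ((CochainComplex.singleFunctor (ShAb X) 0).map φ)⟦(n : ℤ)⟧' =
      cechHom n (f ≫ φ) (by rw [← Category.assoc, hf, zero_comp]) :=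
    h2.symm.trans (congrArg Cocycle.equivHomShift.symm h.symm)
  rw [h3, cechComp_cechHom]

variable [HasDerivedCategory.{w1} (ShAb X)]

lemma represents_iff {K : CochainComplex (ShAb X) ℤ} {n : ℕ} (f : cech U ⟶ K⟦(n : ℤ)⟧)
    (x : HyperH K n) : Represents f x ↔ Q.map (cechAug U) ≫ x = ShiftedHom.map f Q := Iff.rfl

/-- Invertibility of the augmentation in the derived category gives each cocycle of a cover exactly
one class: see `Represents.unique` and `exists_represents`. -/
lemma isIso_Q_cechAug (hU : iSup U = ⊤) : IsIso (Q.map (cechAug U)) := by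
  have := quasiIso_cechAug hU
  exact Localization.inverts Q (HomologicalComplex.quasiIso _ _) _
    ((HomologicalComplex.mem_quasiIso_iff _).2 this)

lemma Represents.unique {K : CochainComplex (ShAb X) ℤ} {n : ℕ} {f : cech U ⟶ K⟦(n : ℤ)⟧}
    {x y : HyperH K n} (hU : iSup U = ⊤) (hx : Represents f x) (hy : Represents f y) : x = y := by
  have h : Q.map (cechAug U) ≫ x = Q.map (cechAug U) ≫ y := hx.trans hy.symm
  obtain ⟨r, -, hr⟩ := (isIso_Q_cechAug hU).out
  have h1 (z : HyperH K n) : r ≫ Q.map (cechAug U) ≫ z = z :=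
    (Category.assoc r (Q.map (cechAug U)) z).symm.trans
      ((congrArg (fun t => t ≫ z) hr).trans (Category.id_comp z))
  rw [← h1 x, ← h1 y]
  exact congrArg (fun t => r ≫ t) h

lemma exists_represents {K : CochainComplex (ShAb X) ℤ} {n : ℕ} (f : cech U ⟶ K⟦(n : ℤ)⟧)
    (hU : iSup U = ⊤) : ∃ x : HyperH K n, Represents f x := by
  obtain ⟨r, hr, -⟩ := (isIso_Q_cechAug hU).out
  exact ⟨r ≫ ShiftedHom.map f Q, (Category.assoc (Q.map (cechAug U)) r (ShiftedHom.map f Q)).symm.trans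
    ((congrArg (fun t => t ≫ ShiftedHom.map f Q) hr).trans (Category.id_comp _))⟩

lemma toHyperH_injective {n : ℕ} {x y : Sheaf.H F n} (h : toHyperH x = toHyperH y) : x = y :=
  Ext.ext h

lemma Represents.neg {K : CochainComplex (ShAb X) ℤ} {n : ℕ} {f : cech U ⟶ K⟦(n : ℤ)⟧}
    {x : HyperH K n} (hf : Represents f x) : Represents (-f) (-x) := by
  rw [represents_iff] at *
  refine (Preadditive.comp_neg _ x).trans ?_
  refine (congrArg Neg.neg hf).trans ?_
  rw [ShiftedHom.map, ShiftedHom.map, Q.map_neg, Preadditive.neg_comp]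

lemma Represents.map {K L : CochainComplex (ShAb X) ℤ} {n : ℕ} {f : cech U ⟶ K⟦(n : ℤ)⟧}
    {x : HyperH K n} (hf : Represents f x) (φ : K ⟶ L) :
    Represents (f ≫ φ⟦(n : ℤ)⟧') (HyperH.map φ x) := by
  rw [represents_iff] at *
  have h1 : ShiftedHom.map (f ≫ φ⟦(n : ℤ)⟧') Q = ShiftedHom.map f Q ≫ (Q.map φ)⟦(n : ℤ)⟧' := by
    rw [← ShiftedHom.comp_mk₀ (m₀ := (0 : ℤ)) f rfl φ, ShiftedHom.map_comp, ShiftedHom.map_mk₀,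
      ShiftedHom.comp_mk₀]
  rw [h1, ← hf]
  exact (Category.assoc _ _ _).symm

lemma toHyperH_comp_mk₀ {n : ℕ} (x : Sheaf.H F n) (φ : F ⟶ G) :
    toHyperH (x.comp (Ext.mk₀ φ) (add_zero n)) =
      HyperH.map ((CochainComplex.singleFunctor (ShAb X) 0).map φ) (toHyperH x) := by
  rw [toHyperH, Ext.comp_hom, Ext.mk₀_hom]
  exact ShiftedHom.comp_mk₀ _ _ _ _

lemma Represents.postcomp {n : ℕ} {f : cech U ⟶ (single₀ F)⟦(n : ℤ)⟧} {x : Sheaf.H F n}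
    (hf : Represents f (toHyperH x)) (φ : F ⟶ G) :
    Represents (f ≫ ((CochainComplex.singleFunctor (ShAb X) 0).map φ)⟦(n : ℤ)⟧')
      (toHyperH (x.comp (Ext.mk₀ φ) (add_zero n))) := by
  rw [toHyperH_comp_mk₀]
  exact hf.map _

/-- Cohomologous cocycles represent the same class. -/
lemma Represents.of_coboundary {n : ℕ} {f g : cech U ⟶ (single₀ F)⟦((n + 1 : ℕ) : ℤ)⟧}
    {x : HyperH (single₀ F) (n + 1)} (hf : Represents f x) (w : (cech U).X (-(n : ℤ)) ⟶ F)
    (hw : cechComp g - cechComp f = (cech U).d (-((n + 1 : ℕ) : ℤ)) (-(n : ℤ)) ≫ w) :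
    Represents g x := by
  -- A coboundary in the Hom complex is a null-homotopic morphism. Hence `f` and `g` agree in the
  -- homotopy category, and so in the derived category.
  have hz : Cocycle.equivHomShift (g - f) ∈ coboundaries _ _ _ := by
    have h := (Cocycle.toSingleMk_mem_coboundaries_iff (cechComp (g - f)) (by omega)
      (-((n + 1 + 1 : ℕ) : ℤ)) (by push_cast; ring) (d_cechComp (g - f)) (-(n : ℤ))
      (by push_cast; ring)  (n := ((n + 1 : ℕ) : ℤ)) (q := 0)).2 ⟨w, by
        rw [← hw, sub_eq_add_neg, sub_eq_add_neg, cechComp_add, cechComp_neg]⟩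
    convert h using 1
    rw [← AddEquiv.eq_symm_apply]
    exact (cechHom_cechComp (g - f)).symm
  have h2 := (CohomologyClass.toHom_mk_eq_zero_iff _).2 hz
  rw [CohomologyClass.toHom_mk, AddEquiv.symm_apply_apply, Functor.map_sub, sub_eq_zero] at h2
  have h3 : Q.map g = Q.map f := congrArg Qh.map h2
  rw [represents_iff] at *
  rw [hf, ShiftedHom.map, ShiftedHom.map, h3]

end Cocycles

end

section

variable {X : TopCat.{u}}

/-! ### Connecting maps and degree-zero classes in terms of Čech cocycles. -/

section Cohomology

open CochainComplex HomComplex DerivedCategory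

variable {ι : Type u} {U : ι → Opens X} {F G : ShAb X}

/-- The two models of an object in degree 0 of the derived category are compared by isomorphisms
whose components are identities, so the conjugation in `singleδ` disappears. -/
lemma singleδ_eq {C : Type*} [Category* C] [Abelian C] [HasDerivedCategory.{w1} C]
    {S : ShortComplex C} (hS : S.ShortExact) : hS.singleδ =
      triangleOfSESδ (hS.map_of_exact (HomologicalComplex.single C (ComplexShape.up ℤ) 0)) := by
  have h1 : ((SingleFunctors.evaluation _ _ (0 : ℤ)).mapIso
      (singleFunctorsPostcompQIso C)).hom.app S.X₃ =
      𝟙 (Q.obj ((CochainComplex.singleFunctor C 0).obj S.X₃)) :=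
    NatTrans.congr_app (singleFunctorsPostcompQIso_hom_hom C 0) S.X₃
  have h2 : ((SingleFunctors.evaluation _ _ (0 : ℤ)).mapIso
      (singleFunctorsPostcompQIso C)).inv.app S.X₁ =
      𝟙 (Q.obj ((CochainComplex.singleFunctor C 0).obj S.X₁)) :=
    NatTrans.congr_app (singleFunctorsPostcompQIso_inv_hom C 0) S.X₁
  refine (congrArg₂ (fun a b => a ≫ triangleOfSESδ (hS.map_of_exact
    (HomologicalComplex.single C (ComplexShape.up ℤ) 0)) ≫ b⟦(1 : ℤ)⟧') h1 h2).trans ?_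
  refine (Category.id_comp _).trans ?_
  refine (congrArg (fun t => _ ≫ t) (CategoryTheory.Functor.map_id _ _)).trans ?_
  exact Category.comp_id _

lemma comp_comp_inv_comp_hom {C : Type*} [Category* C] {A B D E : C} (a : A ⟶ B) (h : B ⟶ D)
    (e : E ≅ D) : (a ≫ h ≫ e.inv) ≫ e.hom = a ≫ h := by
  rw [Category.assoc, Category.assoc, e.inv_hom_id, Category.comp_id]

/-- This removes the isomorphism between a complex and its shift by zero, where the zero is the cast
of the natural number indexing Čech degree. -/
lemma mk₀_f_zero {C : Type*} [Category* C] [Preadditive C] {K L : CochainComplex C ℤ} (f : K ⟶ L) :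
    (ShiftedHom.mk₀ ((0 : ℕ) : ℤ) rfl f : K ⟶ L⟦((0 : ℕ) : ℤ)⟧).f (-((0 : ℕ) : ℤ)) ≫
      (CochainComplex.shiftFunctorObjXIso L ((0 : ℕ) : ℤ) (-((0 : ℕ) : ℤ)) 0 rfl).hom = f.f 0 := by
  have h : (ShiftedHom.mk₀ ((0 : ℕ) : ℤ) rfl f : K ⟶ L⟦((0 : ℕ) : ℤ)⟧).f 0 =
      f.f 0 ≫ (L.XIsoOfEq (by simp)).hom := by
    have h1 : CategoryTheory.shiftFunctorZero' (CochainComplex C ℤ) ((0 : ℕ) : ℤ) rfl =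
        shiftFunctorZero (CochainComplex C ℤ) ℤ := Iso.ext (by
      ext K i
      exact Category.id_comp (((shiftFunctorZero (CochainComplex C ℤ) ℤ).hom.app K).f i))
    exact congrArg (fun e : CategoryTheory.shiftFunctor (CochainComplex C ℤ) (0 : ℤ) ≅ 𝟭 _ =>
      f.f 0 ≫ (e.inv.app L).f 0) h1
  refine (congrArg (fun t => t ≫ _) h).trans ?_
  refine (Category.assoc _ _ _).trans ?_
  have h2 : (L.XIsoOfEq (by simp)).hom ≫ (CochainComplex.shiftFunctorObjXIso L ((0 : ℕ) : ℤ)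
      (-((0 : ℕ) : ℤ)) 0 rfl).hom = 𝟙 (L.X 0) :=
    HomologicalComplex.XIsoOfEq_hom_comp_XIsoOfEq_hom L (p₁ := 0) (p₂ := 0 + 0) (p₃ := 0) rfl rfl
  exact (congrArg (fun t => f.f 0 ≫ t) h2).trans (Category.comp_id _)

variable [HasDerivedCategory.{w1} (ShAb X)]

/-- The connecting homomorphism on classes of Čech cocycles. -/
lemma Represents.comp_extClass {S : ShortComplex (ShAb X)} (hS : S.ShortExact) {n : ℕ}
    {x : Sheaf.H S.X₃ n} {z : cech U ⟶ (single₀ S.X₃)⟦(n : ℤ)⟧} (hx : Represents z (toHyperH x))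
    {c : cech U ⟶ (single₀ S.X₁)⟦((n + 1 : ℕ) : ℤ)⟧} (g : (cech U).X (-(n : ℤ)) ⟶ S.X₂)
    (u : (cech U).X (-((n + 1 : ℕ) : ℤ)) ⟶ S.X₁) (hz : cechComp z = g ≫ S.g)
    (hu : u ≫ S.f = (cech U).d (-((n + 1 : ℕ) : ℤ)) (-(n : ℤ)) ≫ g)
    (hc : cechComp c = ((n + 1 : ℕ) : ℤ).negOnePow • u) :
    Represents c (toHyperH (x.comp hS.extClass rfl)) := by
  have hf : (cech U).d (-((n + 1 : ℕ) : ℤ)) (-(n : ℤ)) ≫ g ≫ S.g = 0 := by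
    rw [← hz, d_cechComp]
  have hu' : (cech U).d (-((n + 1 + 1 : ℕ) : ℤ)) (-((n + 1 : ℕ) : ℤ)) ≫
      (((n + 1 : ℕ) : ℤ).negOnePow • u) = 0 := by
    rw [← hc, d_cechComp]
  have hz' : z = cechHom n (g ≫ S.g) hf := cechComp_injective (by rw [hz, cechComp_cechHom])
  have hc' : c = cechHom (n + 1) _ hu' := cechComp_injective (by rw [hc, cechComp_cechHom])
  have key := toSingleHom_comp_triangleOfSESδ hS (K := cech U) (n := n) (m := ((n + 1 : ℕ) : ℤ))
    (by omega) (by push_cast; ring) (by push_cast; ring) (by push_cast; ring) g u hu hf hu'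
  have h2 : toHyperH (x.comp hS.extClass rfl) = (toHyperH x).comp hS.singleδ
      (by push_cast; ring) := by
    rw [toHyperH, Ext.comp_hom, ShortComplex.ShortExact.extClass_hom]
    rfl
  rw [represents_iff] at *
  rw [h2, singleδ_eq]
  refine (Category.assoc _ _ _).symm.trans ?_
  refine (congrArg (fun t => t ≫ _) hx).trans ?_
  subst hz' hc'
  exact key

/-- Such a cocycle factors through the augmentation as a morphism of complexes, so its class can be
read off without inverting anything. -/
lemma represents_mk₀ {z : cech U ⟶ (single₀ F)⟦((0 : ℕ) : ℤ)⟧} (h : constZ X ⟶ F)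
    (hz : cechComp z = cechAug₀ U ≫ h) : Represents z (toHyperH (Ext.mk₀ h)) := by
  rw [represents_iff, toHyperH, Ext.mk₀_hom]
  have h1 : z = ShiftedHom.mk₀ ((0 : ℕ) : ℤ) rfl
      (cechAug U ≫ (CochainComplex.singleFunctor (ShAb X) 0).map h) := by
    refine cechComp_injective (hz.trans ?_)
    have h2 : cechAug₀ U ≫ h = (cechAug U ≫ (CochainComplex.singleFunctor (ShAb X) 0).map h).f 0 ≫
        (singleX F).hom := by
      have h3 : ((CochainComplex.singleFunctor (ShAb X) 0).map h).f 0 ≫ (singleX F).hom =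
          (singleX _).hom ≫ h := by
        have := HomologicalComplex.single_map_f_self (ComplexShape.up ℤ) 0 h
        refine (congrArg (fun t => t ≫ (singleX F).hom) this).trans ?_
        exact comp_comp_inv_comp_hom _ _ _
      rw [HomologicalComplex.comp_f, Category.assoc, h3, cechAug_f_zero, Category.assoc,
        Iso.inv_hom_id_assoc]
    rw [h2]
    exact (congrArg (fun t => t ≫ (singleX F).hom) (mk₀_f_zero _)).symm
  rw [h1, ShiftedHom.map_mk₀, Q.map_comp]
  exact (Category.assoc _ _ _).symm

end Cohomology

end

section

variable {X : TopCat.{u}}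

/-! ### Čech 1-cocycles and local lifts of global sections. -/

section Torsor

open DerivedCategory

variable {ι : Type u} {U : ι → Opens X} {F G : ShAb X}

variable (U) in
/-- The augmentation of the Čech resolution, on the term of degree `-0`. -/
def cechε : (cech U).X (-((0 : ℕ) : ℤ)) ⟶ constZ X := cechAug₀ U

lemma d_cechε : (cech U).d (-((0 + 1 : ℕ) : ℤ)) (-((0 : ℕ) : ℤ)) ≫ cechε U = 0 :=
  d_cechAug₀ U (-1) rfl

lemma cechε_exact (hU : iSup U = ⊤) : (ShortComplex.mk _ _ (d_cechε (U := U))).Exact :=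
  cechAug₀_exact hU

lemma cechε_epi (hU : iSup U = ⊤) : Epi (cechε U) := cechAug₀_epi hU

/-- Gluing: the augmentation is the cokernel of the last Čech differential, so a Čech 0-cocycle is a
global section. -/
lemma exists_of_d_comp_eq_zero (hU : iSup U = ⊤) (g : (cech U).X (-((0 : ℕ) : ℤ)) ⟶ F)
    (hg : (cech U).d (-((0 + 1 : ℕ) : ℤ)) (-((0 : ℕ) : ℤ)) ≫ g = 0) : ∃ h, g = cechε U ≫ h := by
  have := cechε_epi hU
  exact ⟨(cechε_exact hU).desc g hg, ((cechε_exact hU).g_desc g hg).symm⟩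

lemma cech_exact_one (hU : iSup U = ⊤) :
    (ShortComplex.mk ((cech U).d (-((1 + 1 : ℕ) : ℤ)) (-((0 + 1 : ℕ) : ℤ)))
      ((cech U).d (-((0 + 1 : ℕ) : ℤ)) (-((0 : ℕ) : ℤ))) ((cech U).d_comp_d _ _ _)).Exact :=
  ((cech U).exactAt_iff' (-2) (-1) 0 (by simp) (by simp)).1 (cech_exactAt hU (by omega))

/-- The morphism from the constant sheaf given by a global section. -/
def constHom (s : F.obj.obj (op (⊤ : Opens X))) : constZ X ⟶ F :=
  Ext.addEquiv₀ ((Sheaf.H.equiv₀ F (isTerminalTop (α := Opens X))).symm s)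

lemma mk₀_constHom (s : F.obj.obj (op (⊤ : Opens X))) :
    Ext.mk₀ (constHom s) = (Sheaf.H.equiv₀ F (isTerminalTop (α := Opens X))).symm s :=
  Ext.mk₀_addEquiv₀_apply _

lemma sapp_constHom_one (s : F.obj.obj (op (⊤ : Opens X))) :
    sapp (constHom s) ⊤ (toShf ((Functor.const _).obj (AddCommGrpCat.of (ULift.{u} ℤ))) ⊤
      (ULift.up 1)) = s := by
  have h : (AddCommGrpCat.uliftZMultiplesAddEquiv _) (((constantSheafAdj
      (Opens.grothendieckTopology X) AddCommGrpCat.{u} (isTerminalTop (α := Opens X))).homAddEquiv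
        _ F) (constHom s)) = s :=
    (Sheaf.H.equiv₀ F (isTerminalTop (α := Opens X))).apply_symm_apply s
  refine Eq.trans ?_ h
  -- The correspondence between global sections and morphisms from the constant sheaf evaluates at
  -- the image of `1` under the unit of the adjunction.
  change _ = ((constantSheafAdj (Opens.grothendieckTopology X) AddCommGrpCat.{u}
    (isTerminalTop (α := Opens X))).homEquiv _ F (constHom s)).hom (ULift.up 1)
  rw [Adjunction.homEquiv_unit, constantSheafAdj, Adjunction.comp_unit_app]
  rfl

lemma sapp_cechε_constHom (s : F.obj.obj (op (⊤ : Opens X))) (V : Opens X) (σ : Simp U 0 V) :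
    sapp (cechε U ≫ constHom s) V (cechGen U 0 V σ) = sres F le_top s := by
  have h1 : sapp (cechε U) V (cechGen U 0 V σ) =
      toShf ((Functor.const _).obj (AddCommGrpCat.of (ULift.{u} ℤ))) V (ULift.up 1) := by
    have h : sapp (cechXIso U 0).hom V (cechGen U 0 V σ) = toShf (chains U 0) V (chainOf σ) := by
      rw [cechGen_eq, ← sapp_comp, Iso.inv_hom_id]
      rfl
    refine (congrArg (sapp (sheafAug U) V) h).trans ((sapp_toShf (nerveAug U) V _).trans ?_)
    exact congrArg (toShf _ V) (FreeAbelianGroup.lift_apply_of _ _)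
  have h2 := sres_toShf ((Functor.const _).obj (AddCommGrpCat.of (ULift.{u} ℤ))) (le_top : V ≤ ⊤)
    (ULift.up 1)
  exact (congrArg (sapp (constHom s) V) (h1.trans h2.symm)).trans ((sapp_sres (constHom s) le_top _).trans
    (congrArg (sres F le_top) (sapp_constHom_one s)))

variable [HasDerivedCategory.{w1} (ShAb X)]

lemma represents_mk₀' {z : cech U ⟶ (single₀ F)⟦((0 : ℕ) : ℤ)⟧} (h : constZ X ⟶ F)
    (hz : cechComp z = cechε U ≫ h) : Represents z (toHyperH (Ext.mk₀ h)) := represents_mk₀ h hz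

lemma toHyperH_neg {n : ℕ} (x : Sheaf.H F n) : toHyperH (-x) = -toHyperH x := Ext.neg_hom _

/-- For `n = 0` the sign `(-1)^(n+1)` is `-1`: the coboundary of local lifts of a section represents
minus its connecting class. All minus signs in the cocycles of the Atiyah class come from here. -/
lemma represents_mk₀_comp_extClass {S : ShortComplex (ShAb X)} (hS : S.ShortExact)
    (h : constZ X ⟶ S.X₃) {c : cech U ⟶ (single₀ S.X₁)⟦((0 + 1 : ℕ) : ℤ)⟧}
    (g : (cech U).X (-((0 : ℕ) : ℤ)) ⟶ S.X₂) (hg : g ≫ S.g = cechε U ≫ h)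
    (hc : cechComp c ≫ S.f = (cech U).d (-((0 + 1 : ℕ) : ℤ)) (-((0 : ℕ) : ℤ)) ≫ g) :
    Represents c (toHyperH (-((Ext.mk₀ h).comp hS.extClass rfl))) := by
  have hz : (cech U).d (-((0 + 1 : ℕ) : ℤ)) (-((0 : ℕ) : ℤ)) ≫ cechε U ≫ h = 0 := by
    rw [← Category.assoc, d_cechε, zero_comp]
  have h1 := (represents_mk₀' (z := cechHom 0 _ hz) h (cechComp_cechHom _ _ _)).comp_extClass hS
    (c := -c) g (cechComp c) (by rw [cechComp_cechHom, hg]) hc (by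
      rw [cechComp_neg]
      simp)
  have h2 := h1.neg
  rwa [neg_neg, ← toHyperH_neg] at h2

/-- Čech `H^1` injects into `H^1`. After embedding `F` in an injective sheaf, exactness of the Čech
resolution makes `c` the coboundary of some `g₀`. Modulo `F`, `g₀` is a global section with zero
connecting class. It lifts to a global section of the injective sheaf, and subtracting the lift
moves `g₀` into `F`. -/
lemma exists_d_comp_eq_of_represents_zero (hU : iSup U = ⊤)
    {c : cech U ⟶ (single₀ F)⟦((0 + 1 : ℕ) : ℤ)⟧}
    (hc : Represents c (toHyperH (0 : Sheaf.H F (0 + 1)))) :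
    ∃ t, (cech U).d (-((0 + 1 : ℕ) : ℤ)) (-((0 : ℕ) : ℤ)) ≫ t = cechComp c := by
  let S : ShortComplex (ShAb X) := ShortComplex.mk (Injective.ι F) (cokernel.π (Injective.ι F))
    (cokernel.condition _)
  have hS : S.ShortExact :=
    { exact := ShortComplex.exact_of_g_is_cokernel _ (cokernelIsCokernel _)
      mono_f := inferInstanceAs (Mono (Injective.ι F))
      epi_g := inferInstanceAs (Epi (cokernel.π _)) }
  have := hS.mono_f
  have hI : Injective S.X₂ := inferInstanceAs (Injective (Injective.under F))
  have hd := d_cechComp c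
  let g₀ : (cech U).X (-((0 : ℕ) : ℤ)) ⟶ S.X₂ := (cech_exact_one hU).descToInjective
    (cechComp c ≫ S.f) (by
      refine (Category.assoc _ _ _).symm.trans ((congrArg (fun t => t ≫ S.f) hd).trans zero_comp))
  have hg₀ : (cech U).d (-((0 + 1 : ℕ) : ℤ)) (-((0 : ℕ) : ℤ)) ≫ g₀ = cechComp c ≫ S.f :=
    (cech_exact_one hU).comp_descToInjective _ _
  obtain ⟨h, hh⟩ := exists_of_d_comp_eq_zero hU (g₀ ≫ S.g) (by
    rw [← Category.assoc, hg₀, Category.assoc, S.zero, comp_zero])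
  have h1 := represents_mk₀_comp_extClass hS h g₀ hh hg₀.symm
  have h2 := neg_eq_zero.1 (toHyperH_injective (h1.unique hU hc))
  obtain ⟨x, hx⟩ := Ext.covariant_sequence_exact₃ _ hS _ rfl h2
  obtain ⟨s, rfl⟩ := (Ext.mk₀_bijective _ _).2 x
  rw [Ext.mk₀_comp_mk₀] at hx
  have hs := (Ext.mk₀_bijective _ _).1 hx
  have h3 : (g₀ - cechε U ≫ s) ≫ S.g = 0 := by
    rw [Preadditive.sub_comp, hh, Category.assoc, hs, sub_self]
  refine ⟨hS.exact.lift _ h3, (cancel_mono S.f).1 ?_⟩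
  rw [Category.assoc, hS.exact.lift_f, Preadditive.comp_sub, hg₀, ← Category.assoc, d_cechε,
    zero_comp, sub_zero]

/-- The class of `c` dies in `S.X₂`, so there `c` is the coboundary of some `t`, whose image in
`S.X₃` is a global section `k`. The connecting class of `k` is minus that of `h`, so `h + k` lifts
globally. The global lift minus `t` is a local lift of `h`. -/
lemma exists_lift_of_represents (hU : iSup U = ⊤) {S : ShortComplex (ShAb X)} (hS : S.ShortExact)
    (h : constZ X ⟶ S.X₃) {c : cech U ⟶ (single₀ S.X₁)⟦((0 + 1 : ℕ) : ℤ)⟧}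
    (hc : Represents c (toHyperH ((Ext.mk₀ h).comp hS.extClass rfl))) :
    ∃ g, g ≫ S.g = cechε U ≫ h ∧
      (cech U).d (-((0 + 1 : ℕ) : ℤ)) (-((0 : ℕ) : ℤ)) ≫ g = -(cechComp c ≫ S.f) := by
  have h0 : ((Ext.mk₀ h).comp hS.extClass rfl).comp (Ext.mk₀ S.f) (add_zero (0 + 1)) =
      (0 : Sheaf.H S.X₂ (0 + 1)) := by
    rw [Ext.comp_assoc_of_third_deg_zero, hS.extClass_comp, Ext.comp_zero]
  have h1 := hc.postcomp S.f
  rw [h0] at h1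
  obtain ⟨t, ht⟩ := exists_d_comp_eq_of_represents_zero hU h1
  rw [cechComp_postcomp] at ht
  obtain ⟨k, hk⟩ := exists_of_d_comp_eq_zero hU (t ≫ S.g) (by
    rw [← Category.assoc, ht, Category.assoc, S.zero, comp_zero])
  have h2 := toHyperH_injective ((represents_mk₀_comp_extClass hS k t hk ht.symm).unique hU hc)
  have h3 : (Ext.mk₀ (h + k)).comp hS.extClass (rfl : 0 + 1 = 0 + 1) = 0 := by
    rw [Ext.mk₀_add, Ext.add_comp, ← h2, neg_add_cancel]
  obtain ⟨x, hx⟩ := Ext.covariant_sequence_exact₃ _ hS _ rfl h3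
  obtain ⟨s, rfl⟩ := (Ext.mk₀_bijective _ _).2 x
  rw [Ext.mk₀_comp_mk₀] at hx
  have hs := (Ext.mk₀_bijective _ _).1 hx
  refine ⟨cechε U ≫ s - t, ?_, ?_⟩
  · rw [Preadditive.sub_comp, hk, Category.assoc, hs, Preadditive.comp_add, add_sub_cancel_right]
  · rw [Preadditive.comp_sub, ht, ← Category.assoc, d_cechε, zero_comp, zero_sub]

/-- Complement of `exists_lift_of_represents`: here the local lifts are given, and their coboundary
already comes from `S.X₁`. -/
lemma exists_represents_mk₀_comp_extClass {S : ShortComplex (ShAb X)} (hS : S.ShortExact)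
    (h : constZ X ⟶ S.X₃) (g : (cech U).X (-((0 : ℕ) : ℤ)) ⟶ S.X₂) (hg : g ≫ S.g = cechε U ≫ h) :
    ∃ c : cech U ⟶ (single₀ S.X₁)⟦((0 + 1 : ℕ) : ℤ)⟧,
      Represents c (toHyperH ((Ext.mk₀ h).comp hS.extClass rfl)) ∧
      (cech U).d (-((0 + 1 : ℕ) : ℤ)) (-((0 : ℕ) : ℤ)) ≫ g = -(cechComp c ≫ S.f) := by
  have := hS.mono_f
  have h1 : ((cech U).d (-((0 + 1 : ℕ) : ℤ)) (-((0 : ℕ) : ℤ)) ≫ g) ≫ S.g = 0 := by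
    rw [Category.assoc, hg, ← Category.assoc, d_cechε, zero_comp]
  let v : (cech U).X (-((0 + 1 : ℕ) : ℤ)) ⟶ S.X₁ := hS.exact.lift _ h1
  have hv : v ≫ S.f = (cech U).d (-((0 + 1 : ℕ) : ℤ)) (-((0 : ℕ) : ℤ)) ≫ g := hS.exact.lift_f _ h1
  have hdv : (cech U).d (-((0 + 1 + 1 : ℕ) : ℤ)) (-((0 + 1 : ℕ) : ℤ)) ≫ v = 0 :=
    (cancel_mono S.f).1 (by
      rw [Category.assoc, hv, ← Category.assoc, HomologicalComplex.d_comp_d, zero_comp, zero_comp])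
  have h3 := (represents_mk₀_comp_extClass hS h (c := cechHom (0 + 1) v hdv) g hg
    (by rw [cechComp_cechHom, hv])).neg
  rw [← toHyperH_neg, neg_neg] at h3
  exact ⟨_, h3, by rw [cechComp_neg, cechComp_cechHom, Preadditive.neg_comp, neg_neg, hv]⟩

lemma exists_represents_comp_extClass {S : ShortComplex (ShAb X)} (hS : S.ShortExact)
    {x : Sheaf.H S.X₃ (0 + 1)} {z : cech U ⟶ (single₀ S.X₃)⟦((0 + 1 : ℕ) : ℤ)⟧}
    (hx : Represents z (toHyperH x)) (g : (cech U).X (-((0 + 1 : ℕ) : ℤ)) ⟶ S.X₂)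
    (u : (cech U).X (-((0 + 1 + 1 : ℕ) : ℤ)) ⟶ S.X₁) (hg : g ≫ S.g = cechComp z)
    (hu : u ≫ S.f = (cech U).d (-((0 + 1 + 1 : ℕ) : ℤ)) (-((0 + 1 : ℕ) : ℤ)) ≫ g) :
    ∃ c : cech U ⟶ (single₀ S.X₁)⟦((0 + 1 + 1 : ℕ) : ℤ)⟧,
      Represents c (toHyperH (x.comp hS.extClass rfl)) ∧ cechComp c = u := by
  have := hS.mono_f
  have hdu : (cech U).d (-((0 + 1 + 1 + 1 : ℕ) : ℤ)) (-((0 + 1 + 1 : ℕ) : ℤ)) ≫ u = 0 :=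
    (cancel_mono S.f).1 (by
      rw [Category.assoc, hu, ← Category.assoc, HomologicalComplex.d_comp_d, zero_comp, zero_comp])
  refine ⟨cechHom _ u hdu, hx.comp_extClass hS g u hg.symm hu ?_, cechComp_cechHom _ _ _⟩
  -- From degree 1 to degree 2 the connecting map carries no sign.
  have h2 : ((0 + 1 + 1 : ℕ) : ℤ).negOnePow = 1 := rfl
  rw [cechComp_cechHom, h2, one_smul]

end Torsor

end

section

variable {X : TopCat.{u}} {O : CAlgSheaf X}

/-! ### Čech cochains with values in sheaves of modules -/

section Values

variable {ι : Type u} {U : ι → Opens X} {M N : O.Mod} {p : ℕ}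

/-- The value of a Čech cochain with values in a sheaf of modules. -/
def mval (φ : (cech U).X (-(p : ℤ)) ⟶ (toShAb O).obj M) (V : Opens X) (s : Simp U p V) : MSec M V :=
  sapp φ V (cechGen U p V s)

lemma mval_ext {φ ψ : (cech U).X (-(p : ℤ)) ⟶ (toShAb O).obj M}
    (h : ∀ V s, mval φ V s = mval ψ V s) : φ = ψ :=
  cechX_hom_ext h

lemma mres_mval (φ : (cech U).X (-(p : ℤ)) ⟶ (toShAb O).obj M) {V W : Opens X} (h : W ≤ V)
    (s : Simp U p V) : mres M h (mval φ V s) = mval φ W (simpRes h s) :=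
  (sapp_sres φ h _).symm.trans (congrArg (sapp φ W) (sres_cechGen p h s))

lemma mval_comp (φ : (cech U).X (-(p : ℤ)) ⟶ (toShAb O).obj M) (ψ : M ⟶ N) (V : Opens X)
    (s : Simp U p V) : mval (φ ≫ (toShAb O).map ψ) V s = happ ψ V (mval φ V s) := rfl

lemma mval_d (φ : (cech U).X (-(p : ℤ)) ⟶ (toShAb O).obj M) (V : Opens X) (s : Simp U (p + 1) V) :
    mval ((cech U).d (-((p + 1 : ℕ) : ℤ)) (-(p : ℤ)) ≫ φ) V s =
      ∑ i : Fin (p + 2), (-1 : ℤ) ^ (i : ℕ) • mval φ V (fun j => s (i.succAbove j)) :=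
  sapp_cech_d_comp p φ V s

lemma mval_d_zero (φ : (cech U).X (-((0 : ℕ) : ℤ)) ⟶ (toShAb O).obj M) (V : Opens X)
    (s : Simp U (0 + 1) V) :
    mval ((cech U).d (-((0 + 1 : ℕ) : ℤ)) (-((0 : ℕ) : ℤ)) ≫ φ) V s =
      mval φ V ![s 1] - mval φ V ![s 0] := by
  rw [mval_d, Fin.sum_univ_two]
  have h0 : (fun j => s ((0 : Fin 2).succAbove j)) = ![s 1] := by ext j; fin_cases j; rfl
  have h1 : (fun j => s ((1 : Fin 2).succAbove j)) = ![s 0] := by ext j; fin_cases j; rfl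
  rw [h0, h1]
  simp [sub_eq_add_neg]

lemma mval_d_one (φ : (cech U).X (-((0 + 1 : ℕ) : ℤ)) ⟶ (toShAb O).obj M) (V : Opens X)
    (s : Simp U (0 + 1 + 1) V) :
    mval ((cech U).d (-((0 + 1 + 1 : ℕ) : ℤ)) (-((0 + 1 : ℕ) : ℤ)) ≫ φ) V s =
      mval φ V ![s 1, s 2] - mval φ V ![s 0, s 2] + mval φ V ![s 0, s 1] := by
  rw [mval_d, Fin.sum_univ_three]
  have h0 : (fun j => s ((0 : Fin 3).succAbove j)) = ![s 1, s 2] := by ext j; fin_cases j <;> rfl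
  have h1 : (fun j => s ((1 : Fin 3).succAbove j)) = ![s 0, s 2] := by ext j; fin_cases j <;> rfl
  have h2 : (fun j => s ((2 : Fin 3).succAbove j)) = ![s 0, s 1] := by ext j; fin_cases j <;> rfl
  rw [h0, h1, h2]
  simp [sub_eq_add_neg]

lemma mval_d_two (φ : (cech U).X (-((0 + 1 + 1 : ℕ) : ℤ)) ⟶ (toShAb O).obj M) (V : Opens X)
    (s : Simp U (0 + 1 + 1 + 1) V) :
    mval ((cech U).d (-((0 + 1 + 1 + 1 : ℕ) : ℤ)) (-((0 + 1 + 1 : ℕ) : ℤ)) ≫ φ) V s =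
      mval φ V ![s 1, s 2, s 3] - mval φ V ![s 0, s 2, s 3] + mval φ V ![s 0, s 1, s 3] -
        mval φ V ![s 0, s 1, s 2] := by
  rw [mval_d, Fin.sum_univ_four]
  have h0 : (fun j => s ((0 : Fin 4).succAbove j)) = ![s 1, s 2, s 3] := by
    ext j; fin_cases j <;> rfl
  have h1 : (fun j => s ((1 : Fin 4).succAbove j)) = ![s 0, s 2, s 3] := by
    ext j; fin_cases j <;> rfl
  have h2 : (fun j => s ((2 : Fin 4).succAbove j)) = ![s 0, s 1, s 3] := by
    ext j; fin_cases j <;> rfl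
  have h3 : (fun j => s ((3 : Fin 4).succAbove j)) = ![s 0, s 1, s 2] := by
    ext j; fin_cases j <;> rfl
  rw [h0, h1, h2, h3]
  simp [sub_eq_add_neg, pow_succ]

lemma simpRes_one {V W : Opens X} (h : W ≤ V) (i : {i : ι // V ≤ U i}) :
    simpRes h (![i] : Simp U 0 V) = ![⟨i.1, h.trans i.2⟩] := by
  ext j; fin_cases j; rfl

lemma simpRes_two {V W : Opens X} (h : W ≤ V) (i j : {i : ι // V ≤ U i}) :
    simpRes h (![i, j] : Simp U 1 V) = ![⟨i.1, h.trans i.2⟩, ⟨j.1, h.trans j.2⟩] := by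
  ext k; fin_cases k <;> rfl

/-- The Čech cochain with given values in a sheaf of modules. -/
def mdesc (p : ℕ) (c : ∀ V : Opens X, Simp U p V → MSec M V)
    (hc : ∀ (V W : Opens X) (h : W ≤ V) (s : Simp U p V), mres M h (c V s) = c W (simpRes h s)) :
    (cech U).X (-(p : ℤ)) ⟶ (toShAb O).obj M :=
  cechDesc p c hc

lemma mval_mdesc (c : ∀ V : Opens X, Simp U p V → MSec M V) (hc) (V : Opens X) (s : Simp U p V) :
    mval (mdesc p c hc) V s = c V s :=
  sapp_cechDesc (F := (toShAb O).obj M) p c hc V s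

end Values

/-! ### Sections of `ĝ` -/

namespace LieAlgebroid

variable {A : LieAlgebroid O} (p : A.InvariantPairing)

/-- Taking sections preserves limits, so a section of a fibre product, in particular of `ĝ`, is a
compatible pair of sections. -/
lemma isPullback_types {M N P : O.Mod} (φ : M ⟶ P) (ψ : N ⟶ P) (W : Opens X) :
    IsPullback ((forget _).map ((SheafOfModules.evaluation.{u} O.ring (op W)).map (pullback.fst φ ψ)))
      ((forget _).map ((SheafOfModules.evaluation.{u} O.ring (op W)).map (pullback.snd φ ψ)))
      ((forget _).map ((SheafOfModules.evaluation.{u} O.ring (op W)).map φ))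
      ((forget _).map ((SheafOfModules.evaluation.{u} O.ring (op W)).map ψ)) :=
  ((IsPullback.of_hasPullback φ ψ).map (SheafOfModules.evaluation.{u} O.ring (op W))).map (forget _)

lemma pullback_sec_ext {M N P : O.Mod} (φ : M ⟶ P) (ψ : N ⟶ P) {W : Opens X}
    {x y : MSec (pullback φ ψ) W} (h1 : happ (pullback.fst φ ψ) W x = happ (pullback.fst φ ψ) W y)
    (h2 : happ (pullback.snd φ ψ) W x = happ (pullback.snd φ ψ) W y) : x = y :=
  Types.ext_of_isPullback (isPullback_types φ ψ W) h1 h2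

lemma exists_pullback_sec {M N P : O.Mod} (φ : M ⟶ P) (ψ : N ⟶ P) {W : Opens X} (m : MSec M W)
    (n : MSec N W) (h : happ φ W m = happ ψ W n) : ∃ x : MSec (pullback φ ψ) W,
      happ (pullback.fst φ ψ) W x = m ∧ happ (pullback.snd φ ψ) W x = n :=
  Types.exists_of_isPullback (isPullback_types φ ψ W) m n h

end LieAlgebroid

end

section

variable {X : TopCat.{u}} {O : CAlgSheaf X}

namespace LieAlgebroid

variable {A : LieAlgebroid O}

/-! ### Connections -/

/-- A connection on `A` over `V`: an `O`-linear section of the anchor. -/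
def IsConn {V : Opens X} (D : MSec (homMod (tangent O) A.mod) V) : Prop :=
  ∀ (W : Opens X) (hW : W ≤ V) (ξ : MSec (tangent O) W), happ A.anchor W (hval D hW ξ) = ξ

section Conn

variable {V : Opens X} {D : MSec (homMod (tangent O) A.mod) V} (hD : IsConn D)

/-- The projection of `A` onto the kernel of the anchor given by a connection. -/
def connProj {W : Opens X} (hW : W ≤ V) : MSec A.mod W →ₗ[O.Sec W] A.ker W :=
  LinearMap.codRestrict (A.ker W) (LinearMap.id - hval D hW ∘ₗ happ A.anchor W) fun x => by
    rw [LinearMap.mem_ker, LinearMap.sub_apply, LinearMap.comp_apply, map_sub, hD, LinearMap.id_apply,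
      sub_self]

lemma connProj_coe {W : Opens X} (hW : W ≤ V) (x : MSec A.mod W) :
    (connProj hD hW x : MSec A.mod W) = x - hval D hW (happ A.anchor W x) := rfl

lemma kres_connProj {W W' : Opens X} (hW : W ≤ V) (h : W' ≤ W) (x : MSec A.mod W) :
    kres h (connProj hD hW x) = connProj hD (h.trans hW) (mres A.mod h x) :=
  Subtype.ext (by
    change mres A.mod h (x - hval D hW (happ A.anchor W x)) =
      mres A.mod h x - hval D _ (happ A.anchor W' (mres A.mod h x))
    rw [map_sub, hval_nat, happ_mres])

lemma anchor_gι {W : Opens X} (c : MSec A.g W) : happ A.anchor W (happ A.gι W c) = 0 :=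
  (toKer c).2

lemma connProj_gι {W : Opens X} (hW : W ≤ V) (c : MSec A.g W) :
    connProj hD hW (happ A.gι W c) = toKer c :=
  Subtype.ext (by
    change happ A.gι W c - hval D hW (happ A.anchor W (happ A.gι W c)) = happ A.gι W c
    rw [anchor_gι, map_zero, sub_zero])

variable (p : A.InvariantPairing)

/-- The form `x ↦ ⟨b, x - ∇ π x⟩` on `A`. -/
def InvariantPairing.connDual {W : Opens X} (hW : W ≤ V) (b : MSec A.g W) : MSec (dual A.mod) W :=
  mkHomSec (fun W' hW' =>
    { toFun := fun x =>
        (p.pair W' (toKer (mres A.g hW' b)) (connProj hD (hW'.trans hW) x) : O.Sec W')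
      map_add' := fun x y => by rw [map_add]; exact p.pair_add _ _ _ _
      map_smul' := fun r x => by rw [map_smul]; exact p.pair_smul _ _ _ _ })
    (fun W' W'' hW' hW'' x => (p.pair_res _ _ _ _ _).trans (by
      rw [← toKer_mres, mres_mres, kres_connProj]; rfl))

lemma InvariantPairing.hval_connDual {W W' : Opens X} (hW : W ≤ V) (b : MSec A.g W) (hW' : W' ≤ W)
    (x : MSec A.mod W') : hval (p.connDual hD hW b) hW' x =
      p.pair W' (toKer (mres A.g hW' b)) (connProj hD (hW'.trans hW) x) := rfl

/-- The projection given by a connection is the identity on `g`. This is the compatibility that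
makes `(connDual b, b)` a section of `ĝ`, so a connection splits `ĝ → g`. -/
lemma InvariantPairing.homPre_connDual {W : Opens X} (hW : W ≤ V) (b : MSec A.g W) :
    happ (homPre O.unit A.gι) W (p.connDual hD hW b) = happ p.toDual W b :=
  hom_sec_ext fun W' hW' c => by
    rw [hval_homPre, p.hval_connDual, connProj_gι]
    rfl

/-- Composition of `α` with the splitting of `ĝ → g`. Linearity and compatibility with restriction
are checked on the two components. -/
lemma InvariantPairing.exists_connLift (α : MSec (homMod (tangent O) A.g) V) :
    ∃ l : MSec (homMod (tangent O) p.gHat) V, ∀ (W : Opens X) (hW : W ≤ V) (ξ : MSec (tangent O) W),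
      happ (pullback.fst _ _) W (hval l hW ξ) = p.connDual hD hW (hval α hW ξ) ∧
      happ (pullback.snd _ _) W (hval l hW ξ) = hval α hW ξ := by
  have h : ∀ (W : Opens X) (hW : W ≤ V) (ξ : MSec (tangent O) W), ∃ y : MSec p.gHat W,
      happ (pullback.fst _ _) W y = p.connDual hD hW (hval α hW ξ) ∧
      happ (pullback.snd _ _) W y = hval α hW ξ := fun W hW ξ =>
    exists_pullback_sec _ _ _ _ (p.homPre_connDual hD hW _)
  choose l hl1 hl2 using h
  refine ⟨mkHomSec (fun W hW =>
    { toFun := l W hW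
      map_add' := fun ξ η => pullback_sec_ext _ _ ?_ ?_
      map_smul' := fun r ξ => pullback_sec_ext _ _ ?_ ?_ }) ?_, fun W hW ξ => ⟨hl1 W hW ξ, hl2 W hW ξ⟩⟩
  · rw [map_add, hl1, hl1, hl1]
    refine hom_sec_ext fun W' hW' x => ?_
    rw [hval_add, LinearMap.add_apply, p.hval_connDual, p.hval_connDual, p.hval_connDual, map_add,
      map_add, map_add]
    exact p.add_pair _ _ _ _
  · rw [map_add, hl2, hl2, hl2, map_add]
  · rw [map_smul, hl1, hl1]
    refine hom_sec_ext fun W' hW' x => ?_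
    rw [RingHom.id_apply, hval_smul, p.hval_connDual, map_smul, mres_smul, map_smul]
    exact p.smul_pair _ _ _ _
  · rw [map_smul, hl2, hl2, map_smul]
    rfl
  · intro W W' hW hW' ξ
    change mres p.gHat hW' (l W hW ξ) = l W' _ (mres _ hW' ξ)
    refine pullback_sec_ext _ _ ?_ ?_
    · rw [happ_mres, hl1, hl1]
      refine hom_sec_ext fun W'' hW'' x => ?_
      rw [hval_res, p.hval_connDual, p.hval_connDual, ← hval_nat α hW hW', mres_mres]
    · rw [happ_mres, hl2, hl2, hval_nat]

end Conn

end LieAlgebroid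

end

section

variable {X : TopCat.{u}} {O : CAlgSheaf X}

/-! ### The Atiyah class and the class of the 2-extension -/

section AtiyahClass

variable [HasExt.{w} O.Mod] {A : LieAlgebroid O} (hT : IsLocallyFree (tangent O))
  (hA : A.IsTransitive)

/-- An exact functor carries extension classes to extension classes, so the Atiyah class is the
obstruction to a global lift of `id`, that is, to a global connection. -/
lemma atiyahClass_eq : atiyahClass hT hA = (Ext.mk₀ (constHom (F := (homFunctor (tangent O)).obj
      (tangent O)) (idSec (tangent O)))).comp
    (homFunctor_shortExact hT (LieAlgebroid.seq_shortExact hA)).extClass rfl := by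
  have := (homFunctor_exact hT).1
  have := (homFunctor_exact hT).2
  have h := Ext.mapExactFunctor_extClass (homFunctor (tangent O)) (LieAlgebroid.seq_shortExact hA)
  refine Eq.trans ?_ (congrArg (fun t => Ext.comp t (homFunctor_shortExact hT
    (LieAlgebroid.seq_shortExact hA)).extClass rfl) (mk₀_constHom _)).symm
  exact congrArg (fun t => ((Sheaf.H.equiv₀ ((homFunctor (tangent O)).obj (tangent O))
    (isTerminalTop (α := Opens X))).symm (idSec (tangent O))).comp t (zero_add 1)) h

/-- The exact functor respects Yoneda products. By associativity, the 2-extension becomes two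
successive connecting maps applied to `id`. -/
lemma betaClass_eq (p : A.InvariantPairing) : betaClass hT hA p =
    (atiyahClass hT hA).comp (homFunctor_shortExact hT (p.seq_shortExact hA hT)).extClass rfl := by
  have := (homFunctor_exact hT).1
  have := (homFunctor_exact hT).2
  have h := Ext.mapExactFunctor_extClass (homFunctor (tangent O)) (p.seq_shortExact hA hT)
  have h2 := Ext.mapExactFunctor_comp (homFunctor (tangent O))
    (LieAlgebroid.seq_shortExact hA).extClass (p.seq_shortExact hA hT).extClass rfl
  rw [h] at h2
  refine (congrArg (fun t => ((Sheaf.H.equiv₀ ((homFunctor (tangent O)).obj (tangent O))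
    (isTerminalTop (α := Opens X))).symm (idSec (tangent O))).comp t (zero_add 2)) h2).trans ?_
  exact (Ext.comp_assoc _ _ _ (zero_add 1) rfl rfl).symm

end AtiyahClass

namespace LieAlgebroid

/-! ### Explicit cocycles for the Atiyah class and for `β`. -/

section Cocycles

open DerivedCategory

variable [HasExt.{w} O.Mod] {A : LieAlgebroid O} {hT : IsLocallyFree (tangent O)}
  {hA : A.IsTransitive} {ι : Type u} {U : ι → Opens X}

omit [HasExt.{w} O.Mod] in
lemma isConn_mval {g : (cech U).X (-((0 : ℕ) : ℤ)) ⟶ (toShAb O).obj (homMod (tangent O) A.mod)}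
    (hg : g ≫ (toShAb O).map (homPost (tangent O) A.anchor) =
      cechε U ≫ constHom (F := (toShAb O).obj (homMod (tangent O) (tangent O))) (idSec (tangent O)))
    {V : Opens X} (s : Simp U 0 V) : IsConn (mval g V s) := fun W hW ξ => by
  have h1 := (mval_comp g (homPost (tangent O) A.anchor) V s).symm.trans
    ((congrArg (fun t => mval t V s) hg).trans (sapp_cechε_constHom _ V s))
  exact congrArg (fun f : MSec (homMod (tangent O) (tangent O)) V => hval f hW ξ) h1

variable [HasDerivedCategory.{w1} (ShAb X)]

/-- The cup product statement allows arbitrary representatives of `α(A)`. This lemma attaches local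
connections to each of them. -/
lemma exists_conn_of_represents (hU : iSup U = ⊤)
    {b : cech U ⟶ (single₀ ((homFunctor (tangent O)).obj A.g))⟦((0 + 1 : ℕ) : ℤ)⟧}
    (hb : Represents b (toHyperH (atiyahClass hT hA))) :
    ∃ g : (cech U).X (-((0 : ℕ) : ℤ)) ⟶ (toShAb O).obj (homMod (tangent O) A.mod),
      g ≫ (toShAb O).map (homPost (tangent O) A.anchor) =
        cechε U ≫ constHom (F := (toShAb O).obj (homMod (tangent O) (tangent O))) (idSec (tangent O)) ∧
      ∀ (V : Opens X) (s : Simp U (0 + 1) V),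
        mval g V ![s 1] - mval g V ![s 0] = -happ (homPost (tangent O) A.gι) V
          (mval (M := homMod (tangent O) A.g) (cechComp b) V s) := by
  rw [atiyahClass_eq] at hb
  obtain ⟨g, hg, hd⟩ := exists_lift_of_represents hU
    (homFunctor_shortExact hT (LieAlgebroid.seq_shortExact hA)) _ hb
  exact ⟨g, hg, fun V s => (mval_d_zero (M := homMod (tangent O) A.mod) g V s).symm.trans
    (congrArg (fun t => mval (M := homMod (tangent O) A.mod) t V s) hd)⟩

lemma represents_atiyahClass (g : (cech U).X (-((0 : ℕ) : ℤ)) ⟶ (toShAb O).obj (homMod (tangent O) A.mod))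
    (hg : g ≫ (toShAb O).map (homPost (tangent O) A.anchor) =
        cechε U ≫ constHom (F := (toShAb O).obj (homMod (tangent O) (tangent O))) (idSec (tangent O))) :
    ∃ b : cech U ⟶ (single₀ ((homFunctor (tangent O)).obj A.g))⟦((0 + 1 : ℕ) : ℤ)⟧,
      Represents b (toHyperH (atiyahClass hT hA)) ∧ ∀ (V : Opens X) (s : Simp U (0 + 1) V),
        mval g V ![s 1] - mval g V ![s 0] = -happ (homPost (tangent O) A.gι) V
          (mval (M := homMod (tangent O) A.g) (cechComp b) V s) := by
  rw [atiyahClass_eq]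
  obtain ⟨b, hb, hd⟩ := exists_represents_mk₀_comp_extClass
    (homFunctor_shortExact hT (LieAlgebroid.seq_shortExact hA)) _ g hg
  exact ⟨b, hb, fun V s => (mval_d_zero (M := homMod (tangent O) A.mod) g V s).symm.trans
    (congrArg (fun t => mval (M := homMod (tangent O) A.mod) t V s) hd)⟩

-- The algebra behind the coboundary of the lift: `a, b, c` stand for the values of the cocycle at
-- `jk, ik, ij`, and `x, y` for the projections along `∇_j, ∇_k`, whose difference is `z`.
omit [HasExt.{w} O.Mod] [HasDerivedCategory.{w1} (ShAb X)] in
lemma InvariantPairing.pair_sub_add_pair (p : A.InvariantPairing) {V : Opens X}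
    {a b c x y z : A.ker V} (h : a - b + c = 0) (hx : x = y - z) :
    p.pair V a y - p.pair V b y + p.pair V c x = -p.pair V c z := by
  obtain rfl : b = a + c := by rw [← sub_eq_zero, ← neg_eq_zero, ← h]; abel
  obtain rfl : y = x + z := by rw [hx]; abel
  rw [p.add_pair, p.pair_add, p.pair_add]
  ring

/-- The cup square of a Čech cocycle of the Atiyah class. -/
lemma exists_represents_betaClass (p : A.InvariantPairing) (hU : iSup U = ⊤)
    {a b : cech U ⟶ (single₀ ((homFunctor (tangent O)).obj A.g))⟦((0 + 1 : ℕ) : ℤ)⟧}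
    (ha : Represents a (toHyperH (atiyahClass hT hA)))
    (hb : Represents b (toHyperH (atiyahClass hT hA))) :
    ∃ c : cech U ⟶ (single₀ ((homFunctor (tangent O)).obj (Omega1 O)))⟦((0 + 1 + 1 : ℕ) : ℤ)⟧,
      Represents c (toHyperH (betaClass hT hA p)) ∧ ∀ (V : Opens X) (s : Simp U (0 + 1 + 1) V),
        mval (M := homMod (tangent O) (Omega1 O)) (cechComp c) V s =
          -p.homPairSec (mval (M := homMod (tangent O) A.g) (cechComp a) V ![s 0, s 1])
            (mval (M := homMod (tangent O) A.g) (cechComp b) V ![s 1, s 2]) := by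
  obtain ⟨g, hg, hgb⟩ := exists_conn_of_represents hU hb
  have hconn : ∀ {V : Opens X} (s : Simp U 0 V), IsConn (mval g V s) := fun s => isConn_mval hg s
  let α : ∀ (V : Opens X) (s : Simp U (0 + 1) V), MSec (homMod (tangent O) A.g) V :=
    fun V s => mval (M := homMod (tangent O) A.g) (cechComp a) V s
  let β : ∀ (V : Opens X) (s : Simp U (0 + 1) V), MSec (homMod (tangent O) A.g) V :=
    fun V s => mval (M := homMod (tangent O) A.g) (cechComp b) V s
  have hαr : ∀ (V W : Opens X) (h : W ≤ V) (s : Simp U (0 + 1) V),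
      mres _ h (α V s) = α W (simpRes h s) := fun V W h s =>
    mres_mval (M := homMod (tangent O) A.g) (cechComp a) h s
  have hβr : ∀ (V W : Opens X) (h : W ≤ V) (s : Simp U (0 + 1) V),
      mres _ h (β V s) = β W (simpRes h s) := fun V W h s =>
    mres_mval (M := homMod (tangent O) A.g) (cechComp b) h s
  have hcoc : ∀ (V : Opens X) (s : Simp U (0 + 1 + 1) V),
      α V ![s 1, s 2] - α V ![s 0, s 2] + α V ![s 0, s 1] = 0 := fun V s =>
    (mval_d_one (M := homMod (tangent O) A.g) (cechComp a) V s).symm.trans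
      (congrArg (fun t => mval (M := homMod (tangent O) A.g) t V s) (d_cechComp a))
  -- the lift of `a` to a cochain with values in `Hom(T, ĝ)`
  choose l hl using fun (V : Opens X) (s : Simp U (0 + 1) V) =>
    p.exists_connLift (hconn (V := V) ![s 1]) (α V s)
  let L : (cech U).X (-((0 + 1 : ℕ) : ℤ)) ⟶ (toShAb O).obj (homMod (tangent O) p.gHat) :=
    mdesc (0 + 1) l (fun V W h s => hom_sec_ext fun W' hW' ξ => by
      have h1 : hval (α W (simpRes h s)) hW' ξ = hval (α V s) (hW'.trans h) ξ := by
        rw [← hαr]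
        rfl
      have h2 : mval g W ![simpRes h s 1] = mres _ h (mval g V ![s 1]) := by
        rw [mres_mval, simpRes_one]
        rfl
      rw [hval_res]
      refine pullback_sec_ext _ _ ?_ ?_
      · rw [(hl _ _ _ _ _).1, (hl _ _ _ _ _).1, h1]
        refine hom_sec_ext fun W'' hW'' x => ?_
        rw [p.hval_connDual, p.hval_connDual]
        congr 1
        refine Subtype.ext ?_
        rw [connProj_coe, connProj_coe, h2, hval_res]
      · rw [(hl _ _ _ _ _).2, (hl _ _ _ _ _).2, h1])
  have hLv : ∀ V s, mval L V s = l V s := mval_mdesc _ _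
  -- The expected coboundary of `L`, written in `Hom(T, Ω^1)`. The identity `hus` is verified after
  -- inclusion in `Hom(T, ĝ)`.
  let u : (cech U).X (-((0 + 1 + 1 : ℕ) : ℤ)) ⟶ (toShAb O).obj (homMod (tangent O) (Omega1 O)) :=
    mdesc (0 + 1 + 1) (fun V s => -p.homPairSec (α V ![s 0, s 1]) (β V ![s 1, s 2])) (fun V W h s => by
      have h1 : α W ![simpRes h s 0, simpRes h s 1] = mres _ h (α V ![s 0, s 1]) := by
        rw [hαr, simpRes_two]
        rfl
      have h2 : β W ![simpRes h s 1, simpRes h s 2] = mres _ h (β V ![s 1, s 2]) := by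
        rw [hβr, simpRes_two]
        rfl
      rw [h1, h2, map_neg]
      rfl)
  have huv : ∀ V s, mval u V s = -p.homPairSec (α V ![s 0, s 1]) (β V ![s 1, s 2]) := mval_mdesc _ _
  have hLs : L ≫ (p.seq.map (homFunctor (tangent O))).g = cechComp a := by
    refine mval_ext (M := homMod (tangent O) A.g) fun V s => ?_
    refine (mval_comp L (homPost (tangent O) _) V s).trans ?_
    rw [hLv]
    exact hom_sec_ext fun W hW ξ => (hl V s W hW ξ).2
  have hus : u ≫ (p.seq.map (homFunctor (tangent O))).f =
      (cech U).d (-((0 + 1 + 1 : ℕ) : ℤ)) (-((0 + 1 : ℕ) : ℤ)) ≫ L := by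
    refine mval_ext (M := homMod (tangent O) p.gHat) fun V s => ?_
    refine (mval_comp u (homPost (tangent O) p.fromOmega) V s).trans
      (Eq.trans ?_ (mval_d_one L V s).symm)
    rw [huv, hLv, hLv, hLv]
    refine hom_sec_ext fun W hW ξ => pullback_sec_ext _ _ ?_ ?_
    · have e1 : happ (pullback.fst (homPre O.unit A.gι) p.toDual) W (happ p.fromOmega W
          (hval (-p.homPairSec (α V ![s 0, s 1]) (β V ![s 1, s 2])) hW ξ)) =
          happ (homPre O.unit A.anchor) W
            (hval (-p.homPairSec (α V ![s 0, s 1]) (β V ![s 1, s 2])) hW ξ) :=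
        congrArg (fun φ : Omega1 O ⟶ dual A.mod => happ φ W _) (pullback.lift_fst _ _ _)
      rw [hval_homPost, e1, hval_add, hval_sub, LinearMap.add_apply, LinearMap.sub_apply, map_add,
        map_sub, (hl _ _ _ _ _).1, (hl _ _ _ _ _).1, (hl _ _ _ _ _).1]
      refine hom_sec_ext fun W' hW' x => ?_
      rw [hval_homPre, hval_add, hval_sub, LinearMap.add_apply, LinearMap.sub_apply,
        p.hval_connDual, p.hval_connDual, p.hval_connDual]
      have h1 := congrArg (fun f => toKer (mres A.g hW' (hval f hW ξ))) (hcoc V s)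
      -- The projections along `∇_j` and `∇_k` differ by `b_{jk} ∘ π`, because `∇_k - ∇_j =
      -- -b_{jk}`.
      have h2 : connProj (hconn ![s 1]) (hW'.trans hW) x = connProj (hconn ![s 2]) (hW'.trans hW) x -
          toKer (hval (β V ![s 1, s 2]) (hW'.trans hW) (happ A.anchor W' x)) := by
        refine Subtype.ext ?_
        have h3 := congrArg (fun f => hval f (hW'.trans hW) (happ A.anchor W' x)) (hgb V ![s 1, s 2])
        change hval (mval g V ![s 2]) _ _ - hval (mval g V ![s 1]) _ _ =
          -happ A.gι W' (hval (β V ![s 1, s 2]) _ _) at h3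
        change x - hval (mval g V ![s 1]) _ _ = x - hval (mval g V ![s 2]) _ _ -
          happ A.gι W' (hval (β V ![s 1, s 2]) _ _)
        rw [← neg_eq_iff_eq_neg.2 h3]
        abel
      refine (p.pair_sub_add_pair ?_ h2).symm
      simp only [hval_add, hval_sub, LinearMap.add_apply, LinearMap.sub_apply, map_add, map_sub,
        hval_zero, LinearMap.zero_apply, map_zero] at h1
      exact h1
    · have e1 : happ (pullback.snd (homPre O.unit A.gι) p.toDual) W (happ p.fromOmega W
          (hval (-p.homPairSec (α V ![s 0, s 1]) (β V ![s 1, s 2])) hW ξ)) = 0 :=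
        congrArg (fun φ : Omega1 O ⟶ A.g => happ φ W _) (pullback.lift_snd _ _ _)
      rw [hval_homPost, e1, hval_add, hval_sub, LinearMap.add_apply, LinearMap.sub_apply, map_add,
        map_sub, (hl _ _ _ _ _).2, (hl _ _ _ _ _).2, (hl _ _ _ _ _).2]
      -- The `g`-component of the coboundary is that of `a` itself, which vanishes.
      exact (congrArg (fun f => hval f hW ξ) (hcoc V s)).symm
  obtain ⟨c, hc, hcu⟩ := exists_represents_comp_extClass
    (homFunctor_shortExact hT (p.seq_shortExact hA hT)) ha L u hLs hus
  refine ⟨c, by rw [betaClass_eq]; exact hc, fun V s => ?_⟩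
  exact (congrArg (fun t => mval (M := homMod (tangent O) (Omega1 O)) t V s) hcu).trans (huv V s)

end Cocycles

end LieAlgebroid

end

section

variable {X : TopCat.{u}} {O : CAlgSheaf X}

/-! ### Identification of `β` with the cup square. -/

namespace LieAlgebroid

variable {A : LieAlgebroid O} {ι : Type u} {U : ι → Opens X}

/-- The Čech 0-cochain of a family of sections. -/
def connCochain (D : ∀ i, MSec (homMod (tangent O) A.mod) (U i)) :
    (cech U).X (-((0 : ℕ) : ℤ)) ⟶ (toShAb O).obj (homMod (tangent O) A.mod) :=
  mdesc 0 (fun _ s => mres _ (s 0).2 (D (s 0).1)) (fun _ _ _ _ => mres_mres _ _ _ _)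

lemma mval_connCochain (D : ∀ i, MSec (homMod (tangent O) A.mod) (U i)) (V : Opens X)
    (s : Simp U 0 V) : mval (connCochain D) V s = mres _ (s 0).2 (D (s 0).1) :=
  mval_mdesc _ _ _ _

lemma connCochain_anchor {D : ∀ i, MSec (homMod (tangent O) A.mod) (U i)} (hD : ∀ i, IsConn (D i)) :
    connCochain D ≫ (toShAb O).map (homPost (tangent O) A.anchor) = cechε U ≫
      constHom (F := (toShAb O).obj (homMod (tangent O) (tangent O))) (idSec (tangent O)) := by
  refine mval_ext (M := homMod (tangent O) (tangent O)) fun V s => ?_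
  refine (mval_comp (connCochain D) (homPost (tangent O) A.anchor) V s).trans
    (Eq.trans ?_ (sapp_cechε_constHom (F := (toShAb O).obj (homMod (tangent O) (tangent O)))
      (idSec (tangent O)) V s).symm)
  rw [mval_connCochain]
  exact hom_sec_ext fun W hW ξ => hD _ W (hW.trans (s 0).2) ξ

/-- Near each point the vector fields of a frame lift along the anchor, which gives a cover indexed
by the points of `X`. -/
lemma exists_local_conn (hT : IsLocallyFree (tangent O)) (hA : A.IsTransitive) :
    ∃ (U : X → Opens X) (_ : iSup U = ⊤) (D : ∀ x, MSec (homMod (tangent O) A.mod) (U x)),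
      ∀ x, IsConn (D x) := by
  have := hA.epi
  choose U hU hx D hD using fun x : X => hom_lift_of_frame A.anchor hT ⊤ (idSec (tangent O)) x trivial
  refine ⟨U, eq_top_iff.2 fun x _ => Opens.mem_iSup.2 ⟨x, hx x⟩, D, fun x V hV ξ => ?_⟩
  exact congrArg (fun f : MSec (homMod (tangent O) (tangent O)) (U x) => hval f hV ξ) (hD x)

/-- The Koszul sign in bidegree `(1, 1)` is the minus sign found in `exists_represents_betaClass`.
-/
lemma InvariantPairing.neg_one_smul_homPair (p : A.InvariantPairing)
    (a b : cech U ⟶ (single₀ ((homFunctor (tangent O)).obj A.g))⟦((1 : ℕ) : ℤ)⟧) (V : Opens X)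
    (s : Simp U 2 V) : (-1 : ℤ) ^ (1 * 1) • p.homPair.app V
        (cval₀ a V fun j => s ⟨j, by omega⟩) (cval₀ b V fun j => s ⟨1 + j, by omega⟩) =
      -p.homPairSec (mval (M := homMod (tangent O) A.g) (p := 1) (cechComp a) V ![s 0, s 1])
        (mval (M := homMod (tangent O) A.g) (p := 1) (cechComp b) V ![s 1, s 2]) := by
  have h1 : (fun j : Fin 2 => s ⟨j, by omega⟩) = ![s 0, s 1] := by ext j; fin_cases j <;> rfl
  have h2 : (fun j : Fin 2 => s ⟨1 + j, by omega⟩) = ![s 1, s 2] := by ext j; fin_cases j <;> rfl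
  rw [h1, h2, mul_one, pow_one, neg_one_smul]
  rfl

open DerivedCategory

variable [HasExt.{w} O.Mod] [HasDerivedCategory.{w1} (ShAb X)]

/-- The class of the 2-extension is the cup square of the Atiyah class. -/
theorem isCup_iff (hT : IsLocallyFree (tangent O)) (hA : A.IsTransitive) (p : A.InvariantPairing)
    (z : Sheaf.H ((homFunctor (tangent O)).obj (Omega1 O)) 2) :
    IsCup p.homPair (p := 1) (q := 1) rfl (atiyahClass hT hA) (atiyahClass hT hA) z ↔
      z = betaClass hT hA p := by
  constructor
  · rintro ⟨ι, U, hU, a, b, c, ha, hb, hc, h⟩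
    obtain ⟨c', hc', h'⟩ := exists_represents_betaClass p hU ha hb
    -- The given cup cocycle and the constructed cocycle of `β` have the same values, so they are
    -- equal and represent one class.
    have hcc : c = c' := cechComp_injective (mval_ext (M := homMod (tangent O) (Omega1 O))
      fun V s => by
        exact (h V s).trans ((p.neg_one_smul_homPair a b V s).trans (h' V s).symm))
    subst hcc
    exact toHyperH_injective (hc.unique hU hc')
  · rintro rfl
    -- The cup square exists: differences of local connections give a cocycle, which serves for both
    -- factors.
    obtain ⟨U, hU, D, hD⟩ := exists_local_conn hT hA
    obtain ⟨b, hb, -⟩ := represents_atiyahClass (hT := hT) (hA := hA) _ (connCochain_anchor hD)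
    obtain ⟨c, hc, h⟩ := exists_represents_betaClass p hU hb hb
    refine ⟨_, U, hU, b, b, c, hb, hb, hc, fun V s => (h V s).trans
      (p.neg_one_smul_homPair b b V s).symm⟩

end LieAlgebroid

end

section

variable {X : TopCat.{u}} {O : CAlgSheaf X}

namespace LieAlgebroid

/-! ### The form `⟨x, [y, z]⟩` -/

section Triple

variable {A : LieAlgebroid O} {V : Opens X}

lemma bracket_swap (x y : MSec A.mod V) : A.bracket V y x = -A.bracket V x y := by
  have h := A.bracket_self V (x + y)
  rw [A.bracket_add, A.add_bracket, A.add_bracket, A.bracket_self, A.bracket_self, zero_add,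
    add_zero] at h
  exact eq_neg_of_add_eq_zero_left h

lemma add_ad (x y : MSec A.mod V) (b : A.ker V) : ad (x + y) b = ad x b + ad y b :=
  Subtype.ext (A.add_bracket V _ _ _)

lemma ad_swap (b c : A.ker V) : ad (c : MSec A.mod V) b = -ad (b : MSec A.mod V) c :=
  Subtype.ext (bracket_swap _ _)

lemma ad_jacobi (x : MSec A.mod V) (b c : A.ker V) : ad x (ad (b : MSec A.mod V) c) =
    ad (ad x b : MSec A.mod V) c + ad (b : MSec A.mod V) (ad x c) :=
  Subtype.ext (A.jacobi V _ _ _)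

namespace InvariantPairing

variable (p : A.InvariantPairing)

lemma pair_neg (b c : A.ker V) : p.pair V b (-c) = -p.pair V b c :=
  map_neg (AddMonoidHom.mk' (p.pair V b) (p.pair_add V b)) c

lemma neg_pair (b c : A.ker V) : p.pair V (-b) c = -p.pair V b c := by
  rw [p.symm, p.pair_neg, p.symm]

lemma pair_sub (b c d : A.ker V) : p.pair V b (c - d) = p.pair V b c - p.pair V b d :=
  map_sub (AddMonoidHom.mk' (p.pair V b) (p.pair_add V b)) c d

lemma sub_pair (b c d : A.ker V) : p.pair V (b - c) d = p.pair V b d - p.pair V c d := by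
  rw [p.symm, p.pair_sub, p.symm, p.symm V c]

lemma pair_zero (b : A.ker V) : p.pair V b 0 = 0 :=
  map_zero (AddMonoidHom.mk' (p.pair V b) (p.pair_add V b))

/-- The alternating form `⟨x, [y, z]⟩`. -/
def triple (x y z : A.ker V) : O.Sec V := p.pair V x (ad (y : MSec A.mod V) z)

lemma triple_swap23 (x y z : A.ker V) : p.triple x z y = -p.triple x y z := by
  rw [triple, triple, ad_swap, p.pair_neg]

/-- A section of `ker` has zero anchor, so invariance says that its adjoint action is skew for the
pairing. -/
lemma triple_swap12 (x y z : A.ker V) : p.triple y x z = -p.triple x y z := by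
  have h := p.invariant V (z : MSec A.mod V) x y
  have h0 : act (happ A.anchor V z) (p.pair V x y) = 0 := by
    rw [LinearMap.mem_ker.1 z.2]
    rfl
  rw [h0, ad_swap x z, ad_swap y z, p.neg_pair, p.pair_neg, p.symm] at h
  rw [triple, triple]
  linear_combination h

lemma pair_ad (x y z : A.ker V) : p.pair V (ad (x : MSec A.mod V) y) z = p.triple x y z := by
  rw [p.symm]
  change p.triple z x y = _
  rw [p.triple_swap12, p.triple_swap23, neg_neg]

lemma add_triple (x x' y z : A.ker V) : p.triple (x + x') y z = p.triple x y z + p.triple x' y z :=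
  p.add_pair _ _ _ _

lemma triple_add_snd (x y y' z : A.ker V) :
    p.triple x (y + y') z = p.triple x y z + p.triple x y' z := by
  rw [p.triple_swap12, p.add_triple, p.triple_swap12 x y, p.triple_swap12 x y']
  ring

lemma triple_add (x y z z' : A.ker V) : p.triple x y (z + z') = p.triple x y z + p.triple x y z' := by
  rw [p.triple_swap23, p.triple_add_snd, p.triple_swap23 x y z, p.triple_swap23 x y z']
  ring

lemma sub_triple (x x' y z : A.ker V) : p.triple (x - x') y z = p.triple x y z - p.triple x' y z :=
  p.sub_pair _ _ _

lemma smul_triple (r : O.Sec V) (x y z : A.ker V) : p.triple (r • x) y z = r * p.triple x y z :=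
  p.smul_pair _ _ _ _

lemma act_triple (D : MSec A.mod V) (x y z : A.ker V) :
    act (happ A.anchor V D) (p.triple x y z) =
      p.triple (ad D x) y z - p.triple (ad D y) x z + p.triple (ad D z) x y := by
  rw [triple, p.invariant, ad_jacobi, p.pair_add]
  change p.triple _ _ _ + (p.triple _ _ _ + p.triple _ _ _) = _
  rw [p.triple_swap12 (ad D y) x z, p.triple_swap23 x (ad D z) y, p.triple_swap12 (ad D z) x y]
  ring

/-- Invariance moves `x` out of the bracket in each term. What remains is `x` paired with the Jacobi
identity for `y, z, w`. -/
lemma triple_jacobi (x y z w : A.ker V) :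
    p.triple (ad (x : MSec A.mod V) y) z w - p.triple (ad (x : MSec A.mod V) z) y w +
      p.triple (ad (x : MSec A.mod V) w) y z = 0 := by
  have h : ∀ a b c d : A.ker V, p.triple (ad (a : MSec A.mod V) b) c d =
      p.pair V a (ad (b : MSec A.mod V) (ad (c : MSec A.mod V) d)) := fun a b c d =>
    p.pair_ad a b _
  rw [h, h, h, ad_jacobi, ad_swap w (ad _ _), p.pair_add, p.pair_neg]
  ring

lemma triple_ad_comm (x y z w : A.ker V) : p.triple (ad (x : MSec A.mod V) y) z w =
    p.triple (ad (z : MSec A.mod V) w) x y :=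
  p.symm _ _ _

end InvariantPairing

end Triple

/-! ### Maurer-Cartan equations -/

section MaurerCartan

variable {A : LieAlgebroid O} {V : Opens X} (p : A.InvariantPairing)
  {D : MSec (tangent O) V → MSec A.mod V} (hD : ∀ ξ, happ A.anchor V (D ξ) = ξ)
  {a b : MSec (tangent O) V → A.ker V}

include hD

/-- If `D` and `D + a` commute with brackets, then `⟨a, [a, a]⟩` is closed. -/
lemma InvariantPairing.extD3_triple
    (ha : ∀ ξ η, ad (D ξ) (a η) - ad (D η) (a ξ) - a (lie ξ η) +
      ad (a ξ : MSec A.mod V) (a η) = 0) (x y z w : MSec (tangent O) V) :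
    extD3 (fun x => p.triple (a x.1) (a x.2.1) (a x.2.2)) x y z w = 0 := by
  -- The Maurer-Cartan equation for the pair `x, y`, paired with `[a z, a w]`.
  have hM : ∀ x y z w, p.triple (ad (D x) (a y)) (a z) (a w) -
      p.triple (ad (D y) (a x)) (a z) (a w) - p.triple (a (lie x y)) (a z) (a w) +
      p.triple (ad (a x : MSec A.mod V) (a y)) (a z) (a w) = 0 := fun x y z w => by
    rw [← p.sub_triple, ← p.sub_triple, ← p.add_triple, ha, InvariantPairing.triple, p.symm, p.pair_zero]
  -- The vector field `x` acts as the anchor of `D x`, so invariance differentiates the pairing.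
  have hact : ∀ x y z w, act x (p.triple (a y) (a z) (a w)) =
      p.triple (ad (D x) (a y)) (a z) (a w) - p.triple (ad (D x) (a z)) (a y) (a w) +
        p.triple (ad (D x) (a w)) (a y) (a z) := fun x y z w => by
    rw [← p.act_triple, hD]
  simp only [extD3, hact]
  -- One Maurer-Cartan equation for each of the six pairs removes all derivatives. The six quartic
  -- terms `⟨[a, a], [a, a]⟩` agree in pairs by symmetry of the pairing, which leaves twice a Jacobi
  -- sum.
  linear_combination hM x y z w - hM x z y w + hM x w y z + hM y z x w - hM y w x z + hM z w x y -
    2 * p.triple_jacobi (a x) (a y) (a z) (a w) - p.triple_ad_comm (a z) (a w) (a x) (a y) +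
    p.triple_ad_comm (a y) (a w) (a x) (a z) - p.triple_ad_comm (a y) (a z) (a x) (a w)

/-- The derivative of `-⟨a ∧ b⟩`, if `D`, `D + a` and `D + a + b` commute with brackets. -/
lemma InvariantPairing.extD2_wedge
    (ha : ∀ ξ η, ad (D ξ) (a η) - ad (D η) (a ξ) - a (lie ξ η) +
      ad (a ξ : MSec A.mod V) (a η) = 0)
    (hb : ∀ ξ η, ad (D ξ) (b η) - ad (D η) (b ξ) - b (lie ξ η) +
      ad (a ξ : MSec A.mod V) (b η) + ad (b ξ : MSec A.mod V) (a η) +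
      ad (b ξ : MSec A.mod V) (b η) = 0) (x y z : MSec (tangent O) V) :
    extD2 (fun x => -p.wedge a b x.1 x.2) (x, y, z) =
      p.triple (b x) (b y) (b z) - p.triple (a x + b x) (a y + b y) (a z + b z) +
        p.triple (a x) (a y) (a z) := by
  have hA : ∀ ξ η c, p.pair V (ad (D ξ) (a η)) c - p.pair V (ad (D η) (a ξ)) c -
      p.pair V (a (lie ξ η)) c + p.triple (a ξ) (a η) c = 0 := fun ξ η c => by
    rw [← p.pair_ad, ← p.sub_pair, ← p.sub_pair, ← p.add_pair, ha, p.symm, p.pair_zero]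
  have hB : ∀ ξ η c, p.pair V c (ad (D ξ) (b η)) - p.pair V c (ad (D η) (b ξ)) -
      p.pair V c (b (lie ξ η)) + p.triple c (a ξ) (b η) + p.triple c (b ξ) (a η) +
      p.triple c (b ξ) (b η) = 0 := fun ξ η c => by
    rw [InvariantPairing.triple, InvariantPairing.triple, InvariantPairing.triple, ← p.pair_sub, ← p.pair_sub, ← p.pair_add, ← p.pair_add,
      ← p.pair_add, hb, p.pair_zero]
  have hact : ∀ x b c, act x (p.pair V b c) = p.pair V (ad (D x) b) c + p.pair V b (ad (D x) c) :=
    fun x b c => by rw [← p.invariant, hD]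
  simp only [extD2, wedge, act_neg, act_sub, hact, p.add_triple, p.triple_add_snd, p.triple_add]
  have s1 := fun x y z : A.ker V => p.triple_swap12 x y z
  have s2 := fun x y z : A.ker V => p.triple_swap23 x y z
  have cyc : ∀ x y z : A.ker V, p.triple z x y = p.triple x y z := fun x y z => by
    rw [s1, s2, neg_neg]
  -- The Maurer-Cartan equations for `a` paired with `b`, and for `b` paired with `a`, remove the
  -- derivatives. The cubic terms that are left are mixed in `a` and `b`, and match the mixed terms
  -- of the expanded triple of `a + b` by the alternating property.
  linear_combination -hA x y (b z) + hA x z (b y) - hA y z (b x) + hB x y (a z) - hB x z (a y) +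
    hB y z (a x) - cyc (a y) (a z) (b x) + s1 (a x) (a y) (b z) + s1 (b x) (a y) (a z) +
    s1 (b x) (a y) (b z) - s2 (a x) (b y) (a z) - cyc (a x) (b y) (a z) - cyc (b x) (a y) (a z) -
    cyc (b x) (b y) (a z)

end MaurerCartan

end LieAlgebroid

end

section

variable {X : TopCat.{u}} {O : CAlgSheaf X}

lemma sapp_d_one {ι : Type u} {U : ι → Opens X} {F : ShAb X}
    (φ : (cech U).X (-((1 : ℕ) : ℤ)) ⟶ F) (V : Opens X) (s : Simp U (1 + 1) V) :
    sapp ((cech U).d (-((1 + 1 : ℕ) : ℤ)) (-((1 : ℕ) : ℤ)) ≫ φ) V (cechGen U (1 + 1) V s) =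
      sapp φ V (cechGen U 1 V ![s 1, s 2]) - sapp φ V (cechGen U 1 V ![s 0, s 2]) +
        sapp φ V (cechGen U 1 V ![s 0, s 1]) := by
  rw [sapp_cech_d_comp, Fin.sum_univ_three]
  have h0 : (fun j => s ((0 : Fin 3).succAbove j)) = ![s 1, s 2] := by ext j; fin_cases j <;> rfl
  have h1 : (fun j => s ((1 : Fin 3).succAbove j)) = ![s 0, s 2] := by ext j; fin_cases j <;> rfl
  have h2 : (fun j => s ((2 : Fin 3).succAbove j)) = ![s 0, s 1] := by ext j; fin_cases j <;> rfl
  rw [h0, h1, h2]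
  simp [sub_eq_add_neg]

namespace LieAlgebroid

/-! ### The forms `B` and `H` -/

section FlatConnections

variable {A : LieAlgebroid O} {ι : Type u} {U : ι → Opens X}
  {D : ∀ i, MSec (homMod (tangent O) A.mod) (U i)} (hD : ∀ i, IsFlatConnection (D i))
  (p : A.InvariantPairing) {V : Opens X} (i j k l : {i : ι // V ≤ U i})

lemma connDiff_trans (ξ : MSec (tangent O) V) :
    connDiff hD i j ξ + connDiff hD j k ξ = connDiff hD i k ξ :=
  Subtype.ext (by
    change (hval (D j.1) j.2 ξ - hval (D i.1) i.2 ξ) + (hval (D k.1) k.2 ξ - hval (D j.1) j.2 ξ) =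
      hval (D k.1) k.2 ξ - hval (D i.1) i.2 ξ
    abel)

lemma connDiff_swap (ξ : MSec (tangent O) V) : connDiff hD j i ξ = -connDiff hD i j ξ :=
  Subtype.ext (neg_sub _ _).symm

lemma connDiff_add (ξ η : MSec (tangent O) V) :
    connDiff hD i j (ξ + η) = connDiff hD i j ξ + connDiff hD i j η :=
  Subtype.ext (by
    change hval (D j.1) j.2 (ξ + η) - hval (D i.1) i.2 (ξ + η) =
      (hval (D j.1) j.2 ξ - hval (D i.1) i.2 ξ) + (hval (D j.1) j.2 η - hval (D i.1) i.2 η)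
    rw [map_add, map_add]
    abel)

lemma connDiff_smul (r : O.Sec V) (ξ : MSec (tangent O) V) :
    connDiff hD i j (r • ξ) = r • connDiff hD i j ξ :=
  Subtype.ext (by
    change hval (D j.1) j.2 (r • ξ) - hval (D i.1) i.2 (r • ξ) =
      r • (hval (D j.1) j.2 ξ - hval (D i.1) i.2 ξ)
    rw [map_smul, map_smul, smul_sub])

lemma kres_connDiff {W : Opens X} (h : W ≤ V) (ξ : MSec (tangent O) V) :
    kres h (connDiff hD i j ξ) =
      connDiff hD ⟨i.1, h.trans i.2⟩ ⟨j.1, h.trans j.2⟩ (mres _ h ξ) :=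
  Subtype.ext (by
    change mres _ h (hval (D j.1) j.2 ξ - hval (D i.1) i.2 ξ) = _
    rw [map_sub, hval_nat, hval_nat]
    rfl)

/-- This is the flatness of `∇_j = ∇_i + A_{ij}` minus the flatness of `∇_i`. -/
lemma maurerCartan (ξ η : MSec (tangent O) V) :
    ad (hval (D i.1) i.2 ξ) (connDiff hD i j η) - ad (hval (D i.1) i.2 η) (connDiff hD i j ξ) -
      connDiff hD i j (lie ξ η) + ad (connDiff hD i j ξ : MSec A.mod V) (connDiff hD i j η) = 0 := by
  refine Subtype.ext ?_
  have h1 := (hD i.1).flat V i.2 ξ η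
  have h2 := (hD j.1).flat V j.2 ξ η
  change A.bracket V (hval (D i.1) i.2 ξ) (hval (D j.1) j.2 η - hval (D i.1) i.2 η) -
    A.bracket V (hval (D i.1) i.2 η) (hval (D j.1) j.2 ξ - hval (D i.1) i.2 ξ) -
    (hval (D j.1) j.2 (lie ξ η) - hval (D i.1) i.2 (lie ξ η)) +
    A.bracket V (hval (D j.1) j.2 ξ - hval (D i.1) i.2 ξ) (hval (D j.1) j.2 η - hval (D i.1) i.2 η) = 0
  rw [← h1, ← h2]
  generalize hval (D i.1) i.2 ξ = x
  generalize hval (D i.1) i.2 η = y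
  generalize hval (D j.1) j.2 ξ = z
  generalize hval (D j.1) j.2 η = w
  have s : ∀ a b c : MSec A.mod V, A.bracket V a (b - c) = A.bracket V a b - A.bracket V a c :=
    fun a => map_sub (AddMonoidHom.mk' (A.bracket V a) (A.bracket_add V a))
  have s' : ∀ a b c : MSec A.mod V, A.bracket V (a - b) c = A.bracket V a c - A.bracket V b c :=
    fun a b c => map_sub (AddMonoidHom.mk' (fun t => A.bracket V t c)
      (fun t t' => A.add_bracket V t t' c)) a b
  rw [s, s, s', s, s, bracket_swap z y, bracket_swap x y]
  abel

/-- The Maurer-Cartan equation of `A_{jk}`, rewritten with base connection `∇_i`. In the derivative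
of `⟨A_{ij} ∧ A_{jk}⟩` both factors must be differentiated by one connection. -/
lemma maurerCartan_trans (ξ η : MSec (tangent O) V) :
    ad (hval (D i.1) i.2 ξ) (connDiff hD j k η) - ad (hval (D i.1) i.2 η) (connDiff hD j k ξ) -
      connDiff hD j k (lie ξ η) + ad (connDiff hD i j ξ : MSec A.mod V) (connDiff hD j k η) +
      ad (connDiff hD j k ξ : MSec A.mod V) (connDiff hD i j η) +
      ad (connDiff hD j k ξ : MSec A.mod V) (connDiff hD j k η) = 0 := by
  have h := maurerCartan hD j k ξ η
  have e : ∀ ξ, hval (D j.1) j.2 ξ = hval (D i.1) i.2 ξ + connDiff hD i j ξ := fun ξ =>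
    (add_sub_cancel _ _).symm
  rw [e, e, add_ad, add_ad, ad_swap (connDiff hD j k ξ) (connDiff hD i j η)] at h
  rw [← h]
  abel

namespace InvariantPairing

lemma wedge_swap (a b : MSec (tangent O) V → A.ker V) (ξ η : MSec (tangent O) V) :
    p.wedge a b η ξ = -p.wedge a b ξ η := by
  rw [wedge, wedge, neg_sub]

/-- Since `A_{ki} = -(A_{ij} + A_{jk})` and `⟨a ∧ a⟩ = 0` for a symmetric pairing, all three wedge
products equal `⟨A_{ij} ∧ A_{jk}⟩`. The coefficients `-1 - 1 + 1` add up to `-1`. -/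
lemma formB_eq (ξ η : MSec (tangent O) V) :
    p.formB hD i j k ξ η = -p.wedge (connDiff hD i j) (connDiff hD j k) ξ η := by
  simp only [formB, wedge, connDiff_swap hD i k, ← connDiff_trans hD i j k, p.pair_neg, p.neg_pair,
    p.add_pair, p.pair_add]
  rw [p.symm V (connDiff hD j k ξ) (connDiff hD i j η),
    p.symm V (connDiff hD j k η) (connDiff hD i j ξ),
    p.symm V (connDiff hD j k η) (connDiff hD j k ξ),
    p.symm V (connDiff hD i j η) (connDiff hD i j ξ)]
  ring

lemma isForm2_formB : IsForm2 (fun x : _ × _ => p.formB hD i j k x.1 x.2) where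
  add a b c := by
    simp only [formB_eq, wedge, connDiff_add, p.add_pair, p.pair_add]
    ring
  smul r a b := by
    simp only [formB_eq, wedge, connDiff_smul, p.smul_pair, p.pair_smul]
    ring
  swap a b := by
    simp only [formB_eq, p.wedge_swap _ _ a b]

lemma isClosed3_formH : IsClosed3 (fun x : _ × _ × _ => p.formH hD i j x.1 x.2.1 x.2.2) where
  form :=
    { add := fun a b c d => by
        change p.triple _ _ _ = p.triple _ _ _ + p.triple _ _ _
        rw [connDiff_add, p.add_triple]
      smul := fun r a b c => by
        change p.triple _ _ _ = r * p.triple _ _ _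
        rw [connDiff_smul, p.smul_triple]
      swap12 := fun a b c => p.triple_swap12 _ _ _
      swap23 := fun a b c => p.triple_swap23 _ _ _ }
  closed := p.extD3_triple (fun ξ => (hD i.1).anchor V i.2 ξ) (maurerCartan hD i j)

/-- This is `extD2_wedge` with `D = ∇_i`, `a = A_{ij}`, `b = A_{jk}` and `a + b = A_{ik}`. It is the
mixed part of the cocycle condition for `(B, H)`. -/
lemma extD2_formB (ξ η ζ : MSec (tangent O) V) :
    extD2 (fun x : _ × _ => p.formB hD i j k x.1 x.2) (ξ, η, ζ) =
      p.formH hD j k ξ η ζ - p.formH hD i k ξ η ζ + p.formH hD i j ξ η ζ := by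
  have h := p.extD2_wedge (fun ξ => (hD i.1).anchor V i.2 ξ) (maurerCartan hD i j)
    (maurerCartan_trans hD i j k) ξ η ζ
  simp only [connDiff_trans] at h
  simp only [formB_eq]
  exact h

/-- Up to sign, `B` is a bilinear product of the additive cocycle `A` with itself; additivity of `A`
along edges cancels everything. -/
lemma formB_cocycle (ξ η : MSec (tangent O) V) :
    p.formB hD j k l ξ η - p.formB hD i k l ξ η + p.formB hD i j l ξ η - p.formB hD i j k ξ η = 0 := by
  simp only [formB_eq, wedge, ← connDiff_trans hD i j k, ← connDiff_trans hD j k l, p.pair_add,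
    p.add_pair]
  ring

lemma res_formB {W : Opens X} (h : W ≤ V) (ξ η : MSec (tangent O) V) :
    O.res h (p.formB hD i j k ξ η) = p.formB hD ⟨i.1, h.trans i.2⟩ ⟨j.1, h.trans j.2⟩
      ⟨k.1, h.trans k.2⟩ (mres _ h ξ) (mres _ h η) := by
  simp only [formB, wedge, map_add, map_sub, map_neg, p.pair_res, kres_connDiff]

lemma res_formH {W : Opens X} (h : W ≤ V) (ξ η ζ : MSec (tangent O) V) :
    O.res h (p.formH hD i j ξ η ζ) = p.formH hD ⟨i.1, h.trans i.2⟩ ⟨j.1, h.trans j.2⟩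
      (mres _ h ξ) (mres _ h η) (mres _ h ζ) := by
  have e : ∀ b c : A.ker V, kres h (ad (b : MSec A.mod V) c) =
      ad (kres h b : MSec A.mod W) (kres h c) := fun b c => Subtype.ext (A.bracket_res V W h _ _)
  simp only [formH, p.pair_res, e, kres_connDiff]

/-- The 2-form `B`. -/
def secB (V : Opens X) (s : Simp U 2 V) : MSec (Omega2 O) V :=
  mkFam (P := form2Cond O) (fun _ hW x => p.formB hD ⟨(s 0).1, hW.trans (s 0).2⟩
      ⟨(s 1).1, hW.trans (s 1).2⟩ ⟨(s 2).1, hW.trans (s 2).2⟩ x.1 x.2)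
    (fun _ _ _ hW _ => p.res_formB hD _ _ _ hW _ _)
    (fun _ _ => p.isForm2_formB hD _ _ _)

/-- The closed 3-form `H`. -/
def secH (V : Opens X) (s : Simp U 1 V) : (Omega3cl O).obj.obj (op V) :=
  mkFam (P := closed3Cond O) (fun _ hW x => p.formH hD ⟨(s 0).1, hW.trans (s 0).2⟩
      ⟨(s 1).1, hW.trans (s 1).2⟩ x.1 x.2.1 x.2.2)
    (fun _ _ _ hW _ => p.res_formH hD _ _ hW _ _ _)
    (fun _ _ => p.isClosed3_formH hD _ _)

/-- The Čech cochain `B`. -/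
def cochainB : (cech U).X (-((2 : ℕ) : ℤ)) ⟶ (toShAb O).obj (Omega2 O) :=
  mdesc 2 (p.secB hD) (fun _ _ _ _ => rfl)

/-- The Čech cochain `H`. -/
def cochainH : (cech U).X (-((1 : ℕ) : ℤ)) ⟶ Omega3cl O :=
  cechDesc 1 (p.secH hD) (fun _ _ _ _ => rfl)

lemma mval_cochainB (V : Opens X) (s : Simp U 2 V) :
    mval (p := 2) (p.cochainB hD) V s = p.secB hD V s :=
  mval_mdesc (M := Omega2 O) _ _ _ _

lemma sapp_cochainH (V : Opens X) (s : Simp U 1 V) :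
    sapp (p.cochainH hD) V (cechGen U 1 V s) = p.secH hD V s :=
  sapp_cechDesc (F := Omega3cl O) _ _ _ _ _

lemma d_cochainB : (cech U).d (-((2 + 1 : ℕ) : ℤ)) (-((2 : ℕ) : ℤ)) ≫ p.cochainB hD = 0 := by
  refine mval_ext (M := Omega2 O) fun V s => ?_
  have h : ∀ i j k, mval (p := 0 + 1 + 1) (p.cochainB hD) V ![s i, s j, s k] =
    p.secB hD V ![s i, s j, s k] := fun i j k => p.mval_cochainB hD V _
  refine (mval_d_two (M := Omega2 O) (p.cochainB hD) V s).trans ?_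
  refine (congrArg₂ HSub.hSub (congrArg₂ HAdd.hAdd (congrArg₂ HSub.hSub (h 1 2 3) (h 0 2 3))
    (h 0 1 3)) (h 0 1 2)).trans ?_
  exact fam_ext (P := form2Cond O) fun W hW x => p.formB_cocycle hD _ _ _ _ _ _

lemma cochainB_extD : p.cochainB hD ≫ extD O =
    (cech U).d (-((1 + 1 : ℕ) : ℤ)) (-((1 : ℕ) : ℤ)) ≫ p.cochainH hD := by
  refine cechX_hom_ext fun V s => ?_
  have h : ∀ i j, sapp (p.cochainH hD) V (cechGen U 1 V ![s i, s j]) =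
    p.secH hD V ![s i, s j] := fun i j => p.sapp_cochainH hD V _
  refine Eq.trans ?_ (sapp_d_one (p.cochainH hD) V s).symm
  rw [sapp_comp]
  refine (congrArg (sapp (extD O) V) (p.mval_cochainB hD V s)).trans (Eq.trans ?_
    (congrArg₂ HAdd.hAdd (congrArg₂ HSub.hSub (h 1 2) (h 0 2)) (h 0 1)).symm)
  exact fam_ext (P := closed3Cond O) fun W hW x => p.extD2_formB hD _ _ _ _ _ _

end InvariantPairing

end FlatConnections

end LieAlgebroid

end

section

variable {X : TopCat.{u}}

/-! ### Čech cocycles with values in a two-term complex -/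

section TwoTerm

variable {C : Type*} [Category* C] [Preadditive C] {K M : CochainComplex C ℤ} {p q : ℤ}

open scoped Classical in
lemma exists_hom_of_isZero (hpq : p + 1 = q) (hM : ∀ k, k ≠ p → k ≠ q → IsZero (M.X k))
    (φ : K.X p ⟶ M.X p) (ψ : K.X q ⟶ M.X q) (h : φ ≫ M.d p q = K.d p q ≫ ψ)
    (h0 : ∀ k, k + 1 = p → K.d k p ≫ φ = 0) : ∃ f : K ⟶ M, f.f p = φ ∧ f.f q = ψ := by
  have hne : q ≠ p := by omega
  -- The two prescribed components, transported along equalities of degrees, and zero elsewhere.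
  let f : ∀ k, K.X k ⟶ M.X k := fun k =>
    if e : k = p then eqToHom (by rw [e]) ≫ φ ≫ eqToHom (by rw [e]) else
      if e : k = q then eqToHom (by rw [e]) ≫ ψ ≫ eqToHom (by rw [e]) else 0
  have hp : f p = φ := by simp [f]
  have hq : f q = ψ := by simp [f, hne]
  refine ⟨{ f := f, comm' := fun i j hij => ?_ }, hp, hq⟩
  replace hij : i + 1 = j := hij
  by_cases hjp : j = p
  · subst hjp
    rw [hp, h0 i hij, (hM i (by omega) (by omega)).eq_of_tgt (f i) 0, zero_comp]
  by_cases hjq : j = q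
  · obtain rfl : i = p := by omega
    subst hjq
    rw [hp, hq, h]
  · exact (hM j hjp hjq).eq_of_tgt _ _

lemma hom_ext_of_isZero (hM : ∀ k, k ≠ p → k ≠ q → IsZero (M.X k)) {f g : K ⟶ M}
    (hp : f.f p = g.f p) (hq : f.f q = g.f q) : f = g := by
  refine HomologicalComplex.hom_ext _ _ fun k => ?_
  by_cases h : k = p
  · rwa [h]
  by_cases h' : k = q
  · rwa [h']
  · exact (hM k h h').eq_of_tgt _ _

/-- An even shift leaves the differential without sign, so the cocycle condition for `(B, H)` in
degree 2 carries none. -/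
lemma shift_d_eq (K : CochainComplex C ℤ) {n i j i' j' : ℤ} (hn : n.negOnePow = 1) (hi : i' = i + n)
    (hj : j' = j + n) : (K⟦n⟧).d i j = (CochainComplex.shiftFunctorObjXIso K n i i' hi).hom ≫
      K.d i' j' ≫ (CochainComplex.shiftFunctorObjXIso K n j j' hj).inv := by
  subst hi hj
  simp only [CochainComplex.shiftFunctor_obj_d', hn, one_smul]
  exact ((Category.id_comp _).trans (Category.comp_id _)).symm

lemma shift_map_f_comp (φ : K ⟶ M) {n i i' : ℤ} (hi : i' = i + n) :
    (φ⟦n⟧').f i ≫ (CochainComplex.shiftFunctorObjXIso M n i i' hi).hom =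
      (CochainComplex.shiftFunctorObjXIso K n i i' hi).hom ≫ φ.f i' := by
  subst hi
  exact (Category.comp_id _).trans (Category.id_comp _).symm

omit [Preadditive C] in
lemma comp_comp_assoc {A B A' B' A'' B'' : C} {a : A ⟶ B} {d : B ⟶ B'} {a' : B' ⟶ A'}
    {b : B ⟶ B''} {e : B'' ⟶ A''} {b' : A'' ⟶ B'} (h : d = b ≫ e ≫ b') :
    a ≫ d ≫ a' = (a ≫ b) ≫ e ≫ (b' ≫ a') := by
  subst h
  simp

omit [Preadditive C] in
lemma comp_assoc₃ {A B B' D D' E E' : C} {f : A ⟶ B} {g : B ⟶ D} {e : D ⟶ D'} {e' : B ⟶ B'}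
    {g' : B' ⟶ D'} {a : D' ⟶ E} {b : B' ⟶ E'} {c : E' ⟶ E} (h : g ≫ e = e' ≫ g')
    (h' : g' ≫ a = b ≫ c) : ((f ≫ g) ≫ e) ≫ a = (f ≫ e' ≫ b) ≫ c := by
  simp only [Category.assoc, reassoc_of% h, h']

end TwoTerm

lemma mkHomToSingle_f_comp {K : CochainComplex (ShAb X) ℤ} {F : ShAb X} (φ : K.X 0 ⟶ F) (hφ) :
    (HomologicalComplex.mkHomToSingle φ hφ : K ⟶ single₀ F).f 0 ≫ (singleX F).hom = φ := by
  rw [HomologicalComplex.mkHomToSingle_f]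
  exact (Category.assoc _ _ _).trans
    ((congrArg _ (Iso.inv_hom_id _)).trans (Category.comp_id _))

/-! ### Čech 2-cocycles with values in `Ω^2 → Ω^{3,cl}`. -/

section FormCocycles

variable {O : CAlgSheaf X} {ι : Type u} {U : ι → Opens X}

variable (O) in
/-- The term of degree `-2` of the shifted complex of forms. -/
def shiftFormIso₀ : ((formComplex O)⟦((2 : ℕ) : ℤ)⟧).X (-((2 : ℕ) : ℤ)) ≅ (toShAb O).obj (Omega2 O) :=
  CochainComplex.shiftFunctorObjXIso (formComplex O) ((2 : ℕ) : ℤ) (-((2 : ℕ) : ℤ)) 0 (by norm_num) ≪≫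
    HomologicalComplex.doubleXIso₀ (extD O) _

variable (O) in
/-- The term of degree `-1` of the shifted complex of forms. -/
def shiftFormIso₁ : ((formComplex O)⟦((2 : ℕ) : ℤ)⟧).X (-((1 : ℕ) : ℤ)) ≅ Omega3cl O :=
  CochainComplex.shiftFunctorObjXIso (formComplex O) ((2 : ℕ) : ℤ) (-((1 : ℕ) : ℤ)) 1 (by norm_num) ≪≫
    HomologicalComplex.doubleXIso₁ (extD O) _ (by norm_num)

variable (O) in
lemma isZero_shiftForm (k : ℤ) (h : k ≠ -((2 : ℕ) : ℤ)) (h' : k ≠ -((1 : ℕ) : ℤ)) :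
    IsZero (((formComplex O)⟦((2 : ℕ) : ℤ)⟧).X k) :=
  HomologicalComplex.isZero_double_X (extD O) (c := ComplexShape.up ℤ) (i₀ := 0) (i₁ := 1) rfl
    (k + ((2 : ℕ) : ℤ)) (by push_cast at *; omega) (by push_cast at *; omega)

variable (O) in
lemma shiftForm_d : ((formComplex O)⟦((2 : ℕ) : ℤ)⟧).d (-((2 : ℕ) : ℤ)) (-((1 : ℕ) : ℤ)) =
    (shiftFormIso₀ O).hom ≫ extD O ≫ (shiftFormIso₁ O).inv := by
  refine (shift_d_eq (formComplex O) (by decide) (i' := 0) (j' := 1) (by norm_num)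
    (by norm_num)).trans ?_
  have h3 : (formComplex O).d 0 1 = _ := HomologicalComplex.double_d (extD O) _ (by norm_num)
  exact comp_comp_assoc h3

/-- The component in `Ω^2` of a Čech cocycle with values in the complex of forms. -/
def formComp₀ (f : cech U ⟶ (formComplex O)⟦((2 : ℕ) : ℤ)⟧) :
    (cech U).X (-((2 : ℕ) : ℤ)) ⟶ (toShAb O).obj (Omega2 O) :=
  f.f (-((2 : ℕ) : ℤ)) ≫ (shiftFormIso₀ O).hom

/-- The component in `Ω^{3,cl}` of a Čech cocycle with values in the complex of forms. -/
def formComp₁ (f : cech U ⟶ (formComplex O)⟦((2 : ℕ) : ℤ)⟧) :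
    (cech U).X (-((1 : ℕ) : ℤ)) ⟶ Omega3cl O :=
  f.f (-((1 : ℕ) : ℤ)) ≫ (shiftFormIso₁ O).hom

lemma formComp_ext {f g : cech U ⟶ (formComplex O)⟦((2 : ℕ) : ℤ)⟧}
    (h0 : formComp₀ f = formComp₀ g) (h1 : formComp₁ f = formComp₁ g) : f = g :=
  hom_ext_of_isZero (isZero_shiftForm O) ((cancel_mono (shiftFormIso₀ O).hom).1 h0)
    ((cancel_mono (shiftFormIso₁ O).hom).1 h1)

lemma exists_formCocycle (b : (cech U).X (-((2 : ℕ) : ℤ)) ⟶ (toShAb O).obj (Omega2 O))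
    (h : (cech U).X (-((1 : ℕ) : ℤ)) ⟶ Omega3cl O)
    (hb : (cech U).d (-((2 + 1 : ℕ) : ℤ)) (-((2 : ℕ) : ℤ)) ≫ b = 0)
    (hbh : b ≫ extD O = (cech U).d (-((1 + 1 : ℕ) : ℤ)) (-((1 : ℕ) : ℤ)) ≫ h) :
    ∃ f : cech U ⟶ (formComplex O)⟦((2 : ℕ) : ℤ)⟧, formComp₀ f = b ∧ formComp₁ f = h := by
  obtain ⟨f, hf0, hf1⟩ := exists_hom_of_isZero (K := cech U) (by norm_num) (isZero_shiftForm O)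
    (b ≫ (shiftFormIso₀ O).inv) (h ≫ (shiftFormIso₁ O).inv) (by
      rw [shiftForm_d, Category.assoc, Iso.inv_hom_id_assoc, ← Category.assoc, hbh, Category.assoc])
    (fun k hk => by
      obtain rfl : k = -((2 + 1 : ℕ) : ℤ) := by push_cast at *; omega
      rw [← Category.assoc, hb, zero_comp])
  refine ⟨f, ?_, ?_⟩
  · rw [formComp₀, hf0, Category.assoc, Iso.inv_hom_id, Category.comp_id]
  · rw [formComp₁, hf1, Category.assoc, Iso.inv_hom_id, Category.comp_id]

/-- The component of the image of a Čech cocycle of forms. -/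
lemma cechComp_formsToTensors (f : cech U ⟶ (formComplex O)⟦((2 : ℕ) : ℤ)⟧) :
    cechComp (f ≫ (formsToTensors O)⟦((2 : ℕ) : ℤ)⟧') = formComp₀ f ≫ antisymm O := by
  have h2 : (formsToTensors O).f 0 ≫ (singleX _).hom =
      (HomologicalComplex.doubleXIso₀ (extD O) _).hom ≫ antisymm O := mkHomToSingle_f_comp _ _
  have h3 := shift_map_f_comp (formsToTensors O) (n := ((2 : ℕ) : ℤ)) (i := -((2 : ℕ) : ℤ))
    (i' := 0) (by norm_num)
  exact comp_assoc₃ h3 h2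

end FormCocycles

end

section

variable {X : TopCat.{u}} {O : CAlgSheaf X}

namespace LieAlgebroid

/-! ### The first Pontryagin class -/

section Pontryagin

variable {A : LieAlgebroid O} {ι : Type u} {U : ι → Opens X}
  {D : ∀ i, MSec (homMod (tangent O) A.mod) (U i)} (hD : ∀ i, IsFlatConnection (D i))
  (p : A.InvariantPairing)

/-- The Atiyah cocycle is `-A_{ij}`, not `A_{ij}`, by the sign of the connecting map. The sign drops
out of the quadratic expressions below. -/
lemma toKer_eq_neg_connDiff {V : Opens X} (s : Simp U (0 + 1) V)
    {β : MSec (homMod (tangent O) A.g) V}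
    (h : mval (connCochain D) V ![s 1] - mval (connCochain D) V ![s 0] =
      -happ (homPost (tangent O) A.gι) V β) {W : Opens X} (hW : W ≤ V) (ξ : MSec (tangent O) W) :
    toKer (hval β hW ξ) =
      -connDiff hD ⟨(s 0).1, hW.trans (s 0).2⟩ ⟨(s 1).1, hW.trans (s 1).2⟩ ξ := by
  rw [mval_connCochain, mval_connCochain] at h
  have h3 := congrArg (fun f => hval f hW ξ) h
  change hval (D (s 1).1) _ ξ - hval (D (s 0).1) _ ξ = -happ A.gι W (hval β _ ξ) at h3
  refine Subtype.ext ?_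
  change happ A.gι W (hval β _ ξ) = -(hval (D (s 1).1) _ ξ - hval (D (s 0).1) _ ξ)
  rw [h3, neg_neg]

namespace InvariantPairing

lemma homPairSec_val {V : Opens X} (a b : MSec (homMod (tangent O) A.g) V) {W W' : Opens X}
    (hW : W ≤ V) (hW' : W' ≤ W) (ξ : MSec (tangent O) W) (η : MSec (tangent O) W') :
    hval (hval (p.homPairSec a b) hW ξ) hW' η =
      p.pair W' (toKer (hval a (hW'.trans hW) (mres _ hW' ξ))) (toKer (hval b (hW'.trans hW) η)) := by
  rw [← hval_nat a hW hW' ξ]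
  rfl

/-- Subtracting the cup cocycle from `½B` leaves the symmetrisation `½⟨A_{ij}, A_{jk}⟩ + ½⟨A_{jk},
A_{ij}⟩`. By polarisation with `A_{ik} = A_{ij} + A_{jk}`, this is the coboundary of `-½⟨A, A⟩`. -/
lemma half_formB_add {V : Opens X} (i j k : {i : ι // V ≤ U i}) (ξ η : MSec (tangent O) V) :
    O.scalar V (1 / 2) * p.formB hD i j k ξ η - -p.pair V (-connDiff hD i j ξ) (-connDiff hD j k η) =
      -(O.scalar V (1 / 2) * p.pair V (-connDiff hD j k ξ) (-connDiff hD j k η)) -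
        -(O.scalar V (1 / 2) * p.pair V (-connDiff hD i k ξ) (-connDiff hD i k η)) +
        -(O.scalar V (1 / 2) * p.pair V (-connDiff hD i j ξ) (-connDiff hD i j η)) := by
  have h2 : O.scalar V (1 / 2) + O.scalar V (1 / 2) = 1 := by
    rw [← map_add]
    norm_num
  rw [formB_eq, wedge, ← connDiff_trans hD i j k ξ, ← connDiff_trans hD i j k η]
  simp only [p.neg_pair, p.pair_neg, p.add_pair, p.pair_add, neg_neg]
  rw [p.symm V (connDiff hD j k ξ) (connDiff hD i j η)]
  linear_combination -p.pair V (connDiff hD i j ξ) (connDiff hD j k η) * h2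

/-- The section `-½⟨a, a⟩`. -/
def negHalfSec {V : Opens X} (a : MSec (homMod (tangent O) A.g) V) :
    MSec (homMod (tangent O) (Omega1 O)) V :=
  -(O.scalar V (1 / 2) • p.homPairSec a a)

lemma mres_negHalfSec {V W : Opens X} (h : W ≤ V) (a : MSec (homMod (tangent O) A.g) V) :
    mres _ h (p.negHalfSec a) = p.negHalfSec (mres _ h a) := by
  have h1 : O.res h (O.scalar V (1 / 2)) = O.scalar W (1 / 2) := O.scalar_res _ _ _ _
  rw [negHalfSec, map_neg, mres_smul, h1]
  rfl

lemma negHalfSec_val {V : Opens X} (a : MSec (homMod (tangent O) A.g) V) {W W' : Opens X}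
    (hW : W ≤ V) (hW' : W' ≤ W) (ξ : MSec (tangent O) W) (η : MSec (tangent O) W') :
    hval (hval (p.negHalfSec a) hW ξ) hW' η =
      -(O.scalar W' (1 / 2) * p.pair W' (toKer (hval a (hW'.trans hW) (mres _ hW' ξ)))
        (toKer (hval a (hW'.trans hW) η))) := by
  have h1 : O.res hW' (O.res hW (O.scalar V (1 / 2))) = O.scalar W' (1 / 2) := by
    have e : O.res hW (O.scalar V (1 / 2)) = O.scalar W (1 / 2) := O.scalar_res _ _ _ _
    rw [e]
    exact O.scalar_res _ _ _ _
  rw [← h1, ← homPairSec_val]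
  rfl

section Classes

open DerivedCategory

variable [HasDerivedCategory.{w1} (ShAb X)]

/-- The definition evaluates forms only over the whole open set of the simplex. Their values over a
smaller open set are recovered by restricting the simplex. -/
lemma isPontryagin_iff (P : HyperH (formComplex O) 2) : p.IsPontryagin hD P ↔
    ∃ f : cech U ⟶ (formComplex O)⟦((2 : ℕ) : ℤ)⟧, Represents f P ∧
      formComp₀ f = p.cochainB hD ∧ formComp₁ f = p.cochainH hD := by
  refine exists_congr fun f => and_congr_right fun _ => and_congr ?_ ?_
  · constructor
    · intro h
      refine mval_ext (M := Omega2 O) fun V s => Eq.trans ?_ (p.mval_cochainB hD V s).symm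
      refine fam_ext (P := form2Cond O) fun W hW x => ?_
      refine Eq.trans ?_ (h W (simpRes hW s) x.1 x.2)
      have e := mres_mval (M := Omega2 O) (formComp₀ f) hW s
      exact congrArg (fun ω => val2 ω le_rfl x) e
    · intro h V s ξ η
      have e : mval (M := Omega2 O) (formComp₀ f) V s = p.secB hD V s :=
        (congrArg (fun t => mval (M := Omega2 O) t V s) h).trans (p.mval_cochainB hD V s)
      exact congrArg (fun ω => val2 ω le_rfl (ξ, η)) e
  · constructor
    · intro h
      refine cechX_hom_ext fun V s => Eq.trans ?_ (p.sapp_cochainH hD V s).symm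
      refine fam_ext (P := closed3Cond O) fun W hW x => ?_
      refine Eq.trans ?_ (h W (simpRes hW s) x.1 x.2.1 x.2.2)
      have e := (sapp_sres (formComp₁ f) hW _).symm.trans
        (congrArg (sapp (formComp₁ f) W) (sres_cechGen 1 hW s))
      exact congrArg (fun ω => val3 ω le_rfl x) e
    · intro h V s ξ η ζ
      have e : sapp (formComp₁ f) V (cechGen U 1 V s) = p.secH hD V s :=
        (congrArg (fun t => sapp t V (cechGen U 1 V s)) h).trans (p.sapp_cochainH hD V s)
      exact congrArg (fun ω => val3 ω le_rfl (ξ, η, ζ)) e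

/-- The forms `B` and `H` are the components of a unique class. -/
theorem existsUnique_isPontryagin (hU : iSup U = ⊤) :
    ∃! P : HyperH (formComplex O) 2, p.IsPontryagin hD P := by
  obtain ⟨f, hf0, hf1⟩ := exists_formCocycle _ _ (p.d_cochainB hD) (p.cochainB_extD hD)
  obtain ⟨P, hP⟩ := exists_represents f hU
  refine ⟨P, (p.isPontryagin_iff hD P).2 ⟨f, hP, hf0, hf1⟩, fun P' hP' => ?_⟩
  obtain ⟨f', hf', h0, h1⟩ := (p.isPontryagin_iff hD P').1 hP'
  -- The shifted complex has two nonzero terms, so `B` and `H` determine the cocycle and hence its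
  -- class.
  obtain rfl : f' = f := formComp_ext (h0.trans hf0.symm) (h1.trans hf1.symm)
  exact hf'.unique hU hP

/-- The image of the first Pontryagin class is the class of the 2-extension. -/
theorem map_eq_betaClass [HasExt.{w} O.Mod] (hT : IsLocallyFree (tangent O)) (hA : A.IsTransitive)
    (hU : iSup U = ⊤) {P : HyperH (formComplex O) 2} (hP : p.IsPontryagin hD P) :
    HyperH.map (formsToTensors O) P = toHyperH (betaClass hT hA p) := by
  obtain ⟨f, hf, h0, -⟩ := (p.isPontryagin_iff hD P).1 hP
  -- The Atiyah cocycle is taken from the given flat connections, so that `B` and the cup square are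
  -- written in the same `A_{ij}`.
  obtain ⟨b, hb, hbv⟩ := represents_atiyahClass (hT := hT) (hA := hA) _
    (connCochain_anchor (D := D) fun i V hV ξ => (hD i).anchor V hV ξ)
  obtain ⟨c, hc, hcv⟩ := exists_represents_betaClass p hU hb hb
  let β : ∀ (V : Opens X) (s : Simp U (0 + 1) V), MSec (homMod (tangent O) A.g) V :=
    fun V s => mval (M := homMod (tangent O) A.g) (cechComp b) V s
  have hβ : ∀ (V : Opens X) (i j : {i : ι // V ≤ U i}) (W : Opens X) (hW : W ≤ V)
      (ξ : MSec (tangent O) W), toKer (hval (β V ![i, j]) hW ξ) =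
        -connDiff hD ⟨i.1, hW.trans i.2⟩ ⟨j.1, hW.trans j.2⟩ ξ := fun V i j W hW ξ =>
    toKer_eq_neg_connDiff hD ![i, j] (hbv V ![i, j]) hW ξ
  -- The 1-cochain `-½⟨A_{ij}, A_{ij}⟩`, whose coboundary is the difference between `½B` and the cup
  -- square.
  obtain ⟨w, hw⟩ : ∃ w : (cech U).X (-((0 + 1 : ℕ) : ℤ)) ⟶
      (toShAb O).obj (homMod (tangent O) (Omega1 O)), ∀ V s, mval w V s = p.negHalfSec (β V s) :=
    ⟨mdesc (0 + 1) (fun V s => p.negHalfSec (β V s))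
      (fun V W h s => (p.mres_negHalfSec h _).trans (congrArg p.negHalfSec
        (mres_mval (M := homMod (tangent O) A.g) (cechComp b) h s))), mval_mdesc _ _⟩
  refine (hf.map (formsToTensors O)).unique hU (hc.of_coboundary (n := 1) w
    (mval_ext (M := homMod (tangent O) (Omega1 O)) (p := 0 + 1 + 1) fun V s => ?_))
  have h1 : mval (M := homMod (tangent O) (Omega1 O)) (p := 0 + 1 + 1)
      (cechComp (f ≫ (formsToTensors O)⟦((2 : ℕ) : ℤ)⟧')) V s = halfSec (p.secB hD V s) :=
    (congrArg (fun t => mval (M := homMod (tangent O) (Omega1 O)) (p := 2) t V s)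
      ((cechComp_formsToTensors f).trans (congrArg (· ≫ antisymm O) h0))).trans
      (congrArg halfSec (p.mval_cochainB hD V s))
  refine (congrArg₂ HSub.hSub h1 (hcv V s)).trans (Eq.trans ?_ (mval_d_one w V s).symm)
  rw [hw, hw, hw]
  refine hom_sec_ext fun W hW ξ => hom_sec_ext fun W' hW' η => ?_
  have e := p.homPairSec_val (β V ![s 0, s 1]) (β V ![s 1, s 2]) hW hW' ξ η
  have e1 := fun i j => p.negHalfSec_val (β V ![s i, s j]) hW hW' ξ η
  simp only [hβ] at e e1
  refine (congrArg (fun t => O.scalar W' (1 / 2) * p.formB hD _ _ _ (mres _ hW' ξ) η - -t) e).trans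
    ((p.half_formB_add hD _ _ _ (mres _ hW' ξ) η).trans ?_)
  exact (congrArg₂ (fun a b : O.Sec W' => a + b) (congrArg₂ (fun a b : O.Sec W' => a - b)
    (e1 1 2) (e1 0 2)) (e1 0 1)).symm

end Classes

end InvariantPairing

end Pontryagin

end LieAlgebroid

end

end AtiyahPontryagin

end

theorem mainTheorem8 {X : TopCat.{u}} (O : CAlgSheaf X) (hT : IsLocallyFree (tangent O))
    (A : LieAlgebroid O) (_hAfree : IsLocallyFree A.mod) (hA : A.IsTransitive)
    (p : A.InvariantPairing)
    [HasExt.{w} O.Mod] [HasDerivedCategory.{w1} (ShAb X)] :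
    (∀ z : Sheaf.H ((homFunctor (tangent O)).obj (Omega1 O)) 2,
      IsCup p.homPair (p := 1) (q := 1) rfl (atiyahClass hT hA) (atiyahClass hT hA) z ↔
        z = betaClass hT hA p) ∧
    ∀ (ι : Type u) (U : ι → Opens X) (_ : iSup U = ⊤)
      (D : ∀ i, MSec (homMod (tangent O) A.mod) (U i))
      (hD : ∀ i, LieAlgebroid.IsFlatConnection (D i)),
      (∃! P : HyperH (formComplex O) 2, p.IsPontryagin hD P) ∧
        ∀ P : HyperH (formComplex O) 2, p.IsPontryagin hD P →
          HyperH.map (formsToTensors O) P = toHyperH (betaClass hT hA p) := by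
  exact ⟨fun z => LieAlgebroid.isCup_iff hT hA p z, fun ι U hU D hD =>
    ⟨p.existsUnique_isPontryagin hD hU, fun P hP => p.map_eq_betaClass hD hT hA hU hP⟩⟩
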